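/- For $\ell\ge 0$ let $\beta(x,y)=x^{T}S_{2\ell}\,y$ be the symmetric bilinear form on $\mathbb{C}^{2\ell}$, where $S_{2\ell}$ is the permutation matrix with $S_{2\ell}e_i=e_{2\ell+1-i}$. Let $$SO(2\ell)=\{g\in SL(2\ell,\mathbb{C}) : \beta(gx,gy)=\beta(x,y)\ \forall x,y\},\qquad \mathfrak{so}(2\ell)=\{Z\in\mathfrak{gl}(2\ell,\mathbb{C}) : \beta(Zx,y)=-\beta(x,Zy)\ \forall x,y\},$$ and let $\mathcal{B}_{\mathfrak{so}(2\ell)}$ be the set of all Borel subalgebras (maximal solvable Lie subalgebras) of $\mathfrak{so}(2\ell)$, on which $SO(2\ell)$ acts by $\mathrm{Ad}(g)X=gXg^{-1}$. Let $SO(2\ell-1)\subset SO(2\ell)$ be the subgroup of elements fixing the vector $e_{\ell}-e_{\ell+1}$ (for $\ell=0$ it is the trivial group), and let $B_{SO(2\ell-1)}$ be its standard Borel subgroup, i.e. the group of upper triangular matrices in $SO(2\ell-1)$. Then for every $\ell\ge 0$ the set $B_{SO(2\ell-1)}\backslash\mathcal{B}_{\mathfrak{so}(2\ell)}$ of $B_{SO(2\ell-1)}$-orbits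 on $\mathcal{B}_{\mathfrak{so}(2\ell)}$ is finite, and the exponential generating function of the sequence of its cardinalities is $$\sum_{\ell\ge 0}\bigl|B_{SO(2\ell-1)}\backslash\mathcal{B}_{\mathfrak{so}(2\ell)}\bigr|\,\frac{x^{\ell}}{\ell!}=e^{\frac{x}{1-2x}}$$ as formal power series over $\mathbb{C}$. -/

import Mathlib

open scoped Matrix PowerSeries Nat

attribute [local instance] LieRing.ofAssociativeRing

noncomputable section

namespace OrthFlag

/-- The matrix `S_n` with `S_n e_i = e_{n+1-i}`; it is the Gram matrix of the symmetric bilinear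
form `β(x, y) = xᵀ S_n y` on `ℂⁿ`. -/
def antidiag (n : ℕ) : Matrix (Fin n) (Fin n) ℂ :=
  Matrix.of fun i j => if i = Fin.rev j then 1 else 0

/-- The symmetric bilinear form `β(x, y) = xᵀ S_n y` on `ℂⁿ`. -/
def beta (n : ℕ) (x y : Fin n → ℂ) : ℂ :=
  x ⬝ᵥ (antidiag n *ᵥ y)

/-- `β(Ax, y) = β(x, By)` for all `x, y` is the matrix identity `Aᵀ S_n = S_n B`. -/
theorem beta_adjoint_iff {n : ℕ} (A B : Matrix (Fin n) (Fin n) ℂ) :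
    (∀ x y, beta n (A *ᵥ x) y = beta n x (B *ᵥ y)) ↔ Aᵀ * antidiag n = antidiag n * B := by
  have h1 : ∀ x y, beta n (A *ᵥ x) y = x ⬝ᵥ ((Aᵀ * antidiag n) *ᵥ y) := by
    intro x y
    rw [beta, ← Matrix.vecMul_transpose, ← Matrix.dotProduct_mulVec, Matrix.mulVec_mulVec]
  have h2 : ∀ x y, beta n x (B *ᵥ y) = x ⬝ᵥ ((antidiag n * B) *ᵥ y) := by
    intro x y
    rw [beta, Matrix.mulVec_mulVec]
  simp only [h1, h2]
  constructor
  · intro h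
    ext i j
    simpa using h (Pi.single i 1) (Pi.single j 1)
  · intro h x y
    rw [h]

/-- The special orthogonal group
`SO(n) = {g ∈ SL(n, ℂ) : β(gx, gy) = β(x, y) for all x, y}`. -/
def SO (n : ℕ) : Subgroup (Matrix.SpecialLinearGroup (Fin n) ℂ) where
  carrier := {g | ∀ x y, beta n ((g : Matrix (Fin n) (Fin n) ℂ) *ᵥ x)
    ((g : Matrix (Fin n) (Fin n) ℂ) *ᵥ y) = beta n x y}
  one_mem' := by intro x y; simp
  mul_mem' := by
    intro g h hg hh x y
    rw [Matrix.SpecialLinearGroup.coe_mul, ← Matrix.mulVec_mulVec, ← Matrix.mulVec_mulVec,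
      hg, hh]
  inv_mem' := by
    intro g hg x y
    have key : ∀ z, (g : Matrix (Fin n) (Fin n) ℂ) *ᵥ
        (((g⁻¹ : Matrix.SpecialLinearGroup (Fin n) ℂ) : Matrix (Fin n) (Fin n) ℂ) *ᵥ z) = z := by
      intro z
      rw [Matrix.mulVec_mulVec, ← Matrix.SpecialLinearGroup.coe_mul, mul_inv_cancel,
        Matrix.SpecialLinearGroup.coe_one, Matrix.one_mulVec]
    rw [← hg (((g⁻¹ : Matrix.SpecialLinearGroup (Fin n) ℂ) : Matrix (Fin n) (Fin n) ℂ) *ᵥ x),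
      key, key]

/-- The matrix of an element of `SO(n)`. -/
def mat {n : ℕ} (g : SO n) : Matrix (Fin n) (Fin n) ℂ :=
  ((g : Matrix.SpecialLinearGroup (Fin n) ℂ) : Matrix (Fin n) (Fin n) ℂ)

theorem mat_one {n : ℕ} : mat (1 : SO n) = 1 := by
  simp [mat]

theorem mat_mul {n : ℕ} (g h : SO n) : mat (g * h) = mat g * mat h := by
  simp [mat]

theorem beta_mat {n : ℕ} (g : SO n) (x y : Fin n → ℂ) :
    beta n (mat g *ᵥ x) (mat g *ᵥ y) = beta n x y :=
  g.2 x y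

theorem mat_inv_mul {n : ℕ} (g : SO n) : mat g⁻¹ * mat g = 1 := by
  rw [← mat_mul, inv_mul_cancel, mat_one]

theorem mat_mul_inv {n : ℕ} (g : SO n) : mat g * mat g⁻¹ = 1 := by
  rw [← mat_mul, mul_inv_cancel, mat_one]

/-- The orthogonal Lie algebra
`𝔰𝔬(n) = {Z ∈ 𝔤𝔩(n, ℂ) : β(Zx, y) = -β(x, Zy) for all x, y}`. -/
def so (n : ℕ) : LieSubalgebra ℂ (Matrix (Fin n) (Fin n) ℂ) :=
  skewAdjointMatricesLieSubalgebra (antidiag n)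

theorem mem_so_iff {n : ℕ} (Z : Matrix (Fin n) (Fin n) ℂ) :
    Z ∈ so n ↔ ∀ x y, beta n (Z *ᵥ x) y = -beta n x (Z *ᵥ y) := by
  have h : Z ∈ so n ↔ Zᵀ * antidiag n = antidiag n * (-Z) := by
    rw [so, mem_skewAdjointMatricesLieSubalgebra, mem_skewAdjointMatricesSubmodule]
    rfl
  have e : ∀ x y, beta n x ((-Z) *ᵥ y) = -beta n x (Z *ᵥ y) := by
    intro x y
    simp [beta, Matrix.neg_mulVec, Matrix.mulVec_neg]
  rw [h, ← beta_adjoint_iff]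
  simp only [e]

theorem conj_mem_so {n : ℕ} (g : SO n) {X : Matrix (Fin n) (Fin n) ℂ} (hX : X ∈ so n) :
    mat g * X * mat g⁻¹ ∈ so n := by
  rw [mem_so_iff] at hX ⊢
  have key : ∀ z, mat g *ᵥ (mat g⁻¹ *ᵥ z) = z := by
    intro z
    rw [Matrix.mulVec_mulVec, mat_mul_inv, Matrix.one_mulVec]
  intro x y
  rw [← Matrix.mulVec_mulVec, ← Matrix.mulVec_mulVec, ← Matrix.mulVec_mulVec,
    ← Matrix.mulVec_mulVec]
  have h1 := beta_mat g (X *ᵥ (mat g⁻¹ *ᵥ x)) (mat g⁻¹ *ᵥ y)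
  have h2 := beta_mat g (mat g⁻¹ *ᵥ x) (X *ᵥ (mat g⁻¹ *ᵥ y))
  rw [key] at h1 h2
  rw [h1, h2]
  exact hX _ _

/-- The adjoint action `Ad(g) X = g X g⁻¹` of `SO(n)` on `𝔰𝔬(n)`. -/
def Ad {n : ℕ} (g : SO n) : so n ≃ₗ⁅ℂ⁆ so n where
  toFun X := ⟨mat g * X.1 * mat g⁻¹, conj_mem_so g X.2⟩
  map_add' X Y := by
    apply Subtype.ext
    simp [mul_add, add_mul]
  map_smul' c X := by
    apply Subtype.ext
    simp
  map_lie' := by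
    intro X Y
    apply Subtype.ext
    simp only [LieSubalgebra.coe_bracket, LieRing.of_associative_ring_bracket]
    have h := mat_inv_mul g
    have e : ∀ P Q : Matrix (Fin n) (Fin n) ℂ,
        mat g * P * mat g⁻¹ * (mat g * Q * mat g⁻¹) = mat g * (P * Q) * mat g⁻¹ := by
      intro P Q
      calc mat g * P * mat g⁻¹ * (mat g * Q * mat g⁻¹)
          = mat g * P * (mat g⁻¹ * mat g) * Q * mat g⁻¹ := by simp only [mul_assoc]
        _ = mat g * (P * Q) * mat g⁻¹ := by rw [h]; simp only [mul_assoc, mul_one]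
    rw [e, e, mul_sub, sub_mul]
  invFun X := ⟨mat g⁻¹ * X.1 * mat g, by simpa using conj_mem_so g⁻¹ X.2⟩
  left_inv X := by
    apply Subtype.ext
    change mat g⁻¹ * (mat g * X.1 * mat g⁻¹) * mat g = X.1
    calc mat g⁻¹ * (mat g * X.1 * mat g⁻¹) * mat g
        = (mat g⁻¹ * mat g) * X.1 * (mat g⁻¹ * mat g) := by simp only [mul_assoc]
      _ = X.1 := by rw [mat_inv_mul]; simp
  right_inv X := by
    apply Subtype.ext
    change mat g * (mat g⁻¹ * X.1 * mat g) * mat g⁻¹ = X.1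
    calc mat g * (mat g⁻¹ * X.1 * mat g) * mat g⁻¹
        = (mat g * mat g⁻¹) * X.1 * (mat g * mat g⁻¹) := by simp only [mul_assoc]
      _ = X.1 := by rw [mat_mul_inv]; simp

theorem Ad_apply {n : ℕ} (g : SO n) (X : so n) :
    (Ad g X : Matrix (Fin n) (Fin n) ℂ) = mat g * X.1 * mat g⁻¹ := rfl

theorem Ad_one {n : ℕ} (X : so n) : Ad (1 : SO n) X = X := by
  apply Subtype.ext
  rw [Ad_apply, inv_one, mat_one, one_mul, mul_one]

theorem Ad_mul {n : ℕ} (g h : SO n) (X : so n) : Ad (g * h) X = Ad g (Ad h X) := by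
  apply Subtype.ext
  rw [Ad_apply, Ad_apply, Ad_apply, mul_inv_rev, mat_mul, mat_mul]
  simp only [mul_assoc]

/-- A Borel subalgebra of a complex Lie algebra: a maximal solvable Lie subalgebra. -/
def IsBorel {L : Type*} [LieRing L] [LieAlgebra ℂ L] (b : LieSubalgebra ℂ L) : Prop :=
  Maximal (fun c : LieSubalgebra ℂ L => LieAlgebra.IsSolvable c) b

theorem map_mono {L : Type*} [LieRing L] [LieAlgebra ℂ L] (f : L →ₗ⁅ℂ⁆ L)
    {b c : LieSubalgebra ℂ L} (h : b ≤ c) : b.map f ≤ c.map f := by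
  intro X hX
  rw [LieSubalgebra.mem_map] at hX ⊢
  obtain ⟨Y, hY, rfl⟩ := hX
  exact ⟨Y, h hY, rfl⟩

/-- The flag variety `𝓑_{𝔰𝔬(n)}`: the set of all Borel subalgebras of `𝔰𝔬(n)`. -/
def FlagVariety (n : ℕ) : Type :=
  {b : LieSubalgebra ℂ (so n) // IsBorel b}

theorem isSolvable_map_Ad {n : ℕ} (g : SO n) (c : LieSubalgebra ℂ (so n))
    (hc : LieAlgebra.IsSolvable c) :
    LieAlgebra.IsSolvable (c.map (Ad g).toLieHom) :=
  (LieAlgebra.solvable_iff_equiv_solvable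
    (LieEquiv.ofSubalgebras c (c.map (Ad g).toLieHom) (Ad g) rfl)).1 hc

theorem map_Ad_mul {n : ℕ} (g h : SO n) (c : LieSubalgebra ℂ (so n)) :
    c.map (Ad (g * h)).toLieHom = (c.map (Ad h).toLieHom).map (Ad g).toLieHom := by
  ext X
  simp only [LieSubalgebra.mem_map]
  constructor
  · rintro ⟨Y, hY, rfl⟩
    exact ⟨Ad h Y, ⟨Y, hY, rfl⟩, (Ad_mul g h Y).symm⟩
  · rintro ⟨_, ⟨Y, hY, rfl⟩, rfl⟩
    exact ⟨Y, hY, Ad_mul g h Y⟩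

theorem map_Ad_one {n : ℕ} (c : LieSubalgebra ℂ (so n)) :
    c.map (Ad (1 : SO n)).toLieHom = c := by
  ext X
  simp only [LieSubalgebra.mem_map]
  constructor
  · rintro ⟨Y, hY, rfl⟩
    have : (Ad (1 : SO n)).toLieHom Y = Y := Ad_one Y
    rwa [this]
  · intro hX
    exact ⟨X, hX, Ad_one X⟩

theorem IsBorel.map_Ad {n : ℕ} (g : SO n) {b : LieSubalgebra ℂ (so n)} (hb : IsBorel b) :
    IsBorel (b.map (Ad g).toLieHom) := by
  refine ⟨isSolvable_map_Ad g b hb.1, fun c hc hle => ?_⟩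
  have h1 : b ≤ c.map (Ad g⁻¹).toLieHom := by
    have := map_mono (Ad g⁻¹).toLieHom hle
    rwa [← map_Ad_mul, inv_mul_cancel, map_Ad_one] at this
  have h2 := hb.2 (isSolvable_map_Ad g⁻¹ c hc) h1
  have h3 := map_mono (Ad g).toLieHom h2
  rwa [← map_Ad_mul, mul_inv_cancel, map_Ad_one] at h3

/-- `SO(n)` acts on its flag variety through the adjoint action, `g • 𝔟 = Ad(g) 𝔟`. -/
instance (n : ℕ) : MulAction (SO n) (FlagVariety n) where
  smul g b := ⟨b.1.map (Ad g).toLieHom, b.2.map_Ad g⟩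
  one_smul b := Subtype.ext (map_Ad_one b.1)
  mul_smul g h b := Subtype.ext (map_Ad_mul g h b.1)

/-- The standard Borel subgroup `B_n ⊆ SO(n)` of upper triangular matrices. -/
def upperBorel (n : ℕ) : Subgroup (SO n) where
  carrier := {g | ∀ i j : Fin n, j < i → mat g i j = 0}
  one_mem' := by
    intro i j hij
    rw [mat_one, Matrix.one_apply_ne hij.ne']
  mul_mem' := by
    intro g h hg hh i j hij
    rw [mat_mul, Matrix.mul_apply]
    refine Finset.sum_eq_zero fun k _ => ?_
    by_cases hk : k < i
    · rw [hg i k hk, zero_mul]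
    · rw [hh k j (lt_of_lt_of_le hij (not_lt.1 hk)), mul_zero]
  inv_mem' := by
    intro g hg
    have hg' : (mat g).BlockTriangular id := fun i j hij => hg i j hij
    have e : mat g⁻¹ = (mat g)⁻¹ := (Matrix.inv_eq_right_inv (mat_mul_inv g)).symm
    have : Invertible (mat g) := ⟨mat g⁻¹, mat_inv_mul g, mat_mul_inv g⟩
    intro i j hij
    rw [e]
    exact Matrix.blockTriangular_inv_of_blockTriangular hg' hij

/-- The vector `e_ℓ - e_{-ℓ} = e_ℓ - e_{ℓ+1}` of `ℂ^{2ℓ}` (indices of `Fin` start at `0`);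
for `ℓ = 0` it is the only vector of `ℂ⁰`. -/
def middleVec (l : ℕ) : Fin (2 * l) → ℂ :=
  fun i => if (i : ℕ) + 1 = l then 1 else if (i : ℕ) = l then -1 else 0

/-- The subgroup `K = SO(2ℓ-1)` of `SO(2ℓ)`: the elements fixing the anisotropic vector
`e_ℓ - e_{-ℓ}`. Such an element preserves the orthogonal complement
`span {e_{±1}, …, e_{±(ℓ-1)}, e_ℓ + e_{-ℓ}}`, a nondegenerate space of dimension `2ℓ-1`, and `K`
is the group of all isometries of determinant `1` of that space. -/
def SOsub (l : ℕ) : Subgroup (SO (2 * l)) where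
  carrier := {g | mat g *ᵥ middleVec l = middleVec l}
  one_mem' := by simp [mat_one]
  mul_mem' := by
    intro g h hg hh
    have hg' : mat g *ᵥ middleVec l = middleVec l := hg
    have hh' : mat h *ᵥ middleVec l = middleVec l := hh
    change mat (g * h) *ᵥ middleVec l = middleVec l
    rw [mat_mul, ← Matrix.mulVec_mulVec, hh', hg']
  inv_mem' := by
    intro g hg
    have hg' : mat g *ᵥ middleVec l = middleVec l := hg
    change mat g⁻¹ *ᵥ middleVec l = middleVec l
    conv_lhs => rw [← hg']
    rw [Matrix.mulVec_mulVec, mat_inv_mul, Matrix.one_mulVec]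

/-- The Borel subgroup `B_{SO(2ℓ-1)} = K ∩ B_{2ℓ}` of `K = SO(2ℓ-1)`. -/
def borelSub (l : ℕ) : Subgroup (SO (2 * l)) :=
  SOsub l ⊓ upperBorel (2 * l)

/-- The set `B_{SO(2ℓ-1)} \ 𝓑_{𝔰𝔬(2ℓ)}` of orbits of `B_{SO(2ℓ-1)}` on the flag variety of
`𝔰𝔬(2ℓ)`. -/
abbrev Orbits (l : ℕ) : Type :=
  MulAction.orbitRel.Quotient (borelSub l) (FlagVariety (2 * l))

/-- The exponential generating function `∑ f(n) xⁿ / n!` of a sequence `f`. -/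
def egf (f : ℕ → ℂ) : ℂ⟦X⟧ :=
  PowerSeries.mk fun n => f n / (n ! : ℂ)

end OrthFlag

end

set_option linter.unusedSectionVars false

/-! Orbits become isometry classes of linear-algebra data, which are then counted by a recursion on
the dimension. The Borel subalgebras of so(2ℓ) form SO(2ℓ)/B with B upper triangular: a solvable
subalgebra stabilises a complete isotropic flag by Lie's theorem (`exists_stable_flag`,
`exists_conj_isUpper`), and the stabiliser of `stdBorel` is B (`isUpper_of_smul_stdPoint`). Complete
isotropic flags form two copies of SO(2ℓ)/B, since O(2ℓ) is transitive on them and an orthogonal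
upper triangular matrix has determinant 1. The vector `middleVec` and the standard flag E of its
orthogonal complement are also fixed by an element of determinant -1, namely `-midSwap`, which
exchanges the two copies. Hence the orbits correspond to isometry classes of triples (u, E, F): u of
norm -2, E a complete isotropic flag of u^⊥, F one of the whole space.

These triples make sense in every dimension and are reduced through the line F 1. If it is not
orthogonal to u, it contains a vector v with v - u in u^⊥ and of norm opposite to that of u; then
u^⊥ with the vector v - u, the flag F cut by u^⊥ and the flag E is a triple in one dimension less,
the two flags having exchanged roles. If F 1 = ⟨p⟩ is orthogonal to u, then p belongs to a
hyperbolic pair (p, q) in u^⊥ adapted to E: one of p, q spans a jump of E. Removing the pair leaves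
a triple in two dimensions less, and the invariants lost are the position i of the jump and the
choice between p and q. `Code` records these choices: `Config.Good.exists_hasType` and
`exists_hasType_of_code` show that every triple has a code and every code occurs, `HasType.dom` and
`HasType.eq_of_dom` that the code is a complete invariant.

In dimension 2ℓ+2 there are ℓ jumps in E, in dimension 2ℓ+3 there are ℓ+1. So the numbers P of codes
in dimension 2ℓ and Q in dimension 2ℓ+1 satisfy P(ℓ+1) = Q(ℓ) + 2ℓ P(ℓ) and Q(ℓ+1) = P(ℓ+1) + 2(ℓ+1)
Q(ℓ). For the generating function A of P this says (1-2x)² A' = A with A(0) = 1, whose solution is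
exp(x/(1-2x)). -/

namespace OrthFlag

open Module Submodule LinearMap

/-! ### Symmetric bilinear forms and isotropic flags: inserting and removing a step -/

section Forms

variable {V : Type*} [AddCommGroup V] [Module ℂ V]

/-- The form `B` is nondegenerate on the subspace `U`. -/
def NondegOn (B : LinearMap.BilinForm ℂ V) (U : Submodule ℂ V) : Prop :=
  ∀ x ∈ U, (∀ y ∈ U, B x y = 0) → x = 0

/-- A chain of `B`-isotropic subspaces of dimensions `0, 1, …, r`, constant from then on. -/
structure IsFlag (B : LinearMap.BilinForm ℂ V) (r : ℕ) (F : ℕ → Submodule ℂ V) : Prop where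
  mono : Monotone F
  finrank_eq : ∀ j, finrank ℂ (F j) = min j r
  isotropic : ∀ j, ∀ x ∈ F j, ∀ y ∈ F j, B x y = 0

/-- Insert the vector `s` into the chain `E` just after its `i`-th member. -/
def ins (i : ℕ) (s : V) (E : ℕ → Submodule ℂ V) (j : ℕ) : Submodule ℂ V :=
  if j ≤ i then E j else span ℂ {s} ⊔ E (j - 1)

/-- Remove the `i`-th step of the chain `E` by cutting the later members with `ker f`. -/
def peel (i : ℕ) (f : V →ₗ[ℂ] ℂ) (E : ℕ → Submodule ℂ V) (j : ℕ) : Submodule ℂ V :=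
  if j < i then E j else E (j + 1) ⊓ ker f

theorem sup_inf_ker {W : Submodule ℂ V} {s : V} {f : V →ₗ[ℂ] ℂ} (hs : s ∈ W) (hf : f s ≠ 0) :
    span ℂ {s} ⊔ W ⊓ ker f = W := by
  apply le_antisymm
  · exact sup_le ((span_singleton_le_iff_mem _ _).2 hs) inf_le_left
  · intro x hx
    rw [mem_sup]
    refine ⟨(f x / f s) • s, smul_mem _ _ (mem_span_singleton_self s), x - (f x / f s) • s,
      ⟨sub_mem hx (smul_mem _ _ hs), ?_⟩, by abel⟩
    simp [hf]

theorem mem_span_sup_iff {W : Submodule ℂ V} {s x : V} :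
    x ∈ span ℂ {s} ⊔ W ↔ ∃ a : ℂ, ∃ w ∈ W, x = a • s + w := by
  rw [mem_sup]
  constructor
  · rintro ⟨y, hy, w, hw, rfl⟩
    obtain ⟨a, rfl⟩ := mem_span_singleton.1 hy
    exact ⟨a, w, hw, rfl⟩
  · rintro ⟨a, w, hw, rfl⟩
    exact ⟨a • s, smul_mem _ _ (mem_span_singleton_self s), w, hw, rfl⟩

variable [FiniteDimensional ℂ V]

theorem finrank_span_sup {W : Submodule ℂ V} {s : V} (hs : s ∉ W) :
    finrank ℂ ↥(span ℂ {s} ⊔ W) = finrank ℂ W + 1 := by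
  have hs0 : s ≠ 0 := fun h => hs (h ▸ W.zero_mem)
  have h := finrank_sup_add_finrank_inf_eq (span ℂ {s}) W
  have hd : span ℂ {s} ⊓ W = ⊥ := by
    rw [eq_bot_iff]
    rintro x ⟨hx, hxW⟩
    obtain ⟨a, rfl⟩ := mem_span_singleton.1 hx
    by_cases ha : a = 0
    · simp [ha]
    · exact absurd ((W.smul_mem_iff ha).1 hxW) hs
  rw [hd, finrank_bot, finrank_span_singleton hs0] at h
  omega

theorem finrank_inf_ker {W : Submodule ℂ V} {s : V} {f : V →ₗ[ℂ] ℂ} (hs : s ∈ W) (hf : f s ≠ 0) :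
    finrank ℂ ↥(W ⊓ ker f) + 1 = finrank ℂ W := by
  have h : s ∉ W ⊓ ker f := fun h => hf h.2
  rw [← finrank_span_sup h, sup_inf_ker hs hf]

variable {B : LinearMap.BilinForm ℂ V} {U : Submodule ℂ V}

theorem NondegOn.exists_repr (h : NondegOn B U) (f : V →ₗ[ℂ] ℂ) :
    ∃ q ∈ U, ∀ x ∈ U, B q x = f x := by
  let T : U →ₗ[ℂ] Dual ℂ U := B.compl₁₂ U.subtype U.subtype
  have hT : Function.Injective T := by
    rw [← ker_eq_bot, ker_eq_bot']
    intro x hx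
    apply Subtype.ext
    exact h x x.2 fun y hy => LinearMap.congr_fun hx ⟨y, hy⟩
  have hs : Function.Surjective T :=
    (injective_iff_surjective_of_finrank_eq_finrank Subspace.dual_finrank_eq.symm).1 hT
  obtain ⟨q, hq⟩ := hs (f.comp U.subtype)
  exact ⟨q, q.2, fun x hx => LinearMap.congr_fun hq ⟨x, hx⟩⟩

theorem NondegOn.exists_dual (h : NondegOn B U) {W : Submodule ℂ V} {p : V} (hp : p ∈ U)
    (hW : W ≤ U) (hpW : p ∉ W) : ∃ q ∈ U, B q p = 1 ∧ ∀ x ∈ W, B q x = 0 := by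
  obtain ⟨f, hf, hfW⟩ := exists_le_ker_of_notMem hpW
  obtain ⟨q, hq, hqf⟩ := h.exists_repr ((f p)⁻¹ • f)
  refine ⟨q, hq, ?_, fun x hx => ?_⟩
  · rw [hqf p hp]
    simp [hf]
  · rw [hqf x (hW hx)]
    simp [mem_ker.1 (hfW hx)]

/-- Nondegeneracy makes the map from `U` to the dual of `W` surjective, and isotropy puts `W` in its
kernel. -/
theorem NondegOn.two_mul_finrank_le (h : NondegOn B U) {W : Submodule ℂ V} (hW : W ≤ U)
    (hi : ∀ x ∈ W, ∀ y ∈ W, B x y = 0) : 2 * finrank ℂ W ≤ finrank ℂ U := by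
  let T : U →ₗ[ℂ] Dual ℂ W := B.compl₁₂ U.subtype W.subtype
  have hs : Function.Surjective T := by
    intro f
    obtain ⟨g, hg⟩ := exists_extend f
    obtain ⟨q, hq, hqf⟩ := h.exists_repr g
    refine ⟨⟨q, hq⟩, LinearMap.ext fun w => ?_⟩
    rw [← hg]
    exact hqf w (hW w.2)
  have h1 := finrank_range_add_finrank_ker T
  rw [range_eq_top.2 hs, finrank_top, Subspace.dual_finrank_eq] at h1
  have h2 : comap U.subtype W ≤ ker T := by
    intro x hx
    rw [mem_ker]
    ext w
    exact hi x hx w w.2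
  have h3 := Submodule.finrank_mono h2
  rw [(comapSubtypeEquivOfLe hW).finrank_eq] at h3
  omega

theorem NondegOn.inf_ker_of_ne (h : NondegOn B U) (hB : ∀ x y, B x y = B y x) {u : V} (hu : u ∈ U)
    (huu : B u u ≠ 0) : NondegOn B (U ⊓ ker (B u)) := by
  rintro x ⟨hxU, hxu⟩ hx
  refine h x hxU fun y hy => ?_
  rw [← sup_inf_ker hu huu, mem_span_sup_iff] at hy
  obtain ⟨a, w, hw, rfl⟩ := hy
  rw [map_add, map_smul, hx w hw, hB x u, mem_ker.1 hxu]
  simp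

theorem NondegOn.inf_ker_ker (h : NondegOn B U) (hB : ∀ x y, B x y = B y x) {p q : V}
    (hp : p ∈ U) (hq : q ∈ U) (hpp : B p p = 0) (hpq : B p q = 1) :
    NondegOn B (U ⊓ ker (B p) ⊓ ker (B q)) := by
  rintro x ⟨⟨hxU, hxp⟩, hxq⟩ hx
  refine h x hxU fun y hy => ?_
  rw [← sup_inf_ker (f := B p) hq (by simp [hpq]), mem_span_sup_iff] at hy
  obtain ⟨a, w, hw, rfl⟩ := hy
  rw [← sup_inf_ker (W := U ⊓ ker (B p)) (s := p) (f := B q)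
    ⟨hp, hpp⟩ (by simp [hB q p, hpq]), mem_span_sup_iff] at hw
  obtain ⟨b, w, hw, rfl⟩ := hw
  simp [hx w hw, hB x p, hB x q, mem_ker.1 hxp, mem_ker.1 hxq]

theorem hyperbolic_decomp (hB : ∀ x y, B x y = B y x) {p q : V} (hp : p ∈ U) (hq : q ∈ U)
    (hpp : B p p = 0) (hpq : B p q = 1) :
    span ℂ {q} ⊔ (span ℂ {p} ⊔ U ⊓ ker (B p) ⊓ ker (B q)) = U := by
  rw [sup_inf_ker (W := U ⊓ ker (B p)) (s := p) (f := B q) ⟨hp, hpp⟩ (by simp [hB q p, hpq]),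
    sup_inf_ker (f := B p) hq (by simp [hpq])]

theorem finrank_hyperbolic (hB : ∀ x y, B x y = B y x) {p q : V} (hp : p ∈ U) (hq : q ∈ U)
    (hpp : B p p = 0) (hpq : B p q = 1) :
    finrank ℂ ↥(U ⊓ ker (B p) ⊓ ker (B q)) + 2 = finrank ℂ U := by
  have h1 := finrank_inf_ker (f := B p) hq (by simp [hpq])
  have h2 := finrank_inf_ker (W := U ⊓ ker (B p)) (s := p) (f := B q) ⟨hp, hpp⟩
    (by simp [hB q p, hpq])
  omega

/-- An isotropic vector `p` outside `W` has a hyperbolic partner orthogonal to `W`, provided `p`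
is. -/
theorem NondegOn.exists_partner (h : NondegOn B U) (hB : ∀ x y, B x y = B y x)
    {W : Submodule ℂ V} {p : V} (hp : p ∈ U) (hpp : B p p = 0)
    (hW : W ≤ U) (hpW : p ∉ W) (hperp : ∀ x ∈ W, B p x = 0) :
    ∃ q ∈ U, B p q = 1 ∧ B q q = 0 ∧ ∀ x ∈ W, B q x = 0 := by
  obtain ⟨q, hq, hqp, hqW⟩ := h.exists_dual hp hW hpW
  refine ⟨q - (B q q / 2) • p, sub_mem hq (smul_mem _ _ hp), ?_, ?_, fun x hx => ?_⟩
  · simp [hB p q, hqp, hpp]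
  · simp [hB p q, hqp, hpp]
    ring
  · simp [hqW x hx, hperp x hx]

variable {E F : ℕ → Submodule ℂ V} {r i : ℕ}

theorem IsFlag.zero (hE : IsFlag B r E) : E 0 = ⊥ := by
  rw [← Submodule.finrank_eq_zero, hE.finrank_eq]
  simp

theorem IsFlag.eq_top_step (hE : IsFlag B r E) {j : ℕ} (hj : r ≤ j) : E j = E r := by
  refine (eq_of_le_of_finrank_eq (hE.mono hj) ?_).symm
  rw [hE.finrank_eq, hE.finrank_eq]
  omega

theorem IsFlag.le_step (hE : IsFlag B r E) (j : ℕ) : E j ≤ E r := by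
  rcases le_total j r with h | h
  · exact hE.mono h
  · rw [hE.eq_top_step h]

/-- The boundary index j = i is the point: `f` vanishes on `E i` but not on `E (i + 1)`, so `E (i +
1) ⊓ ker f` contains `E i` and has the same dimension. -/
theorem peel_eq (hE : IsFlag B r E) (hi : i < r) {s : V} (hs : s ∈ E (i + 1)) {f : V →ₗ[ℂ] ℂ}
    (hf : f s ≠ 0) (hfE : ∀ x ∈ E i, f x = 0) {j : ℕ} (hj : j ≤ i) : peel i f E j = E j := by
  rcases hj.lt_or_eq with h | rfl
  · simp [peel, h]
  · have h1 := finrank_inf_ker hs hf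
    rw [hE.finrank_eq] at h1
    rw [peel, if_neg (lt_irrefl _)]
    refine (eq_of_le_of_finrank_eq
      (le_inf (hE.mono (show j ≤ j + 1 by omega)) fun x hx => hfE x hx) ?_).symm
    rw [hE.finrank_eq]
    omega

/-- This identity lets a configuration be rebuilt exactly, not just up to isometry, from the smaller
one. -/
theorem ins_peel (hE : IsFlag B r E) (hi : i < r) {s : V} (hs : s ∈ E (i + 1)) {f : V →ₗ[ℂ] ℂ}
    (hf : f s ≠ 0) (hfE : ∀ x ∈ E i, f x = 0) : ins i s (peel i f E) = E := by
  funext j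
  by_cases hj : j ≤ i
  · rw [ins, if_pos hj, peel_eq hE hi hs hf hfE hj]
  · rw [ins, if_neg hj, peel, if_neg (by omega), Nat.sub_add_cancel (by omega)]
    exact sup_inf_ker (hE.mono (by omega) hs) hf

theorem peel_le_succ (hE : IsFlag B r E) (f : V →ₗ[ℂ] ℂ) (j : ℕ) : peel i f E j ≤ E (j + 1) := by
  rw [peel]
  split_ifs
  · exact hE.mono (Nat.le_succ j)
  · exact inf_le_left

theorem peel_le_ker (hE : IsFlag B r E) {f : V →ₗ[ℂ] ℂ} (hfE : ∀ x ∈ E i, f x = 0) (j : ℕ) :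
    peel i f E j ≤ ker f := by
  rw [peel]
  split_ifs with h
  · exact fun x hx => hfE x (hE.mono h.le hx)
  · exact inf_le_right

theorem IsFlag.peel (hE : IsFlag B (r + 1) E) (hi : i ≤ r) {s : V} (hs : s ∈ E (i + 1))
    {f : V →ₗ[ℂ] ℂ} (hf : f s ≠ 0) (hfE : ∀ x ∈ E i, f x = 0) : IsFlag B r (peel i f E) where
  mono := by
    apply monotone_nat_of_le_succ
    intro j
    refine le_trans (le_inf (peel_le_succ hE f j) (peel_le_ker hE hfE j)) ?_
    by_cases h : j + 1 < i
    · rw [OrthFlag.peel, if_pos h]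
      exact inf_le_left
    · rw [OrthFlag.peel, if_neg h]
      exact inf_le_inf_right _ (hE.mono (Nat.le_succ _))
  finrank_eq := by
    intro j
    by_cases h : j ≤ i
    · rw [peel_eq hE (by omega) hs hf hfE h, hE.finrank_eq]
      omega
    · rw [OrthFlag.peel, if_neg (by omega)]
      have h1 := finrank_inf_ker (hE.mono (show i + 1 ≤ j + 1 by omega) hs) hf
      rw [hE.finrank_eq] at h1
      omega
  isotropic j x hx y hy :=
    hE.isotropic (j + 1) x (peel_le_succ hE f j hx) y (peel_le_succ hE f j hy)

/-- A vector of the top of a flag belongs to exactly one jump. -/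
theorem IsFlag.exists_jump (hE : IsFlag B r E) {P : Submodule ℂ V → Prop} (h0 : ¬ P ⊥)
    (hr : P (E r)) : ∃ i < r, ¬ P (E i) ∧ P (E (i + 1)) := by
  classical
  have hex : ∃ i, P (E i) := ⟨r, hr⟩
  have hpos : Nat.find hex ≠ 0 := by
    intro h
    have := Nat.find_spec hex
    rw [h, hE.zero] at this
    exact h0 this
  obtain ⟨i, hi⟩ := Nat.exists_eq_succ_of_ne_zero hpos
  have hle : Nat.find hex ≤ r := Nat.find_min' hex hr
  refine ⟨i, by omega, Nat.find_min hex (by omega), ?_⟩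
  have := Nat.find_spec hex
  rwa [hi] at this

/-- `E` is a complete isotropic flag of the space `U`. -/
structure IsFullFlag (B : LinearMap.BilinForm ℂ V) (U : Submodule ℂ V) (E : ℕ → Submodule ℂ V) :
    Prop where
  isFlag : IsFlag B (finrank ℂ U / 2) E
  le : ∀ j, E j ≤ U

/-- An isotropic vector orthogonal to a complete isotropic flag lies in its last member. -/
theorem IsFullFlag.mem_top (hE : IsFullFlag B U E) (hU : NondegOn B U)
    (hB : ∀ x y, B x y = B y x) {p : V}
    (hp : p ∈ U) (hpp : B p p = 0) (hpE : ∀ x ∈ E (finrank ℂ U / 2), B p x = 0) :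
    p ∈ E (finrank ℂ U / 2) := by
  by_contra h
  have h1 := finrank_span_sup h
  rw [hE.isFlag.finrank_eq] at h1
  have h2 := hU.two_mul_finrank_le (W := span ℂ {p} ⊔ E (finrank ℂ U / 2))
    (sup_le ((span_singleton_le_iff_mem _ _).2 hp) (hE.le _)) ?_
  · omega
  · intro x hx y hy
    obtain ⟨a, v, hv, rfl⟩ := mem_span_sup_iff.1 hx
    obtain ⟨b, w, hw, rfl⟩ := mem_span_sup_iff.1 hy
    simp [hpp, hpE w hw, hB v p, hpE v hv, hE.isFlag.isotropic _ v hv w hw]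

/-- Relative to a complete isotropic flag `E` every isotropic line `p` is part of a hyperbolic
pair `p, q` one of whose members spans a jump of `E`, orthogonally to the earlier members, the
other being orthogonal to the latter. -/
theorem IsFullFlag.exists_adapted (hE : IsFullFlag B U E) (hU : NondegOn B U)
    (hB : ∀ x y, B x y = B y x) {p : V} (hp : p ∈ U) (hp0 : p ≠ 0) (hpp : B p p = 0) :
    ∃ i < finrank ℂ U / 2, ∃ q ∈ U, B p q = 1 ∧ B q q = 0 ∧ ∃ b : Bool,
      (if b then p else q) ∈ E (i + 1) ∧ ∀ x ∈ E i, B p x = 0 ∧ B q x = 0 := by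
  set r := finrank ℂ U / 2 with hr
  -- If p is orthogonal to the flag, maximality puts p in `E r`, so p itself spans a jump. Otherwise
  -- the first member not orthogonal to p supplies q.
  by_cases hperp : ∀ x ∈ E r, B p x = 0
  · have hpr := hE.mem_top hU hB hp hpp hperp
    obtain ⟨i, hi, hni, hi1⟩ := hE.isFlag.exists_jump (P := fun W => p ∈ W) (by simpa using hp0) hpr
    have hpi : ∀ x ∈ E i, B p x = 0 := fun x hx => hperp x (hE.isFlag.mono hi.le hx)
    obtain ⟨q, hq, hpq, hqq, hqE⟩ := hU.exists_partner hB hp hpp (hE.le i) hni hpi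
    exact ⟨i, hi, q, hq, hpq, hqq, true, by simpa using hi1, fun x hx => ⟨hpi x hx, hqE x hx⟩⟩
  · obtain ⟨i, hi, hni, hi1⟩ := hE.isFlag.exists_jump
      (P := fun W => ¬ ∀ x ∈ W, B p x = 0) (by simp) hperp
    push Not at hni hi1
    obtain ⟨e, he, hpe⟩ := hi1
    refine ⟨i, hi, (B p e)⁻¹ • e, smul_mem _ _ (hE.le _ he), by simp [hpe], ?_, false, ?_, ?_⟩
    · simp [hE.isFlag.isotropic _ e he e he]
    · simpa using smul_mem _ _ he
    · intro x hx
      refine ⟨hni x hx, ?_⟩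
      simp [hE.isFlag.isotropic _ e he x (hE.isFlag.mono (Nat.le_succ i) hx)]

/-- Removal of a hyperbolic pair adapted to a complete isotropic flag. -/
theorem IsFullFlag.peel (hE : IsFullFlag B U E) (hB : ∀ x y, B x y = B y x)
    (hi : i < finrank ℂ U / 2) {s t : V} (hs : s ∈ E (i + 1)) (ht : t ∈ U) (hst : B t s = 1)
    (hss : B s s = 0) (htE : ∀ x ∈ E i, B t x = 0) :
    IsFullFlag B (U ⊓ ker (B s) ⊓ ker (B t)) (peel i (B t) E) := by
  have hdim := finrank_hyperbolic hB (hE.le _ hs) ht hss (by rw [hB, hst])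
  refine ⟨?_, fun j => le_inf (le_inf ?_ ?_) ?_⟩
  · have : finrank ℂ U / 2 = finrank ℂ ↥(U ⊓ ker (B s) ⊓ ker (B t)) / 2 + 1 := by omega
    have h1 := hE.isFlag
    rw [this] at h1
    exact h1.peel (by omega) hs (by simp [hst]) htE
  · exact (peel_le_succ hE.isFlag _ j).trans (hE.le _)
  · intro x hx
    by_cases h : j ≤ i
    · rw [peel_eq hE.isFlag hi hs (by simp [hst]) htE h] at hx
      exact hE.isFlag.isotropic (i + 1) s hs x (hE.isFlag.mono (by omega) hx)
    · exact hE.isFlag.isotropic (j + 1) s (hE.isFlag.mono (by omega) hs) x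
        (peel_le_succ hE.isFlag _ j hx)
  · exact peel_le_ker hE.isFlag htE j

end Forms

/-! ### Configurations (u, E, F), their two extensions and their codes -/

section Configurations

/-- A space `U` with a vector `u` and two chains of subspaces: `E` in `U ∩ u^⊥` and `F` in `U`. -/
structure Config (V : Type*) [AddCommGroup V] [Module ℂ V] where
  U : Submodule ℂ V
  u : V
  E : ℕ → Submodule ℂ V
  F : ℕ → Submodule ℂ V

variable {V : Type*} [AddCommGroup V] [Module ℂ V]

/-- Adjoin an anisotropic vector `u`; the two flags exchange their roles. -/
def Config.ext (T : Config V) (u : V) : Config V :=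
  ⟨span ℂ {u} ⊔ T.U, u, T.F, ins 0 (u + T.u) T.E⟩

/-- Adjoin a hyperbolic pair `p, q`; the second flag starts with `p`, and `p` or `q` is inserted
into the first one. -/
def Config.hyp (T : Config V) (p q : V) (i : ℕ) (b : Bool) : Config V :=
  ⟨span ℂ {q} ⊔ (span ℂ {p} ⊔ T.U), T.u, ins i (if b then p else q) T.E, ins 0 p T.F⟩

/-- `U` is nondegenerate of dimension `n + 1`, `u` is anisotropic, and the two flags are complete
isotropic flags of `U ∩ u^⊥` and of `U`. -/
structure Config.Good (B : LinearMap.BilinForm ℂ V) (n : ℕ) (T : Config V) : Prop where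
  finrank_eq : finrank ℂ T.U = n + 1
  nondeg : NondegOn B T.U
  mem : T.u ∈ T.U
  ne : B T.u T.u ≠ 0
  E : IsFullFlag B (T.U ⊓ ker (B T.u)) T.E
  F : IsFullFlag B T.U T.F

/-- The combinatorial types of configurations in dimension `n + 1`. -/
def Code : ℕ → Type
  | 0 => Unit
  -- In dimension 2 the complement of u is an anisotropic line, so F 1 cannot be orthogonal to u and
  -- only the anisotropic step occurs.
  | 1 => Unit
  -- Here u^⊥ has dimension n + 2, so E has (n + 2) / 2 jumps.
  | n + 2 => Code (n + 1) ⊕ (Fin ((n + 2) / 2) × Bool × Code n)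

/-- `T` arises by adjoining an anisotropic vector to a configuration satisfying `P`. -/
def TransStep (B : LinearMap.BilinForm ℂ V) (P : Config V → Prop) (T : Config V) : Prop :=
  ∃ (T' : Config V) (u : V), P T' ∧ (∀ x ∈ T'.U, B u x = 0) ∧ B u u ≠ 0 ∧
    B T'.u T'.u = -B u u ∧ T = T'.ext u

/-- `T` arises by adjoining a hyperbolic pair to a configuration satisfying `P`. -/
def OrthStep (B : LinearMap.BilinForm ℂ V) (i : ℕ) (b : Bool) (P : Config V → Prop)
    (T : Config V) : Prop :=
  ∃ (T' : Config V) (p q : V), P T' ∧ (∀ x ∈ T'.U, B p x = 0) ∧ (∀ x ∈ T'.U, B q x = 0) ∧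
    B p p = 0 ∧ B q q = 0 ∧ B p q = 1 ∧ T = T'.hyp p q i b

/-- The configuration `T` has the combinatorial type `c`. -/
def HasType (B : LinearMap.BilinForm ℂ V) : (n : ℕ) → Code n → Config V → Prop
  | 0, _, T => T.U = span ℂ {T.u} ∧ B T.u T.u ≠ 0 ∧ ∀ j, T.E j = ⊥ ∧ T.F j = ⊥
  | 1, _, T => TransStep B (HasType B 0 ()) T
  | n + 2, Sum.inl c, T => TransStep B (HasType B (n + 1) c) T
  | n + 2, Sum.inr (i, b, c), T => OrthStep B i b (HasType B n c) T

/-- There is a linear map, isometric on `T.U`, which carries `T` into `T'`. -/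
def Dom (B : LinearMap.BilinForm ℂ V) (T T' : Config V) : Prop :=
  ∃ f : V →ₗ[ℂ] V, (∀ x ∈ T.U, f x ∈ T'.U) ∧ (∀ x ∈ T.U, ∀ y ∈ T.U, B (f x) (f y) = B x y) ∧
    f T.u = T'.u ∧ (∀ j, ∀ x ∈ T.E j, f x ∈ T'.E j) ∧ ∀ j, ∀ x ∈ T.F j, f x ∈ T'.F j

theorem mem_ins_iff {i j : ℕ} {s x : V} {E : ℕ → Submodule ℂ V} :
    x ∈ ins i s E j ↔ (j ≤ i ∧ x ∈ E j) ∨ (i < j ∧ ∃ a : ℂ, ∃ w ∈ E (j - 1), x = a • s + w) := by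
  rw [ins]
  split_ifs with h
  · simp [h, h.not_gt]
  · simp [h, not_le.1 h, mem_span_sup_iff]

theorem ins_le {i j : ℕ} {s : V} {E : ℕ → Submodule ℂ V} {W : Submodule ℂ V} (hs : s ∈ W)
    (hE : ∀ j, E j ≤ W) : ins i s E j ≤ W := by
  rw [ins]
  split_ifs
  · exact hE j
  · exact sup_le ((span_singleton_le_iff_mem _ _).2 hs) (hE _)

variable {B : LinearMap.BilinForm ℂ V}

/-- Induction principle for types. -/
theorem HasType.rec_on {P : ℕ → Config V → Prop}
    (base : ∀ T : Config V, T.U = span ℂ {T.u} → B T.u T.u ≠ 0 → (∀ j, T.E j = ⊥ ∧ T.F j = ⊥) →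
      P 0 T)
    (ext : ∀ (n : ℕ) (T : Config V) (u : V), P n T → (∀ x ∈ T.U, B u x = 0) → B u u ≠ 0 →
      B T.u T.u = -B u u → P (n + 1) (T.ext u))
    (hyp : ∀ (n : ℕ) (T : Config V) (p q : V) (i : ℕ) (b : Bool), P n T → i ≤ n / 2 →
      (∀ x ∈ T.U, B p x = 0) → (∀ x ∈ T.U, B q x = 0) → B p p = 0 → B q q = 0 → B p q = 1 →
      P (n + 2) (T.hyp p q i b)) :
    ∀ (n : ℕ) (c : Code n) (T : Config V), HasType B n c T → P n T
  | 0, _, T, h => base T h.1 h.2.1 h.2.2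
  | 1, _, T, h => by
    obtain ⟨T', u, hT', h1, h2, h3, rfl⟩ := h
    exact ext 0 T' u (HasType.rec_on base ext hyp 0 _ T' hT') h1 h2 h3
  | n + 2, Sum.inl c, T, h => by
    obtain ⟨T', u, hT', h1, h2, h3, rfl⟩ := h
    exact ext (n + 1) T' u (HasType.rec_on base ext hyp (n + 1) _ T' hT') h1 h2 h3
  | n + 2, Sum.inr (i, b, c), T, h => by
    obtain ⟨T', p, q, hT', h1, h2, h3, h4, h5, rfl⟩ := h
    exact hyp n T' p q i b (HasType.rec_on base ext hyp n _ T' hT') (by omega) h1 h2 h3 h4 h5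

variable [FiniteDimensional ℂ V]

theorem IsFlag.ins {r i : ℕ} {E : ℕ → Submodule ℂ V} (hE : IsFlag B r E)
    (hB : ∀ x y, B x y = B y x) (hi : i ≤ r) {s : V}
    (hs : ∀ j, s ∉ E j) (hss : B s s = 0) (hsE : ∀ j, ∀ x ∈ E j, B s x = 0) :
    IsFlag B (r + 1) (ins i s E) where
  mono := by
    apply monotone_nat_of_le_succ
    intro j
    rw [OrthFlag.ins, OrthFlag.ins]
    split_ifs with h1 h2 h3
    · exact hE.mono (Nat.le_succ j)
    · exact le_sup_right
    · omega
    · exact sup_le_sup le_rfl (hE.mono (by omega))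
  finrank_eq j := by
    by_cases h1 : j ≤ i
    · rw [OrthFlag.ins, if_pos h1, hE.finrank_eq]
      omega
    · rw [OrthFlag.ins, if_neg h1, finrank_span_sup (hs _), hE.finrank_eq]
      omega
  isotropic j x hx y hy := by
    rw [mem_ins_iff] at hx hy
    rcases hx with ⟨h, hx⟩ | ⟨h, a, v, hv, rfl⟩
    · rcases hy with ⟨h', hy⟩ | ⟨h', -⟩
      · exact hE.isotropic j x hx y hy
      · omega
    · rcases hy with ⟨h', -⟩ | ⟨h', b, w, hw, rfl⟩
      · omega
      · simp [hss, hsE _ w hw, hB v s, hsE _ v hv, hE.isotropic _ v hv w hw]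

/-- Opposite norms make `u + T.u` isotropic; it is orthogonal to `T.E` and lies outside `T.U`, so it
can start a flag containing `T.E`. The complement of `u` in the new space is `T.U`, of which `T.F`
is a complete flag. -/
theorem Config.Good.ext {n : ℕ} {T : Config V} (hT : T.Good B n) (hB : ∀ x y, B x y = B y x)
    {u : V} (hu : ∀ x ∈ T.U, B u x = 0) (huu : B u u ≠ 0) (hTu : B T.u T.u = -B u u) :
    (T.ext u).Good B (n + 1) := by
  have hnot : u ∉ T.U := fun h => huu (hu u h)
  have hle : T.U ≤ span ℂ {u} ⊔ T.U := le_sup_right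
  have hmem : u ∈ span ℂ {u} ⊔ T.U := mem_sup_left (mem_span_singleton_self u)
  have hker : (span ℂ {u} ⊔ T.U) ⊓ ker (B u) = T.U := by
    apply le_antisymm
    · rintro x ⟨hx, hxu⟩
      obtain ⟨a, w, hw, rfl⟩ := mem_span_sup_iff.1 hx
      have : a = 0 := by simpa [hu w hw, huu] using hxu
      simpa [this] using hw
    · exact le_inf hle fun x hx => hu x hx
  have hdim := finrank_span_sup hnot
  have hdim' := hT.finrank_eq
  have hv : ∀ j, ∀ x ∈ T.E j, B (u + T.u) x = 0 := by
    intro j x hx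
    have := hT.E.le j hx
    simp [hu x this.1, mem_ker.1 this.2]
  have huTu := hu _ hT.mem
  refine ⟨?_, ?_, hmem, huu, ⟨?_, ?_⟩, ⟨?_, ?_⟩⟩
  · exact hdim.trans (by rw [hdim'])
  · intro x hx h
    obtain ⟨a, w, hw, rfl⟩ := mem_span_sup_iff.1 hx
    have ha : a = 0 := by
      have := h u hmem
      simpa [hB w u, hu w hw, huu] using this
    have hw0 : w = 0 := by
      refine hT.nondeg w hw fun y hy => ?_
      have := h y (hle hy)
      simpa [ha] using this
    simp [ha, hw0]
  · change IsFlag B (finrank ℂ ↥((span ℂ {u} ⊔ T.U) ⊓ ker (B u)) / 2) T.F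
    rw [hker]
    exact hT.F.isFlag
  · change ∀ j, T.F j ≤ (span ℂ {u} ⊔ T.U) ⊓ ker (B u)
    rw [hker]
    exact hT.F.le
  · change IsFlag B (finrank ℂ ↥(span ℂ {u} ⊔ T.U) / 2) (ins 0 (u + T.u) T.E)
    have h := hT.E.isFlag
    have h' := finrank_inf_ker hT.mem hT.ne
    have e : finrank ℂ ↥(span ℂ {u} ⊔ T.U) / 2 = finrank ℂ ↥(T.U ⊓ ker (B T.u)) / 2 + 1 := by
      omega
    rw [e]
    refine h.ins hB (Nat.zero_le _) (fun j hj => ?_) ?_ hv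
    · have h2 := (hT.E.le j hj).1
      exact hnot (by simpa using sub_mem h2 hT.mem)
    · simp [hTu, huTu, hB T.u u]
  · exact fun j => ins_le (add_mem hmem (hle hT.mem)) fun j =>
      (hT.E.le j).trans (inf_le_left.trans hle)

/-- Both p and q are isotropic, orthogonal to `T.U` and outside it, so either may be inserted
anywhere in `T.E`. That flag has n / 2 steps, which leaves the places 0, …, n / 2. -/
theorem Config.Good.hyp {n : ℕ} {T : Config V} (hT : T.Good B n) (hB : ∀ x y, B x y = B y x)
    {p q : V} {i : ℕ} (b : Bool) (hi : i ≤ n / 2) (hp : ∀ x ∈ T.U, B p x = 0)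
    (hq : ∀ x ∈ T.U, B q x = 0) (hpp : B p p = 0) (hqq : B q q = 0) (hpq : B p q = 1) :
    (T.hyp p q i b).Good B (n + 2) := by
  have hqp : B q p = 1 := by rw [hB, hpq]
  have hpn : p ∉ T.U := fun h => by simpa [hqp] using hq p h
  have hqn' : q ∉ T.U := fun h => by simpa [hpq] using hp q h
  have hqn : q ∉ span ℂ {p} ⊔ T.U := by
    intro h
    obtain ⟨a, w, hw, e⟩ := mem_span_sup_iff.1 h
    have := congrArg (B p) e
    simp [hpq, hpp, hp w hw] at this
  have hpm : p ∈ span ℂ {q} ⊔ (span ℂ {p} ⊔ T.U) :=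
    mem_sup_right (mem_sup_left (mem_span_singleton_self p))
  have hqm : q ∈ span ℂ {q} ⊔ (span ℂ {p} ⊔ T.U) := mem_sup_left (mem_span_singleton_self q)
  have hle : T.U ≤ span ℂ {q} ⊔ (span ℂ {p} ⊔ T.U) := le_sup_right.trans le_sup_right
  have hdim : finrank ℂ ↥(span ℂ {q} ⊔ (span ℂ {p} ⊔ T.U)) = n + 3 := by
    rw [finrank_span_sup hqn, finrank_span_sup hpn, hT.finrank_eq]
  have hdim1 := finrank_inf_ker hT.mem hT.ne
  have hdim2 := finrank_inf_ker (hle hT.mem) hT.ne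
  have hdim3 := hT.finrank_eq
  have hup : B T.u p = 0 := by rw [hB, hp _ hT.mem]
  have huq : B T.u q = 0 := by rw [hB, hq _ hT.mem]
  refine ⟨hdim, ?_, hle hT.mem, hT.ne, ⟨?_, ?_⟩, ⟨?_, ?_⟩⟩
  · intro x hx h
    obtain ⟨a, w, hw, rfl⟩ := mem_span_sup_iff.1 hx
    obtain ⟨c, v, hv, rfl⟩ := mem_span_sup_iff.1 hw
    have ha : a = 0 := by
      have := h p hpm
      simpa [hqp, hpp, hB v p, hp v hv] using this
    have hc : c = 0 := by
      have := h q hqm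
      simpa [hqq, hpq, hB v q, hq v hv] using this
    have hv0 : v = 0 := by
      refine hT.nondeg v hv fun y hy => ?_
      have := h y (hle hy)
      simpa [ha, hc] using this
    simp [ha, hc, hv0]
  · change IsFlag B (finrank ℂ ↥((span ℂ {q} ⊔ (span ℂ {p} ⊔ T.U)) ⊓ ker (B T.u)) / 2)
      (ins i (if b then p else q) T.E)
    have e : finrank ℂ ↥((span ℂ {q} ⊔ (span ℂ {p} ⊔ T.U)) ⊓ ker (B T.u)) / 2 =
      finrank ℂ ↥(T.U ⊓ ker (B T.u)) / 2 + 1 := by omega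
    rw [e]
    have hEU : ∀ j, T.E j ≤ T.U := fun j => (hT.E.le j).trans inf_le_left
    refine hT.E.isFlag.ins hB (by omega) (fun j hj => ?_) ?_ fun j x hx => ?_
    · cases b
      · exact hqn' (hEU j (by simpa using hj))
      · exact hpn (hEU j (by simpa using hj))
    · cases b <;> simp [hpp, hqq]
    · cases b <;> simp [hp x (hEU j hx), hq x (hEU j hx)]
  · intro j
    refine ins_le ⟨?_, ?_⟩ fun j => ?_
    · cases b <;> simp [hpm, hqm, Config.hyp]
    · cases b <;> simp [hup, huq, Config.hyp]
    · exact (hT.E.le j).trans (inf_le_inf_right _ hle)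
  · change IsFlag B (finrank ℂ ↥(span ℂ {q} ⊔ (span ℂ {p} ⊔ T.U)) / 2) (ins 0 p T.F)
    have e : finrank ℂ ↥(span ℂ {q} ⊔ (span ℂ {p} ⊔ T.U)) / 2 = finrank ℂ T.U / 2 + 1 := by
      omega
    rw [e]
    exact hT.F.isFlag.ins hB (Nat.zero_le _) (fun j hj => hpn (hT.F.le j hj)) hpp
      fun j x hx => hp x (hT.F.le j hx)
  · exact fun j => ins_le hpm fun j => (hT.F.le j).trans hle

theorem HasType.good (hB : ∀ x y, B x y = B y x) {n : ℕ} {c : Code n} {T : Config V}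
    (h : HasType B n c T) : T.Good B n := by
  refine HasType.rec_on (P := fun n T => T.Good B n) ?_ ?_ ?_ n c T h
  · intro T hU hu hEF
    have hu0 : T.u ≠ 0 := fun h => hu (by simp [h])
    have hd : finrank ℂ T.U = 1 := by rw [hU, finrank_span_singleton hu0]
    have hm : T.u ∈ T.U := by rw [hU]; exact mem_span_singleton_self _
    have hd2 := finrank_inf_ker hm hu
    refine ⟨hd, ?_, hm, hu, ⟨⟨?_, ?_, ?_⟩, ?_⟩, ⟨⟨?_, ?_, ?_⟩, ?_⟩⟩
    · intro x hx h
      rw [hU] at hx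
      obtain ⟨a, rfl⟩ := mem_span_singleton.1 hx
      have := h T.u hm
      have ha : a = 0 := by simpa [hu] using this
      simp [ha]
    · intro i j _
      rw [(hEF i).1]
      exact bot_le
    · intro j
      rw [(hEF j).1, finrank_bot]
      omega
    · intro j x hx
      rw [(hEF j).1, mem_bot] at hx
      simp [hx]
    · intro j
      rw [(hEF j).1]
      exact bot_le
    · intro i j _
      rw [(hEF i).2]
      exact bot_le
    · intro j
      rw [(hEF j).2, finrank_bot]
      omega
    · intro j x hx
      rw [(hEF j).2, mem_bot] at hx
      simp [hx]
    · intro j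
      rw [(hEF j).2]
      exact bot_le
  · intro n T u hT h1 h2 h3
    exact hT.ext hB h1 h2 h3
  · intro n T p q i b hT hi h1 h2 h3 h4 h5
    exact hT.hyp hB b hi h1 h2 h3 h4 h5

end Configurations

/-! ### Gluing isometries; equal codes give isometric configurations -/

section Isometries

variable {V : Type*} [AddCommGroup V] [Module ℂ V] {B : LinearMap.BilinForm ℂ V}

/-- Project onto u^⊥ along `u`, apply `f`, and send the `u`-component to `v`. The analogue for a
hyperbolic pair reads the two components off with `B q` and `B p`. -/
theorem exists_glue_vector {W : Submodule ℂ V} {u : V} (hu : ∀ x ∈ W, B u x = 0)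
    (huu : B u u ≠ 0) (f : V →ₗ[ℂ] V) (v : V) :
    ∃ g : V →ₗ[ℂ] V, g u = v ∧ ∀ x ∈ W, g x = f x := by
  refine ⟨f ∘ₗ (LinearMap.id - (B u).smulRight ((B u u)⁻¹ • u)) + (B u).smulRight ((B u u)⁻¹ • v),
    ?_, fun x hx => ?_⟩
  · simp [smul_smul, huu]
  · simp [hu x hx]

theorem exists_glue_pair (hB : ∀ x y, B x y = B y x) {W : Submodule ℂ V} {p q : V}
    (hp : ∀ x ∈ W, B p x = 0) (hq : ∀ x ∈ W, B q x = 0) (hpp : B p p = 0) (hqq : B q q = 0)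
    (hpq : B p q = 1) (f : V →ₗ[ℂ] V) (p' q' : V) :
    ∃ g : V →ₗ[ℂ] V, g p = p' ∧ g q = q' ∧ ∀ x ∈ W, g x = f x := by
  have hqp : B q p = 1 := by rw [hB, hpq]
  refine ⟨f ∘ₗ (LinearMap.id - (B q).smulRight p - (B p).smulRight q) +
    (B q).smulRight p' + (B p).smulRight q', ?_, ?_, fun x hx => ?_⟩
  · simp [hpp, hqp]
  · simp [hqq, hpq]
  · simp [hp x hx, hq x hx]

theorem map_mem_ins {E E' : ℕ → Submodule ℂ V} {f : V →ₗ[ℂ] V} {s s' : V} {i : ℕ}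
    (hs : f s = s') (hE : ∀ j, ∀ x ∈ E j, f x ∈ E' j) (j : ℕ) (x : V) (hx : x ∈ ins i s E j) :
    f x ∈ ins i s' E' j := by
  rw [mem_ins_iff] at hx ⊢
  rcases hx with ⟨h, hx⟩ | ⟨h, a, w, hw, rfl⟩
  · exact Or.inl ⟨h, hE j x hx⟩
  · exact Or.inr ⟨h, a, f w, hE _ w hw, by simp [hs]⟩

theorem Dom.ext {T T' : Config V} (h : Dom B T T') (hB : ∀ x y, B x y = B y x) {u u' : V}
    (hu : ∀ x ∈ T.U, B u x = 0) (hu' : ∀ x ∈ T'.U, B u' x = 0) (huu : B u u ≠ 0)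
    (huu' : B u' u' = B u u) (hE : ∀ j, T.E j ≤ T.U) (hF : ∀ j, T.F j ≤ T.U) (hm : T.u ∈ T.U) :
    Dom B (T.ext u) (T'.ext u') := by
  obtain ⟨f, hfU, hfB, hfu, hfE, hfF⟩ := h
  obtain ⟨g, hgu, hg⟩ := exists_glue_vector hu huu f u'
  refine ⟨g, ?_, ?_, hgu, ?_, ?_⟩
  · intro x hx
    obtain ⟨a, w, hw, rfl⟩ := mem_span_sup_iff.1 hx
    exact mem_span_sup_iff.2 ⟨a, f w, hfU w hw, by simp [hgu, hg w hw]⟩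
  · intro x hx y hy
    obtain ⟨a, v, hv, rfl⟩ := mem_span_sup_iff.1 hx
    obtain ⟨b, w, hw, rfl⟩ := mem_span_sup_iff.1 hy
    simp [hgu, hg v hv, hg w hw, hfB v hv w hw, hB v u, hB (f v) u', hu v hv, hu w hw,
      hu' _ (hfU v hv), hu' _ (hfU w hw), huu']
  · intro j x hx
    rw [hg x (hF j hx)]
    exact hfF j x hx
  · refine map_mem_ins ?_ fun j x hx => ?_
    · rw [map_add, hgu, hg _ hm, hfu]
    · rw [hg x (hE j hx)]
      exact hfE j x hx

theorem Dom.hyp {T T' : Config V} (h : Dom B T T') (hB : ∀ x y, B x y = B y x) {p q p' q' : V}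
    (i : ℕ) (b : Bool)
    (hp : ∀ x ∈ T.U, B p x = 0) (hq : ∀ x ∈ T.U, B q x = 0) (hpp : B p p = 0) (hqq : B q q = 0)
    (hpq : B p q = 1)
    (hp' : ∀ x ∈ T'.U, B p' x = 0) (hq' : ∀ x ∈ T'.U, B q' x = 0) (hpp' : B p' p' = 0)
    (hqq' : B q' q' = 0) (hpq' : B p' q' = 1)
    (hE : ∀ j, T.E j ≤ T.U) (hF : ∀ j, T.F j ≤ T.U) (hm : T.u ∈ T.U) :
    Dom B (T.hyp p q i b) (T'.hyp p' q' i b) := by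
  obtain ⟨f, hfU, hfB, hfu, hfE, hfF⟩ := h
  obtain ⟨g, hgp, hgq, hg⟩ := exists_glue_pair hB hp hq hpp hqq hpq f p' q'
  refine ⟨g, ?_, ?_, (hg _ hm).trans hfu, ?_, ?_⟩
  · intro x hx
    obtain ⟨a, w, hw, rfl⟩ := mem_span_sup_iff.1 hx
    obtain ⟨c, v, hv, rfl⟩ := mem_span_sup_iff.1 hw
    exact mem_span_sup_iff.2 ⟨a, c • p' + f v,
      mem_span_sup_iff.2 ⟨c, f v, hfU v hv, rfl⟩, by simp [hgp, hgq, hg v hv]⟩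
  · intro x hx y hy
    obtain ⟨a, w, hw, rfl⟩ := mem_span_sup_iff.1 hx
    obtain ⟨c, v, hv, rfl⟩ := mem_span_sup_iff.1 hw
    obtain ⟨a', w', hw', rfl⟩ := mem_span_sup_iff.1 hy
    obtain ⟨c', v', hv', rfl⟩ := mem_span_sup_iff.1 hw'
    simp [hgp, hgq, hg v hv, hg v' hv', hfB v hv v' hv', hB q' p', hB q p, hpp, hqq, hpq, hpp',
      hqq', hpq', hB v p, hB v q, hB (f v) p', hB (f v) q', hp v hv, hq v hv, hp v' hv',
      hq v' hv', hp' _ (hfU v hv), hq' _ (hfU v hv), hp' _ (hfU v' hv'), hq' _ (hfU v' hv')]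
  · refine map_mem_ins ?_ fun j x hx => ?_
    · cases b <;> simp [hgp, hgq]
    · rw [hg x (hE j hx)]
      exact hfE j x hx
  · refine map_mem_ins hgp fun j x hx => ?_
    rw [hg x (hF j hx)]
    exact hfF j x hx

variable [FiniteDimensional ℂ V]

/-- Configurations of the same type are isometric. -/
theorem HasType.dom (hB : ∀ x y, B x y = B y x) : ∀ (n : ℕ) (c : Code n) (T T' : Config V),
    HasType B n c T → HasType B n c T' → B T.u T.u = B T'.u T'.u → Dom B T T' := by
  have step : ∀ (n : ℕ) (c : Code n),
      (∀ T T' : Config V, HasType B n c T → HasType B n c T' → B T.u T.u = B T'.u T'.u →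
        Dom B T T') →
      ∀ T T' : Config V, TransStep B (HasType B n c) T → TransStep B (HasType B n c) T' →
        B T.u T.u = B T'.u T'.u → Dom B T T' := by
    rintro n c ih _ _ ⟨T, u, hT, h1, h2, h3, rfl⟩ ⟨T', u', hT', h1', -, h3', rfl⟩ he
    have g := hT.good hB
    have he' : B u u = B u' u' := he
    exact (ih T T' hT hT' (by rw [h3, h3', he'])).ext hB h1 h1' h2 he'.symm
      (fun j => (g.E.le j).trans inf_le_left) g.F.le g.mem
  intro n
  induction n using Nat.strong_induction_on with
  | _ n ih =>
    match n, ih with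
    | 0, _ =>
      rintro - T T' ⟨hU, hu, hEF⟩ ⟨hU', hu', hEF'⟩ he
      refine ⟨(B T.u).smulRight ((B T.u T.u)⁻¹ • T'.u), ?_, ?_, ?_, ?_, ?_⟩
      · intro x _
        rw [hU']
        exact smul_mem _ _ (smul_mem _ _ (mem_span_singleton_self _))
      · intro x hx y hy
        rw [hU] at hx hy
        obtain ⟨a, rfl⟩ := mem_span_singleton.1 hx
        obtain ⟨b, rfl⟩ := mem_span_singleton.1 hy
        simp [← he]
        field_simp
        exact Or.inl trivial
      · simp [smul_smul, hu]
      · intro j x hx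
        rw [(hEF j).1, mem_bot] at hx
        simp [hx]
      · intro j x hx
        rw [(hEF j).2, mem_bot] at hx
        simp [hx]
    | 1, ih => exact fun c T T' h h' he => step 0 () (ih 0 (by omega) ()) T T' h h' he
    | n + 2, ih =>
      rintro (c | ⟨i, b, c⟩) T T' h h' he
      · exact step (n + 1) c (ih (n + 1) (by omega) c) T T' h h' he
      · obtain ⟨T, p, q, hT, h1, h2, h3, h4, h5, rfl⟩ := h
        obtain ⟨T', p', q', hT', h1', h2', h3', h4', h5', rfl⟩ := h'
        have g := hT.good hB
        exact (ih n (by omega) c T T' hT hT' he).hyp hB i b h1 h2 h3 h4 h5 h1' h2' h3' h4' h5'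
          (fun j => (g.E.le j).trans inf_le_left) g.F.le g.mem

/-- Polarisation gives a vector of non-zero norm, and square roots in ℂ allow it to be rescaled to
any norm. -/
theorem NondegOn.exists_norm_eq {U : Submodule ℂ V} (h : NondegOn B U)
    (hB : ∀ x y, B x y = B y x) (hU : 0 < finrank ℂ U) (a : ℂ) :
    ∃ u ∈ U, B u u = a := by
  have h1 : ∃ w ∈ U, B w w ≠ 0 := by
    by_contra! hc
    have hbot : U = ⊥ := by
      rw [eq_bot_iff]
      intro x hx
      refine h x hx fun y hy => ?_
      have := hc (x + y) (add_mem hx hy)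
      simp [hc x hx, hc y hy, hB y x] at this
      exact this
    rw [hbot, finrank_bot] at hU
    exact lt_irrefl _ hU
  obtain ⟨w, hw, hww⟩ := h1
  obtain ⟨z, hz⟩ := IsAlgClosed.exists_eq_mul_self (a / B w w)
  refine ⟨z • w, smul_mem _ _ hw, ?_⟩
  simp [← mul_assoc, ← hz, hww]

/-- The sum of two orthogonal vectors of norms 1 and -1 is a non-zero isotropic vector, which has a
hyperbolic partner. -/
theorem NondegOn.exists_hyperbolic {U : Submodule ℂ V} (h : NondegOn B U)
    (hB : ∀ x y, B x y = B y x) (hU : 2 ≤ finrank ℂ U) :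
    ∃ p ∈ U, ∃ q ∈ U, B p p = 0 ∧ B q q = 0 ∧ B p q = 1 := by
  obtain ⟨u, hu, huu⟩ := h.exists_norm_eq hB (by omega) 1
  have hd := finrank_inf_ker hu (f := B u) (by simp [huu])
  obtain ⟨v, ⟨hv, huv⟩, hvv⟩ :=
    (h.inf_ker_of_ne hB hu (by simp [huu])).exists_norm_eq hB (by omega) (-1)
  have huv' : B u v = 0 := huv
  have hpp : B (u + v) (u + v) = 0 := by simp [huu, hvv, huv', hB v u]
  have hp0 : u + v ∉ (⊥ : Submodule ℂ V) := by
    rw [mem_bot]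
    intro h0
    have := congrArg (B u) h0
    simp [huu, huv'] at this
  obtain ⟨q, hq, hpq, hqq, -⟩ := h.exists_partner hB (add_mem hu hv) hpp bot_le hp0
    (by simp)
  exact ⟨u + v, add_mem hu hv, q, hq, hpp, hqq, hpq⟩

theorem IsFullFlag.exists_split {U : Submodule ℂ V} {F : ℕ → Submodule ℂ V}
    (hF : IsFullFlag B U F) (h : NondegOn B U) (hB : ∀ x y, B x y = B y x)
    (hU : 2 ≤ finrank ℂ U) :
    ∃ p ∈ U, ∃ q ∈ U, B p p = 0 ∧ B q q = 0 ∧ B p q = 1 ∧ ∃ F' : ℕ → Submodule ℂ V,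
      IsFullFlag B (U ⊓ ker (B p) ⊓ ker (B q)) F' ∧ F = ins 0 p F' := by
  have h1 : F 1 ≠ ⊥ := by
    intro h
    have := hF.isFlag.finrank_eq 1
    rw [h, finrank_bot] at this
    omega
  obtain ⟨p, hp, hp0⟩ := (Submodule.ne_bot_iff _).1 h1
  have hpp := hF.isFlag.isotropic 1 p hp p hp
  have hpU := hF.le 1 hp
  obtain ⟨q, hq, hpq, hqq, -⟩ := h.exists_partner hB hpU hpp bot_le
    (by simpa using hp0) (by simp)
  have hq0 : ∀ x ∈ F 0, B q x = 0 := by simp [hF.isFlag.zero]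
  have hqp : B q p = 1 := by rw [hB, hpq]
  exact ⟨p, hpU, q, hq, hpp, hqq, hpq, OrthFlag.peel 0 (B q) F,
    hF.peel hB (by omega) hp hq hqp hpp hq0,
    (ins_peel hF.isFlag (by omega) hp (by simp [hqp]) hq0).symm⟩

/-- Any two complete isotropic flags of spaces of the same dimension are isometric. -/
theorem exists_isometry_flags (hB : ∀ x y, B x y = B y x) :
    ∀ (n : ℕ) (U U' : Submodule ℂ V) (F F' : ℕ → Submodule ℂ V), finrank ℂ U = n →
      finrank ℂ U' = n → NondegOn B U → NondegOn B U' → IsFullFlag B U F → IsFullFlag B U' F' →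
      ∃ f : V →ₗ[ℂ] V, (∀ x ∈ U, f x ∈ U') ∧ (∀ x ∈ U, ∀ y ∈ U, B (f x) (f y) = B x y) ∧
        ∀ j, ∀ x ∈ F j, f x ∈ F' j := by
  have hbot : ∀ (U : Submodule ℂ V) (F : ℕ → Submodule ℂ V), IsFullFlag B U F →
      finrank ℂ U < 2 → ∀ j, F j = ⊥ := by
    intro U F hF h j
    rw [← Submodule.finrank_eq_zero, hF.isFlag.finrank_eq]
    omega
  have hline : ∀ U : Submodule ℂ V, finrank ℂ U = 1 → ∀ w ∈ U, B w w = 1 → U = span ℂ {w} := by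
    intro U hU w hw hww
    have h1 := finrank_inf_ker hw (f := B w) (by simp [hww])
    have h2 : U ⊓ ker (B w) = ⊥ := by
      rw [← Submodule.finrank_eq_zero]
      omega
    rw [← sup_inf_ker hw (f := B w) (by simp [hww]), h2, sup_bot_eq]
  intro n
  induction n using Nat.strong_induction_on with
  | _ n ih =>
    match n, ih with
    | 0, _ =>
      intro U U' F F' hU hU' _ _ hF hF'
      rw [Submodule.finrank_eq_zero] at hU
      refine ⟨0, by simp, fun x hx y hy => ?_, by simp⟩
      rw [hU, mem_bot] at hx
      simp [hx]
    | 1, _ =>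
      intro U U' F F' hU hU' hn hn' hF hF'
      obtain ⟨w, hw, hww⟩ := hn.exists_norm_eq hB (by omega) 1
      obtain ⟨w', hw', hww'⟩ := hn'.exists_norm_eq hB (by omega) 1
      refine ⟨(B w).smulRight w', fun x _ => smul_mem _ _ hw', fun x hx y hy => ?_,
        fun j x hx => ?_⟩
      · rw [hline U hU w hw hww] at hx hy
        obtain ⟨a, rfl⟩ := mem_span_singleton.1 hx
        obtain ⟨b, rfl⟩ := mem_span_singleton.1 hy
        simp [hww, hww']
      · rw [hbot U F hF (by omega), mem_bot] at hx
        simp [hx]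
    | n + 2, ih =>
      intro U U' F F' hU hU' hn hn' hF hF'
      obtain ⟨p, hp, q, hq, hpp, hqq, hpq, G, hG, rfl⟩ := hF.exists_split hn hB (by omega)
      obtain ⟨p', hp', q', hq', hpp', hqq', hpq', G', hG', rfl⟩ :=
        hF'.exists_split hn' hB (by omega)
      have hd := finrank_hyperbolic hB hp hq hpp hpq
      have hd' := finrank_hyperbolic hB hp' hq' hpp' hpq'
      have hpU : ∀ x ∈ U ⊓ ker (B p) ⊓ ker (B q), B p x = 0 := fun x hx => hx.1.2
      have hqU : ∀ x ∈ U ⊓ ker (B p) ⊓ ker (B q), B q x = 0 := fun x hx => hx.2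
      have hpU' : ∀ x ∈ U' ⊓ ker (B p') ⊓ ker (B q'), B p' x = 0 := fun x hx => hx.1.2
      have hqU' : ∀ x ∈ U' ⊓ ker (B p') ⊓ ker (B q'), B q' x = 0 := fun x hx => hx.2
      obtain ⟨f, hfU, hfB, hfF⟩ := ih n (by omega) _ _ G G' (by omega) (by omega)
        (hn.inf_ker_ker hB hp hq hpp hpq) (hn'.inf_ker_ker hB hp' hq' hpp' hpq') hG hG'
      obtain ⟨g, hgp, hgq, hg⟩ := exists_glue_pair hB hpU hqU hpp hqq hpq f p' q'
      have hmem : ∀ x ∈ U, ∃ a c : ℂ, ∃ v ∈ U ⊓ ker (B p) ⊓ ker (B q),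
          x = a • q + (c • p + v) := by
        intro x hx
        rw [← hyperbolic_decomp hB hp hq hpp hpq] at hx
        obtain ⟨a, w, hw, rfl⟩ := mem_span_sup_iff.1 hx
        obtain ⟨c, v, hv, rfl⟩ := mem_span_sup_iff.1 hw
        exact ⟨a, c, v, hv, rfl⟩
      refine ⟨g, ?_, ?_, ?_⟩
      · intro x hx
        obtain ⟨a, c, v, hv, rfl⟩ := hmem x hx
        simp only [map_add, map_smul, hgp, hgq, hg v hv]
        exact add_mem (smul_mem _ _ hq') (add_mem (smul_mem _ _ hp') (hfU v hv).1.1)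
      · intro x hx y hy
        obtain ⟨a, c, v, hv, rfl⟩ := hmem x hx
        obtain ⟨a', c', v', hv', rfl⟩ := hmem y hy
        simp [hgp, hgq, hg v hv, hg v' hv', hfB v hv v' hv', hB q' p', hB q p, hpp, hqq, hpq,
          hpp', hqq', hpq', hB v p, hB v q, hB (f v) p', hB (f v) q', hpU v hv, hqU v hv,
          hpU v' hv', hqU v' hv', hpU' _ (hfU v hv), hqU' _ (hfU v hv), hpU' _ (hfU v' hv'),
          hqU' _ (hfU v' hv')]
      · refine map_mem_ins hgp fun j x hx => ?_
        rw [hg x (hG.le j hx)]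
        exact hfF j x hx

end Isometries

/-! ### Every configuration has a code and every code is realised -/

section Classification

variable {V : Type*} [AddCommGroup V] [Module ℂ V] [FiniteDimensional ℂ V]
  {B : LinearMap.BilinForm ℂ V}

theorem TransStep.exists_hasType {n : ℕ} {c : Code n} {T : Config V}
    (h : TransStep B (HasType B n c) T) : ∃ c', HasType B (n + 1) c' T := by
  match n, c, h with
  | 0, _, h => exact ⟨(), h⟩
  | n + 1, c, h => exact ⟨Sum.inl c, h⟩

/-- A configuration whose flag `F` starts transversally to `u^⊥`. -/
theorem Config.Good.exists_ext {n : ℕ} {T : Config V} (hT : T.Good B (n + 1))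
    (hB : ∀ x y, B x y = B y x) {v : V} (hv : v ∈ T.F 1) (huv : B T.u v ≠ 0) :
    ∃ T' : Config V, T'.Good B n ∧ (∀ x ∈ T'.U, B T.u x = 0) ∧ B T'.u T'.u = -B T.u T.u ∧
      T = T'.ext T.u := by
  obtain ⟨U, u, E, F⟩ := T
  obtain ⟨hd, hn, hu, huu, hE, hF⟩ := hT
  simp only at hd hn hu huu hE hF hv huv ⊢
  -- This scaling of v on its line is the one that puts v - u in u^⊥; its norm is then -B u u
  -- because v is isotropic.
  wlog hs : B u v = B u u generalizing v
  · exact this (v := (B u u / B u v) • v) (smul_mem _ _ hv) (by simp [huv, huu]) (by simp [huv])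
  have hvv : B v v = 0 := hF.isFlag.isotropic 1 v hv v hv
  have hd1 := finrank_inf_ker hu huu
  have hF0 : ∀ x ∈ F 0, B u x = 0 := by simp [hF.isFlag.zero]
  have hmem : v - u ∈ U ⊓ ker (B u) := ⟨sub_mem (hF.le 1 hv) hu, by simp [hs]⟩
  have hnorm : B (v - u) (v - u) = -B u u := by simp [hvv, hs, hB v u]
  have hn' := hn.inf_ker_of_ne hB hu huu
  have hd2 := finrank_inf_ker hmem (f := B (v - u)) (by rw [hnorm]; simpa using huu)
  -- The flags change places: E is complete in u^⊥ and becomes the second flag, while F without its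
  -- first step lies in the complement of v - u in u^⊥ and becomes the first.
  refine ⟨⟨U ⊓ ker (B u), v - u, peel 0 (B u) F, E⟩, ⟨?_, hn', hmem, ?_, ⟨?_, ?_⟩, hE⟩, ?_, hnorm,
    ?_⟩
  · change finrank ℂ ↥(U ⊓ ker (B u)) = n + 1
    omega
  · change B (v - u) (v - u) ≠ 0
    rw [hnorm]
    simpa using huu
  · have h := hF.isFlag
    have e : finrank ℂ U / 2 = finrank ℂ ↥(U ⊓ ker (B u) ⊓ ker (B (v - u))) / 2 + 1 := by
      omega
    rw [e] at h
    exact h.peel (Nat.zero_le _) hv (by simp [huv]) hF0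
  · intro j x hx
    have h1 := peel_le_succ hF.isFlag (B u) j hx
    have h2 := peel_le_ker hF.isFlag hF0 j hx
    refine ⟨⟨hF.le _ h1, h2⟩, ?_⟩
    have h3 := hF.isFlag.isotropic (j + 1) v (hF.isFlag.mono (by omega) hv) x h1
    simp [h3, mem_ker.1 h2]
  · exact fun x hx => hx.2
  · simp only [Config.ext, Config.mk.injEq, true_and, add_sub_cancel]
    exact ⟨(sup_inf_ker hu huu).symm, (ins_peel hF.isFlag (by omega) hv huv hF0).symm⟩

/-- A configuration whose flag `F` starts inside `u^⊥`. -/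
theorem Config.Good.exists_hyp {n : ℕ} {T : Config V} (hT : T.Good B (n + 1))
    (hB : ∀ x y, B x y = B y x) {p : V} (hp : p ∈ T.F 1) (hp0 : p ≠ 0) (hup : B T.u p = 0) :
    1 ≤ n ∧ ∃ T' : Config V, T'.Good B (n - 1) ∧ ∃ i < (n + 1) / 2, ∃ b : Bool, ∃ q : V,
      (∀ x ∈ T'.U, B p x = 0) ∧ (∀ x ∈ T'.U, B q x = 0) ∧ B p p = 0 ∧ B q q = 0 ∧ B p q = 1 ∧
      T = T'.hyp p q i b := by
  obtain ⟨U, u, E, F⟩ := T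
  obtain ⟨hd, hn, hu, huu, hE, hF⟩ := hT
  simp only at hd hn hu huu hE hF hp hup ⊢
  have hpp : B p p = 0 := hF.isFlag.isotropic 1 p hp p hp
  have hpU := hF.le 1 hp
  have hd1 := finrank_inf_ker hu huu
  have hn' := hn.inf_ker_of_ne hB hu huu
  obtain ⟨i, hi, q, hq, hpq, hqq, b, hbE, hE0⟩ := hE.exists_adapted hn' hB ⟨hpU, hup⟩ hp0 hpp
  have hqp : B q p = 1 := by rw [hB, hpq]
  have huq : B u q = 0 := hq.2
  have hd2 := finrank_hyperbolic hB hpU hq.1 hpp hpq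
  have hF0 : ∀ x ∈ F 0, B q x = 0 := by simp [hF.isFlag.zero]
  have hmem : u ∈ U ⊓ ker (B p) ⊓ ker (B q) :=
    ⟨⟨hu, (hB p u).trans hup⟩, (hB q u).trans huq⟩
  have hcomm : U ⊓ ker (B p) ⊓ ker (B q) ⊓ ker (B u) = U ⊓ ker (B u) ⊓ ker (B p) ⊓ ker (B q) := by
    simp only [inf_left_comm, inf_comm]
  -- One member of the pair spans the jump; the step is removed by cutting E with the functional of
  -- the other member.
  have hpeel : ∃ E', IsFullFlag B (U ⊓ ker (B u) ⊓ ker (B p) ⊓ ker (B q)) E' ∧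
      E = ins i (if b then p else q) E' := by
    cases b
    · refine ⟨peel i (B p) E, ?_, (ins_peel hE.isFlag hi hbE (by simp [hpq])
        fun x hx => (hE0 x hx).1).symm⟩
      rw [inf_right_comm]
      exact hE.peel hB hi (by simpa using hbE) ⟨hpU, hup⟩ hpq hqq fun x hx => (hE0 x hx).1
    · exact ⟨peel i (B q) E, hE.peel hB hi (by simpa using hbE) hq hqp hpp
        fun x hx => (hE0 x hx).2, (ins_peel hE.isFlag hi hbE (by simp [hqp])
        fun x hx => (hE0 x hx).2).symm⟩
  obtain ⟨E', hE', hEE'⟩ := hpeel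
  refine ⟨by omega, ⟨U ⊓ ker (B p) ⊓ ker (B q), u, E', peel 0 (B q) F⟩,
    ⟨?_, hn.inf_ker_ker hB hpU hq.1 hpp hpq, hmem, huu, ?_, ?_⟩, i, by omega, b, q,
    fun x hx => hx.1.2, fun x hx => hx.2, hpp, hqq, hpq, ?_⟩
  · change finrank ℂ ↥(U ⊓ ker (B p) ⊓ ker (B q)) = n - 1 + 1
    omega
  · change IsFullFlag B (U ⊓ ker (B p) ⊓ ker (B q) ⊓ ker (B u)) E'
    rwa [hcomm]
  · exact hF.peel hB (by omega) hp hq.1 hqp hpp hF0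
  · simp only [Config.hyp, Config.mk.injEq, true_and]
    exact ⟨(hyperbolic_decomp hB hpU hq.1 hpp hpq).symm, hEE',
      (ins_peel hF.isFlag (by omega) hp (by simp [hqp]) hF0).symm⟩

/-- Every configuration has a type. -/
theorem Config.Good.exists_hasType (hB : ∀ x y, B x y = B y x) :
    ∀ (n : ℕ) (T : Config V), T.Good B n → ∃ c, HasType B n c T := by
  intro n
  induction n using Nat.strong_induction_on with
  | _ n ih =>
    match n, ih with
    | 0, _ =>
      intro T hT
      have hd := hT.finrank_eq
      have hd1 := finrank_inf_ker hT.mem hT.ne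
      have hbot : T.U ⊓ ker (B T.u) = ⊥ := by
        rw [← Submodule.finrank_eq_zero]
        omega
      refine ⟨(), ?_, hT.ne, fun j => ⟨?_, ?_⟩⟩
      · rw [← sup_inf_ker hT.mem hT.ne, hbot, sup_bot_eq]
      · rw [← Submodule.finrank_eq_zero, hT.E.isFlag.finrank_eq]
        omega
      · rw [← Submodule.finrank_eq_zero, hT.F.isFlag.finrank_eq]
        omega
    | n + 1, ih =>
      intro T hT
      have h1 : T.F 1 ≠ ⊥ := by
        intro h
        have h2 := hT.F.isFlag.finrank_eq 1
        have h3 := hT.finrank_eq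
        rw [h, finrank_bot] at h2
        omega
      obtain ⟨p, hp, hp0⟩ := (Submodule.ne_bot_iff _).1 h1
      by_cases hup : B T.u p = 0
      · obtain ⟨h1n, T', hT', i, hi, b, q, h⟩ := hT.exists_hyp hB hp hp0 hup
        obtain ⟨n, rfl⟩ := Nat.exists_eq_add_of_le' h1n
        rw [Nat.add_sub_cancel] at hT'
        obtain ⟨c, hc⟩ := ih n (by omega) T' hT'
        exact ⟨Sum.inr (⟨i, hi⟩, b, c), T', p, q, hc, h⟩
      · obtain ⟨T', hT', h2, h3, h4⟩ := hT.exists_ext hB hp hup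
        obtain ⟨c, hc⟩ := ih n (by omega) T' hT'
        exact TransStep.exists_hasType ⟨T', T.u, hc, h2, hT.ne, h3, h4⟩

/-- Every type is realised in every nondegenerate space of the right dimension. -/
theorem exists_hasType_of_code (hB : ∀ x y, B x y = B y x) :
    ∀ (n : ℕ) (c : Code n) (U : Submodule ℂ V) (a : ℂ), NondegOn B U → finrank ℂ U = n + 1 →
      a ≠ 0 → ∃ T : Config V, HasType B n c T ∧ T.U = U ∧ B T.u T.u = a := by
  have step : ∀ (n : ℕ) (c : Code n),
      (∀ (U : Submodule ℂ V) (a : ℂ), NondegOn B U → finrank ℂ U = n + 1 →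
        a ≠ 0 → ∃ T : Config V, HasType B n c T ∧ T.U = U ∧ B T.u T.u = a) →
      ∀ (U : Submodule ℂ V) (a : ℂ), NondegOn B U → finrank ℂ U = n + 2 →
        a ≠ 0 → ∃ T : Config V, TransStep B (HasType B n c) T ∧ T.U = U ∧ B T.u T.u = a := by
    intro n c ih U a hU hd ha
    obtain ⟨u, hu, huu⟩ := hU.exists_norm_eq hB (by omega) a
    have hne : B u u ≠ 0 := by rwa [huu]
    have hd1 := finrank_inf_ker hu hne
    obtain ⟨T, hT, hTU, hTu⟩ := ih (U ⊓ ker (B u)) (-a) (hU.inf_ker_of_ne hB hu hne) (by omega)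
      (by simpa using ha)
    refine ⟨T.ext u, ⟨T, u, hT, ?_, hne, by rw [hTu, huu], rfl⟩, ?_, huu⟩
    · rw [hTU]
      exact fun x hx => hx.2
    · change span ℂ {u} ⊔ T.U = U
      rw [hTU, sup_inf_ker hu hne]
  intro n
  induction n using Nat.strong_induction_on with
  | _ n ih =>
    match n, ih with
    | 0, _ =>
      intro c U a hU hd ha
      obtain ⟨u, hu, huu⟩ := hU.exists_norm_eq hB (by omega) a
      have hne : B u u ≠ 0 := by rwa [huu]
      have hd1 := finrank_inf_ker hu hne
      have hbot : U ⊓ ker (B u) = ⊥ := by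
        rw [← Submodule.finrank_eq_zero]
        omega
      refine ⟨⟨U, u, fun _ => ⊥, fun _ => ⊥⟩, ⟨?_, hne, fun _ => ⟨rfl, rfl⟩⟩, rfl, huu⟩
      change U = span ℂ {u}
      conv_lhs => rw [← sup_inf_ker hu hne, hbot, sup_bot_eq]
    | 1, ih => exact fun c => step 0 () (ih 0 (by omega) ())
    | n + 2, ih =>
      rintro (c | ⟨i, b, c⟩)
      · exact step (n + 1) c (ih (n + 1) (by omega) c)
      · intro U a hU hd ha
        obtain ⟨p, hp, q, hq, hpp, hqq, hpq⟩ := hU.exists_hyperbolic hB (by omega)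
        have hd1 := finrank_hyperbolic hB hp hq hpp hpq
        obtain ⟨T, hT, hTU, hTu⟩ := ih n (by omega) c (U ⊓ ker (B p) ⊓ ker (B q)) a
          (hU.inf_ker_ker hB hp hq hpp hpq) (by omega) ha
        refine ⟨T.hyp p q i b, ⟨T, p, q, hT, ?_, ?_, hpp, hqq, hpq, rfl⟩, ?_, hTu⟩
        · rw [hTU]
          exact fun x hx => hx.1.2
        · rw [hTU]
          exact fun x hx => hx.2
        · change span ℂ {q} ⊔ (span ℂ {p} ⊔ T.U) = U
          rw [hTU, hyperbolic_decomp hB hp hq hpp hpq]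

/-- The image of a configuration under a linear map. -/
def Config.map (T : Config V) (g : V →ₗ[ℂ] V) : Config V :=
  ⟨T.U.map g, g T.u, fun j => (T.E j).map g, fun j => (T.F j).map g⟩

theorem map_ins (g : V →ₗ[ℂ] V) (i : ℕ) (s : V) (E : ℕ → Submodule ℂ V) :
    (fun j => (ins i s E j).map g) = ins i (g s) fun j => (E j).map g := by
  funext j
  simp only [ins]
  split_ifs
  · rfl
  · simp [Submodule.map_sup, Submodule.map_span]

theorem Config.map_ext (T : Config V) (g : V →ₗ[ℂ] V) (u : V) :
    (T.ext u).map g = (T.map g).ext (g u) := by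
  simp [Config.ext, Config.map, map_ins, Submodule.map_sup, Submodule.map_span]

theorem Config.map_hyp (T : Config V) (g : V →ₗ[ℂ] V) (p q : V) (i : ℕ) (b : Bool) :
    (T.hyp p q i b).map g = (T.map g).hyp (g p) (g q) i b := by
  cases b <;> simp [Config.hyp, Config.map, map_ins, Submodule.map_sup, Submodule.map_span]

theorem HasType.map {g : V →ₗ[ℂ] V} (hg : ∀ x y, B (g x) (g y) = B x y) :
    ∀ (n : ℕ) (c : Code n) (T : Config V), HasType B n c T → HasType B n c (T.map g)
  | 0, _, T, h => by
    refine ⟨?_, ?_, fun j => ?_⟩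
    · simp [Config.map, h.1, Submodule.map_span]
    · simpa [Config.map, hg] using h.2.1
    · simp [Config.map, h.2.2 j]
  | 1, _, T, h => by
    obtain ⟨T', u, hT', h1, h2, h3, rfl⟩ := h
    refine ⟨T'.map g, g u, HasType.map hg 0 () T' hT', ?_, by rwa [hg], ?_, T'.map_ext g u⟩
    · rintro _ ⟨x, hx, rfl⟩
      rw [hg, h1 x hx]
    · simpa [Config.map, hg] using h3
  | n + 2, Sum.inl c, T, h => by
    obtain ⟨T', u, hT', h1, h2, h3, rfl⟩ := h
    refine ⟨T'.map g, g u, HasType.map hg (n + 1) c T' hT', ?_, by rwa [hg], ?_, T'.map_ext g u⟩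
    · rintro _ ⟨x, hx, rfl⟩
      rw [hg, h1 x hx]
    · simpa [Config.map, hg] using h3
  | n + 2, Sum.inr (i, b, c), T, h => by
    obtain ⟨T', p, q, hT', h1, h2, h3, h4, h5, rfl⟩ := h
    refine ⟨T'.map g, g p, g q, HasType.map hg n c T' hT', ?_, ?_, by rw [hg, h3], by rw [hg, h4],
      by rw [hg, h5], T'.map_hyp g p q i b⟩
    · rintro _ ⟨x, hx, rfl⟩
      rw [hg, h1 x hx]
    · rintro _ ⟨x, hx, rfl⟩
      rw [hg, h2 x hx]

end Classification

/-! ### The code is an isometry invariant -/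

section Uniqueness

variable {V : Type*} [AddCommGroup V] [Module ℂ V] [FiniteDimensional ℂ V]
  {B : LinearMap.BilinForm ℂ V}

theorem mem_ins_one_iff {s x : V} {E : ℕ → Submodule ℂ V} (hE : E 0 = ⊥) :
    x ∈ ins 0 s E 1 ↔ ∃ a : ℂ, x = a • s := by
  simp [ins, hE, mem_span_singleton, eq_comm]

theorem mem_ins_of_lt {i j : ℕ} (h : i < j) (s : V) (E : ℕ → Submodule ℂ V) : s ∈ ins i s E j :=
  mem_ins_iff.2 (Or.inr ⟨h, 1, 0, zero_mem _, by simp⟩)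

theorem le_ins_succ {i j : ℕ} (h : i ≤ j) (s : V) (E : ℕ → Submodule ℂ V) :
    E j ≤ ins i s E (j + 1) := fun x hx =>
  mem_ins_iff.2 (Or.inr ⟨by omega, 0, x, hx, by simp⟩)

/-- The isometry carries u to u' and hence the complement `T.U` into `T'.U`. It carries the first
line of the second flag, spanned by `u + T.u`, into the one spanned by `u' + T'.u`; pairing with u'
shows that the factor is 1, so `T.u` goes to `T'.u`. -/
theorem Dom.of_ext {n m : ℕ} {T T' : Config V} (hT : T.Good B n) (hT' : T'.Good B m)
    {u u' : V} (hu : ∀ x ∈ T.U, B u x = 0) (hu' : ∀ x ∈ T'.U, B u' x = 0) (huu' : B u' u' ≠ 0)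
    (h : Dom B (T.ext u) (T'.ext u')) : Dom B T T' := by
  obtain ⟨f, hfU, hfB, hfu, hfE, hfF⟩ := h
  have hfu' : f u = u' := hfu
  have hmu : u ∈ (T.ext u).U := mem_sup_left (mem_span_singleton_self u)
  have hle : T.U ≤ (T.ext u).U := le_sup_right
  have hperp : ∀ x ∈ T.U, B u' (f x) = 0 := by
    intro x hx
    rw [← hfu', hfB u hmu x (hle hx), hu x hx]
  have hmap : ∀ x ∈ T.U, f x ∈ T'.U := by
    intro x hx
    obtain ⟨a, w, hw, e⟩ := mem_span_sup_iff.1 (hfU x (hle hx))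
    have := hperp x hx
    rw [e] at this ⊢
    have ha : a = 0 := by simpa [hu' w hw, huu'] using this
    simpa [ha] using hw
  have hfv : f (u + T.u) = u' + T'.u := by
    obtain ⟨a, ha⟩ := (mem_ins_one_iff hT'.E.isFlag.zero).1
      (hfF 1 (u + T.u) ((mem_ins_one_iff hT.E.isFlag.zero).2 ⟨1, by simp⟩))
    have h1 := congrArg (B u') ha
    have h2 : a = 1 := by
      have h3 := hperp _ hT.mem
      have h4 := hu' _ hT'.mem
      simp only [map_add, hfu', map_smul, h3, h4, add_zero, smul_eq_mul] at h1
      exact (mul_eq_right₀ huu').1 h1.symm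
    simpa [h2] using ha
  refine ⟨f, hmap, fun x hx y hy => hfB x (hle hx) y (hle hy), ?_, fun j x hx => ?_, hfE⟩
  · simpa [hfu'] using hfv
  · have hxU := (hT.E.le j hx).1
    have h1 := hfF (j + 1) x (le_ins_succ (Nat.zero_le j) _ _ hx)
    rcases mem_ins_iff.1 h1 with ⟨h, -⟩ | ⟨-, a, w, hw, e⟩
    · omega
    · have h2 := hperp x hxU
      have h3 := hu' w (hT'.E.le _ hw).1
      have h4 := hu' _ hT'.mem
      have ha : a = 0 := by simpa [e, h3, h4, huu'] using h2
      rw [e]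
      simpa [ha] using hw

/-- Whether the first line of F is orthogonal to the distinguished vector is an isometry invariant;
this and its companion separate the two kinds of extension. -/
theorem not_dom_ext_hyp {T T' : Config V} (hB : ∀ x y, B x y = B y x) {u p q : V} {i : ℕ}
    {b : Bool} {n m : ℕ} (hT : T.Good B n) (hT' : T'.Good B m) (hu : ∀ x ∈ T.U, B u x = 0)
    (huu : B u u ≠ 0) (hp : ∀ x ∈ T'.U, B p x = 0) :
    ¬ Dom B (T.ext u) (T'.hyp p q i b) := by
  rintro ⟨f, hfU, hfB, hfu, hfE, hfF⟩
  have hmu : u ∈ (T.ext u).U := mem_sup_left (mem_span_singleton_self u)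
  have hle : T.U ≤ (T.ext u).U := le_sup_right
  have hv := hfF 1 (u + T.u) ((mem_ins_one_iff hT.E.isFlag.zero).2 ⟨1, by simp⟩)
  obtain ⟨a, ha⟩ := (mem_ins_one_iff hT'.F.isFlag.zero).1 hv
  have h1 := hfB u hmu (u + T.u) (add_mem hmu (hle hT.mem))
  have h2 : f u = T'.u := hfu
  rw [h2, ha] at h1
  simp [hB _ p, hp _ hT'.mem, hu _ hT.mem] at h1
  exact huu h1.symm

theorem not_dom_hyp_ext {T T' : Config V} (hB : ∀ x y, B x y = B y x) {u p q : V} {i : ℕ}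
    {b : Bool} {n m : ℕ} (hT : T.Good B n) (hT' : T'.Good B m) (hu : ∀ x ∈ T.U, B u x = 0)
    (huu : B u u ≠ 0) (hp : ∀ x ∈ T'.U, B p x = 0) (hpq : B p q = 1) :
    ¬ Dom B (T'.hyp p q i b) (T.ext u) := by
  rintro ⟨f, hfU, hfB, hfu, hfE, hfF⟩
  have hpm : p ∈ (T'.hyp p q i b).U :=
    mem_sup_right (mem_sup_left (mem_span_singleton_self p))
  have hqm : q ∈ (T'.hyp p q i b).U := mem_sup_left (mem_span_singleton_self q)
  have hum : T'.u ∈ (T'.hyp p q i b).U := mem_sup_right (mem_sup_right hT'.mem)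
  have hv := hfF 1 p ((mem_ins_one_iff hT'.F.isFlag.zero).2 ⟨1, by simp⟩)
  obtain ⟨a, ha⟩ := (mem_ins_one_iff hT.E.isFlag.zero).1 hv
  have h1 := hfB p hpm _ hum
  have h2 : f T'.u = u := hfu
  have h5 : B T.u u = 0 := by rw [hB, hu _ hT.mem]
  have ha0 : a = 0 := by simpa [h2, ha, hp _ hT'.mem, huu, h5] using h1
  have h3 := hfB p hpm q hqm
  rw [ha, ha0, hpq] at h3
  simp at h3

section Hyperbolic

variable {T T' : Config V} {n m : ℕ} {p q p' q' : V} {i i' : ℕ} {b b' : Bool}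

theorem Dom.hyp_map_first (hT : T.Good B n) (hT' : T'.Good B m) (hpq : B p q = 1) {f : V →ₗ[ℂ] V}
    (hfB : ∀ x ∈ (T.hyp p q i b).U, ∀ y ∈ (T.hyp p q i b).U, B (f x) (f y) = B x y)
    (hfF : ∀ j, ∀ x ∈ (T.hyp p q i b).F j, f x ∈ (T'.hyp p' q' i' b').F j) :
    ∃ a : ℂ, a ≠ 0 ∧ f p = a • p' := by
  have hpm : p ∈ (T.hyp p q i b).U :=
    mem_sup_right (mem_sup_left (mem_span_singleton_self p))
  have hqm : q ∈ (T.hyp p q i b).U := mem_sup_left (mem_span_singleton_self q)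
  obtain ⟨a, ha⟩ := (mem_ins_one_iff hT'.F.isFlag.zero).1
    (hfF 1 p ((mem_ins_one_iff hT.F.isFlag.zero).2 ⟨1, by simp⟩))
  refine ⟨a, ?_, ha⟩
  rintro rfl
  have := hfB p hpm q hqm
  simp [ha, hpq] at this

/-- The position of the inserted vector can only go down, and its kind is preserved if it is the
first vector of `F`. -/
theorem Dom.hyp_position (h : Dom B (T.hyp p q i b) (T'.hyp p' q' i' b'))
    (hB : ∀ x y, B x y = B y x) (hT : T.Good B n) (hT' : T'.Good B m) (hpq : B p q = 1)
    (hp' : ∀ x ∈ T'.U, B p' x = 0) (hq' : ∀ x ∈ T'.U, B q' x = 0)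
    (hqq' : B q' q' = 0) (hpq' : B p' q' = 1) : i' ≤ i ∧ (b = true → b' = true) := by
  obtain ⟨f, hfU, hfB, hfu, hfE, hfF⟩ := h
  obtain ⟨a, ha0, ha⟩ := Dom.hyp_map_first hT hT' hpq hfB hfF
  have hpm : p ∈ (T.hyp p q i b).U :=
    mem_sup_right (mem_sup_left (mem_span_singleton_self p))
  have hqm : q ∈ (T.hyp p q i b).U := mem_sup_left (mem_span_singleton_self q)
  have hqp' : B q' p' = 1 := by rw [hB, hpq']
  have hs := hfE (i + 1) _ (mem_ins_of_lt (Nat.lt_succ_self i) _ _)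
  have hfpq := hfB p hpm q hqm
  rw [ha, hpq] at hfpq
  -- If i < i', the image of the inserted vector would lie in T'.U, hence be orthogonal to p' and
  -- q'. But f p is a non-zero multiple of p', which pairs non-trivially with q', and f q pairs
  -- non-trivially with p'.
  rcases mem_ins_iff.1 hs with ⟨h, hx⟩ | ⟨h, c, w, hw, e⟩
  · exfalso
    have hxU := (hT'.E.le _ hx).1
    cases b
    · have : B p' (f q) = 0 := hp' _ hxU
      simp [this] at hfpq
    · have := hq' _ hxU
      simp [ha, hqp', ha0] at this
  · refine ⟨by omega, ?_⟩
    rintro rfl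
    -- For b true and b' false, a non-zero multiple of p' would lie in the span of q' and T'.U,
    -- where B q' vanishes.
    cases b'
    · exfalso
      have h1 := congrArg (B q') e
      have h2 := hq' w (hT'.E.le _ hw).1
      simp [ha, hqp', hqq', h2, ha0] at h1
    · rfl

/-- The isometry respects the lines of p and p' but need not carry q to q'. Still, it carries `T.U`
into the complement of p', which is the sum of ⟨p'⟩ and `T'.U`. As p' is isotropic and orthogonal to
`T'.U`, discarding the p'-component preserves the form, and what remains maps `T.U` into `T'.U`. -/
theorem Dom.of_hyp (h : Dom B (T.hyp p q i b) (T'.hyp p' q' i b))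
    (hB : ∀ x y, B x y = B y x) (hT : T.Good B n) (hT' : T'.Good B m) (hpq : B p q = 1)
    (hp : ∀ x ∈ T.U, B p x = 0)
    (hp' : ∀ x ∈ T'.U, B p' x = 0) (hq' : ∀ x ∈ T'.U, B q' x = 0)
    (hpp' : B p' p' = 0) (hpq' : B p' q' = 1) : Dom B T T' := by
  obtain ⟨f, hfU, hfB, hfu, hfE, hfF⟩ := h
  obtain ⟨a, ha0, ha⟩ := Dom.hyp_map_first hT hT' hpq hfB hfF
  have hpm : p ∈ (T.hyp p q i b).U :=
    mem_sup_right (mem_sup_left (mem_span_singleton_self p))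
  have hle : T.U ≤ (T.hyp p q i b).U := le_sup_right.trans le_sup_right
  have hqp' : B q' p' = 1 := by rw [hB, hpq']
  have hperp : ∀ x ∈ T.U, B p' (f x) = 0 := by
    intro x hx
    have := hfB p hpm x (hle hx)
    rw [ha, hp x hx] at this
    simpa [ha0] using this
  have key : ∀ x ∈ T.U, ∃ c : ℂ, ∃ v ∈ T'.U, f x = c • p' + v := by
    intro x hx
    obtain ⟨d, w, hw, e⟩ := mem_span_sup_iff.1 (hfU x (hle hx))
    obtain ⟨c, v, hv, rfl⟩ := mem_span_sup_iff.1 hw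
    have := hperp x hx
    have hd : d = 0 := by simpa [e, hpq', hpp', hp' v hv] using this
    exact ⟨c, v, hv, by simpa [hd] using e⟩
  let g : V →ₗ[ℂ] V := f - ((B q').comp f).smulRight p'
  have hg : ∀ (x : V) (c : ℂ) (v : V), v ∈ T'.U → f x = c • p' + v → g x = v := by
    intro x c v hv e
    simp [g, e, hqp', hq' v hv]
  refine ⟨g, fun x hx => ?_, fun x hx y hy => ?_, ?_, fun j x hx => ?_, fun j x hx => ?_⟩
  · obtain ⟨c, v, hv, e⟩ := key x hx
    rwa [hg x c v hv e]
  · obtain ⟨c, v, hv, e⟩ := key x hx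
    obtain ⟨d, w, hw, e'⟩ := key y hy
    rw [hg x c v hv e, hg y d w hw e', ← hfB x (hle hx) y (hle hy), e, e']
    simp [hpp', hp' w hw, hB v p', hp' v hv]
  · exact hg T.u 0 T'.u hT'.mem (by rw [zero_smul, zero_add]; exact hfu)
  · have hxU := (hT.E.le j hx).1
    by_cases hj : j ≤ i
    · rcases mem_ins_iff.1 (hfE j x (mem_ins_iff.2 (Or.inl ⟨hj, hx⟩))) with ⟨-, h⟩ | ⟨h, -⟩
      · rwa [hg x 0 (f x) (hT'.E.le j h).1 (by simp)]
      · omega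
    · rcases mem_ins_iff.1 (hfE (j + 1) x (le_ins_succ (by omega) _ _ hx)) with
        ⟨h, -⟩ | ⟨-, c, w, hw, e⟩
      · omega
      · have hwU := (hT'.E.le _ hw).1
        cases b
        · have := hperp x hxU
          have hc : c = 0 := by simpa [e, hpq', hp' w hwU] using this
          rw [hg x 0 w hwU (by simpa [hc] using e)]
          exact hw
        · rw [hg x c w hwU (by simpa using e)]
          exact hw
  · rcases mem_ins_iff.1 (hfF (j + 1) x (le_ins_succ (Nat.zero_le j) _ _ hx)) with
      ⟨h, -⟩ | ⟨-, c, w, hw, e⟩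
    · omega
    · rw [hg x c w (hT'.F.le _ hw) e]
      exact hw

end Hyperbolic

/-- Isometric configurations have the same type. -/
theorem HasType.eq_of_dom (hB : ∀ x y, B x y = B y x) : ∀ (n : ℕ) (c c' : Code n)
    (T T' : Config V), HasType B n c T → HasType B n c' T' → Dom B T T' → Dom B T' T → c = c' := by
  intro n
  induction n using Nat.strong_induction_on with
  | _ n ih =>
    match n, ih with
    | 0, _ => exact fun _ _ _ _ _ _ _ _ => rfl
    | 1, _ => exact fun _ _ _ _ _ _ _ _ => rfl
    | n + 2, ih =>
      rintro (c | ⟨i, b, c⟩) (c' | ⟨i', b', c'⟩) T T' h h' hd hd'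
      · obtain ⟨T, u, hT, h1, h2, -, rfl⟩ := h
        obtain ⟨T', u', hT', h1', h2', -, rfl⟩ := h'
        have g := hT.good hB
        have g' := hT'.good hB
        exact congrArg Sum.inl (ih (n + 1) (by omega) c c' T T' hT hT'
          (hd.of_ext g g' h1 h1' h2') (hd'.of_ext g' g h1' h1 h2))
      · obtain ⟨T, u, hT, h1, h2, -, rfl⟩ := h
        obtain ⟨T', p', q', hT', h1', -, -, -, -, rfl⟩ := h'
        exact absurd hd (not_dom_ext_hyp hB (hT.good hB) (hT'.good hB) h1 h2 h1')
      · obtain ⟨T, p, q, hT, h1, h2, h3, h4, h5, rfl⟩ := h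
        obtain ⟨T', u, hT', h1', h2', -, rfl⟩ := h'
        exact absurd hd (not_dom_hyp_ext hB (hT'.good hB) (hT.good hB) h1' h2' h1 h5)
      · obtain ⟨T, p, q, hT, h1, h2, h3, h4, h5, rfl⟩ := h
        obtain ⟨T', p', q', hT', h1', h2', h3', h4', h5', rfl⟩ := h'
        have g := hT.good hB
        have g' := hT'.good hB
        obtain ⟨hi, hb⟩ := hd.hyp_position hB g g' h5 h1' h2' h4' h5'
        obtain ⟨hi', hb'⟩ := hd'.hyp_position hB g' g h5' h1 h2 h4 h5
        -- The one-sided comparisons of positions and kinds, used in both directions, become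
        -- equalities.
        obtain rfl : i = i' := Fin.ext (le_antisymm hi' hi)
        obtain rfl : b = b' := Bool.eq_iff_iff.2 ⟨hb, hb'⟩
        have := ih n (by omega) c c' T T' hT hT'
          (hd.of_hyp hB g g' h5 h1 h1' h2' h3' h5')
          (hd'.of_hyp hB g' g h5' h1' h1 h2 h3 h5)
        rw [this]

end Uniqueness

end OrthFlag

namespace OrthFlag

/-! ### Counting codes and solving the differential equation -/

section Counting

theorem Code.finite : ∀ n : ℕ, Finite (Code n)
  | 0 => inferInstanceAs (Finite Unit)
  | 1 => inferInstanceAs (Finite Unit)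
  | n + 2 => by
    have := Code.finite n
    have := Code.finite (n + 1)
    exact inferInstanceAs (Finite (Code (n + 1) ⊕ (Fin ((n + 2) / 2) × Bool × Code n)))

theorem Code.card_zero : Nat.card (Code 0) = 1 :=
  Nat.card_unique (α := Unit)

theorem Code.card_one : Nat.card (Code 1) = 1 :=
  Nat.card_unique (α := Unit)

theorem Code.card_add_two (n : ℕ) : Nat.card (Code (n + 2)) =
    Nat.card (Code (n + 1)) + (n + 2) / 2 * (2 * Nat.card (Code n)) := by
  have := Code.finite n
  have := Code.finite (n + 1)
  change Nat.card (Code (n + 1) ⊕ (Fin ((n + 2) / 2) × Bool × Code n)) = _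
  rw [Nat.card_sum, Nat.card_prod, Nat.card_prod]
  simp

/-- The number of types of configurations in dimension `2ℓ`. -/
noncomputable def codeCount : ℕ → ℕ
  -- Dimension 2ℓ corresponds to `Code (2ℓ - 1)`, so ℓ = 0 has no code and is given the value 1: it
  -- counts the single orbit and provides the constant term.
  | 0 => 1
  | l + 1 => Nat.card (Code (2 * l + 1))

/-- In dimension 2ℓ+2 the complement of u has dimension 2ℓ+1 and E has ℓ jumps; in dimension 2ℓ+3,
treated next, it has ℓ+1. The factor 2 is the choice between p and q. -/
theorem codeCount_succ (l : ℕ) :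
    codeCount (l + 1) = Nat.card (Code (2 * l)) + 2 * l * codeCount l := by
  cases l with
  | zero => simp [codeCount, Code.card_zero, Code.card_one]
  | succ l =>
    have h := Code.card_add_two (2 * l + 1)
    rw [show (2 * l + 1 + 2) / 2 = l + 1 by omega] at h
    change Nat.card (Code (2 * l + 1 + 2)) =
      Nat.card (Code (2 * l + 1 + 1)) + 2 * (l + 1) * Nat.card (Code (2 * l + 1))
    rw [h]
    ring

theorem card_code_even_succ (l : ℕ) :
    Nat.card (Code (2 * (l + 1))) = codeCount (l + 1) + 2 * (l + 1) * Nat.card (Code (2 * l)) := by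
  have h := Code.card_add_two (2 * l)
  rw [show (2 * l + 2) / 2 = l + 1 by omega] at h
  change Nat.card (Code (2 * l + 2)) = Nat.card (Code (2 * l + 1)) + _
  rw [h]
  ring

open PowerSeries in
theorem coeff_two_mul_X_mul (f : ℂ⟦X⟧) (n : ℕ) :
    coeff (n + 1) (2 * X * f) = 2 * coeff n f := by
  rw [mul_assoc, ← map_ofNat (C (R := ℂ)) 2, coeff_C_mul, coeff_succ_X_mul]

open PowerSeries in
-- With A and Q the generating functions for dimensions 2ℓ and 2ℓ+1, the two recursions read A' = Q
-- + 2xA' and Q = A + 2xQ. Eliminating Q gives the equation.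
theorem egf_codeCount_derivative :
    (1 - 2 * X) ^ 2 * d⁄dX ℂ (egf fun l => (codeCount l : ℂ)) = egf fun l => (codeCount l : ℂ) := by
  set A := egf fun l => (codeCount l : ℂ) with hA
  set Q := egf fun l => (Nat.card (Code (2 * l)) : ℂ) with hQ
  have h1 : d⁄dX ℂ A = Q + 2 * X * d⁄dX ℂ A := by
    ext n
    rw [map_add]
    have hf : ((n ! : ℕ) : ℂ) ≠ 0 := by exact_mod_cast Nat.factorial_ne_zero n
    have hn1 : ((n : ℂ) + 1) ≠ 0 := by exact_mod_cast Nat.succ_ne_zero n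
    cases n with
    | zero =>
      rw [coeff_derivative]
      simp [hA, hQ, egf, codeCount_succ 0]
    | succ n =>
      have hf' : ((n ! : ℕ) : ℂ) ≠ 0 := by exact_mod_cast Nat.factorial_ne_zero n
      rw [coeff_two_mul_X_mul, coeff_derivative, coeff_derivative]
      simp only [hA, hQ, egf, coeff_mk, codeCount_succ (n + 1), Nat.factorial_succ]
      push_cast at hn1 ⊢
      have hn : (n : ℂ) + 1 ≠ 0 := by exact_mod_cast Nat.succ_ne_zero n
      field_simp
  have h2 : Q = A + 2 * X * Q := by
    ext n
    rw [map_add]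
    cases n with
    | zero =>
      simp [hA, hQ, egf, codeCount, Code.card_zero]
    | succ n =>
      have hf' : ((n ! : ℕ) : ℂ) ≠ 0 := by exact_mod_cast Nat.factorial_ne_zero n
      have hn : (n : ℂ) + 1 ≠ 0 := by exact_mod_cast Nat.succ_ne_zero n
      rw [coeff_two_mul_X_mul]
      simp only [hA, hQ, egf, coeff_mk, card_code_even_succ n, Nat.factorial_succ]
      push_cast
      field_simp
  linear_combination (1 - 2 * X) * h1 + h2

open PowerSeries in
/-- A solution of `(1 - 2x)² f' = f` is determined by its constant coefficient. -/
theorem eq_of_derivative_eq {f g : ℂ⟦X⟧} (hf : (1 - 2 * X) ^ 2 * d⁄dX ℂ f = f)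
    (hg : (1 - 2 * X) ^ 2 * d⁄dX ℂ g = g) (hf0 : constantCoeff f = 1)
    (hg0 : constantCoeff g = 1) : f = g := by
  have hne : (1 - 2 * X : ℂ⟦X⟧) ^ 2 ≠ 0 := by
    intro h
    have := congrArg constantCoeff h
    simp at this
  have hgi : g * g⁻¹ = 1 := PowerSeries.mul_inv_cancel g (by simp [hg0])
  have hg' : d⁄dX ℂ g * g⁻¹ + g * d⁄dX ℂ g⁻¹ = 0 := by
    have := congrArg (d⁄dX ℂ) hgi
    rw [Derivation.leibniz, Derivation.map_one_eq_zero] at this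
    simpa [add_comm, mul_comm] using this
  -- The quotient of two solutions has derivative zero, so it equals its constant coefficient 1.
  have h1 : d⁄dX ℂ (f * g⁻¹) = 0 := by
    rw [Derivation.leibniz, smul_eq_mul, smul_eq_mul]
    apply mul_left_cancel₀ hne
    apply mul_left_cancel₀ (show g ≠ 0 by rintro rfl; simp at hg0)
    linear_combination f * (1 - 2 * X) ^ 2 * hg' + g * g⁻¹ * hf - f * g⁻¹ * hg
  have h2 : f * g⁻¹ = 1 := by
    apply derivative.ext
    · rw [h1, Derivation.map_one_eq_zero]
    · simp [hf0, hg0]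
  calc f = f * (g * g⁻¹) := by rw [hgi, mul_one]
    _ = f * g⁻¹ * g := by ring
    _ = g := by rw [h2, one_mul]

open PowerSeries in
-- The series h = x/(1-2x) has derivative (1-2x)⁻², so exp ∘ h solves the same equation with the
-- same constant coefficient.
theorem egf_codeCount : egf (fun l => (codeCount l : ℂ)) =
    (PowerSeries.exp ℂ).subst
      ((PowerSeries.X : PowerSeries ℂ) * (1 - 2 * (PowerSeries.X : PowerSeries ℂ))⁻¹) := by
  set h : ℂ⟦X⟧ := X * (1 - 2 * X)⁻¹ with hh
  have hh0 : constantCoeff h = 0 := by simp [hh]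
  have hs : HasSubst h := HasSubst.of_constantCoeff_zero' hh0
  have hu : (1 - 2 * X : ℂ⟦X⟧)⁻¹ * (1 - 2 * X) = 1 := PowerSeries.inv_mul_cancel _ (by simp)
  have hhX : h * (1 - 2 * X) = X := by rw [hh, mul_assoc, hu, mul_one]
  have hd : d⁄dX ℂ h * (1 - 2 * X) ^ 2 = 1 := by
    have h2 : d⁄dX ℂ (2 : ℂ⟦X⟧) = 0 := by
      rw [← map_ofNat (C (R := ℂ)) 2, derivative_C]
    have := congrArg (d⁄dX ℂ) hhX
    rw [Derivation.leibniz, map_sub, Derivation.map_one_eq_zero, Derivation.leibniz, h2,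
      derivative_X] at this
    simp only [smul_eq_mul] at this
    linear_combination (1 - 2 * X) * this + 2 * hhX
  apply eq_of_derivative_eq egf_codeCount_derivative
  · rw [derivative_subst hs, derivative_exp]
    linear_combination (PowerSeries.exp ℂ).subst h * hd
  · simp [egf, codeCount]
  · rw [← coeff_zero_eq_constantCoeff_apply, coeff_subst' hs, finsum_eq_single _ 0]
    · simp
    · intro n hn
      simp [hh0, hn]

end Counting

end OrthFlag

namespace OrthFlag

open Module Submodule LinearMap

/-! ### The standard form, the fixed vector and the coordinate flags -/

section StandardForm

variable {n : ℕ}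

/-- `beta` as a bilinear form. -/
noncomputable def stdForm (n : ℕ) : LinearMap.BilinForm ℂ (Fin n → ℂ) :=
  Matrix.toBilin' (antidiag n)

theorem stdForm_apply (x y : Fin n → ℂ) : stdForm n x y = beta n x y := by
  rw [stdForm, Matrix.toBilin'_apply', beta]

theorem antidiag_mulVec (x : Fin n → ℂ) (i : Fin n) : (antidiag n *ᵥ x) i = x i.rev := by
  rw [Matrix.mulVec, dotProduct, Finset.sum_eq_single i.rev]
  · simp [antidiag]
  · intro j _ hj
    have : i ≠ j.rev := fun h => hj (by rw [h, Fin.rev_rev])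
    simp [antidiag, this]
  · simp

theorem beta_eq_sum (x y : Fin n → ℂ) : beta n x y = ∑ i, x i * y i.rev := by
  simp only [beta, dotProduct, antidiag_mulVec]

theorem stdForm_symm (x y : Fin n → ℂ) : stdForm n x y = stdForm n y x := by
  rw [stdForm_apply, stdForm_apply, beta_eq_sum, beta_eq_sum, ← Equiv.sum_comp Fin.revPerm]
  simp [mul_comm]

theorem beta_single_left (i : Fin n) (x : Fin n → ℂ) : beta n (Pi.single i 1) x = x i.rev := by
  simp [beta, antidiag_mulVec]

theorem beta_single_right (i : Fin n) (x : Fin n → ℂ) : beta n x (Pi.single i 1) = x i.rev := by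
  rw [← stdForm_apply, stdForm_symm, stdForm_apply, beta_single_left]

theorem stdForm_nondeg : NondegOn (stdForm n) ⊤ := by
  intro x _ h
  funext i
  have := h (Pi.single i.rev 1) mem_top
  rwa [stdForm_apply, beta_single_right, Fin.rev_rev] at this

theorem middleVec_norm (l : ℕ) (hl : 1 ≤ l) :
    stdForm (2 * l) (middleVec l) (middleVec l) = -2 := by
  rw [stdForm_apply, beta_eq_sum]
  rw [Finset.sum_eq_add (⟨l - 1, by omega⟩ : Fin (2 * l)) ⟨l, by omega⟩ (by simp; omega)]
  · have h1 : 2 * l - l = l := by omega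
    have h2 : 2 * l - (l + 1) + 1 = l := by omega
    have h3 : l - 1 + 1 = l := by omega
    have h4 : ¬ l - 1 = l := by omega
    simp [middleVec, Fin.rev, h1, h2, h3]
    norm_num
  · intro i _ hi
    have h1 : (i : ℕ) + 1 ≠ l := fun h => hi.1 (Fin.ext (by simp; omega))
    have h2 : (i : ℕ) ≠ l := fun h => hi.2 (Fin.ext h)
    simp [middleVec, h1, h2]
  · simp
  · simp

/-- The span of the first `k` standard basis vectors. -/
def coordSub (n k : ℕ) : Submodule ℂ (Fin n → ℂ) where
  carrier := {x | ∀ i : Fin n, k ≤ i → x i = 0}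
  zero_mem' := by simp
  add_mem' := by
    intro x y hx hy i hi
    simp [hx i hi, hy i hi]
  smul_mem' := by
    intro c x hx i hi
    simp [hx i hi]

theorem mem_coordSub {k : ℕ} {x : Fin n → ℂ} :
    x ∈ coordSub n k ↔ ∀ i : Fin n, k ≤ i → x i = 0 := Iff.rfl

theorem coordSub_mono {k m : ℕ} (h : k ≤ m) : coordSub n k ≤ coordSub n m :=
  fun _ hx i hi => hx i (h.trans hi)

theorem single_mem_coordSub {k : ℕ} {i : Fin n} : (Pi.single i 1 : Fin n → ℂ) ∈ coordSub n k ↔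
    (i : ℕ) < k := by
  rw [mem_coordSub]
  constructor
  · intro h
    by_contra hk
    have := h i (by omega)
    simp at this
  · intro h j hj
    rw [Pi.single_eq_of_ne]
    rintro rfl
    omega

theorem coordSub_succ {k : ℕ} (hk : k < n) :
    coordSub n (k + 1) = span ℂ {Pi.single ⟨k, hk⟩ 1} ⊔ coordSub n k := by
  apply le_antisymm
  · intro x hx
    refine mem_span_sup_iff.2 ⟨x ⟨k, hk⟩, x - x ⟨k, hk⟩ • Pi.single ⟨k, hk⟩ 1, ?_, by abel⟩
    intro i hi
    by_cases h : i = ⟨k, hk⟩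
    · simp [h]
    · have : (i : ℕ) ≠ k := fun h' => h (Fin.ext h')
      simp [h, hx i (by omega)]
  · refine sup_le ?_ (coordSub_mono (Nat.le_succ k))
    rw [span_singleton_le_iff_mem, single_mem_coordSub]
    simp

theorem finrank_coordSub : ∀ {k : ℕ}, k ≤ n → finrank ℂ (coordSub n k) = k
  | 0, _ => by
    rw [Submodule.finrank_eq_zero, eq_bot_iff]
    intro x hx
    exact funext fun i => hx i (Nat.zero_le _)
  | k + 1, hk => by
    rw [coordSub_succ (by omega), finrank_span_sup, finrank_coordSub (by omega)]
    rw [single_mem_coordSub]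
    simp

theorem beta_coordSub {k m : ℕ} (h : k + m ≤ n) {x y : Fin n → ℂ} (hx : x ∈ coordSub n k)
    (hy : y ∈ coordSub n m) : beta n x y = 0 := by
  rw [beta_eq_sum]
  refine Finset.sum_eq_zero fun i _ => ?_
  by_cases hi : k ≤ i
  · rw [hx i hi, zero_mul]
  · rw [hy i.rev (by simp [Fin.rev]; omega), mul_zero]

/-- The standard isotropic flag, stationary from the `r`-th member on. -/
def stdFlag (n r j : ℕ) : Submodule ℂ (Fin n → ℂ) := coordSub n (min j r)

theorem stdFlag_isFlag {r : ℕ} (h : 2 * r ≤ n) : IsFlag (stdForm n) r (stdFlag n r) where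
  mono i j hij := coordSub_mono (by omega)
  finrank_eq j := finrank_coordSub (by omega)
  isotropic j x hx y hy := by
    rw [stdForm_apply]
    exact beta_coordSub (by omega) hx hy

theorem stdFlag_isFullFlag : IsFullFlag (stdForm n) ⊤ (stdFlag n (n / 2)) := by
  refine ⟨?_, fun _ => le_top⟩
  rw [finrank_top, finrank_fin_fun]
  exact stdFlag_isFlag (by omega)

theorem stdFlag_isFullFlag_middle {l : ℕ} (hl : 1 ≤ l) :
    IsFullFlag (stdForm (2 * l)) (⊤ ⊓ ker (stdForm (2 * l) (middleVec l)))
      (stdFlag (2 * l) (l - 1)) := by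
  have h1 := finrank_inf_ker (W := ⊤) (s := middleVec l) (f := stdForm (2 * l) (middleVec l))
    mem_top (by rw [middleVec_norm l hl]; norm_num)
  rw [finrank_top, finrank_fin_fun] at h1
  refine ⟨?_, fun j x hx => ⟨mem_top, ?_⟩⟩
  · rw [show finrank ℂ ↥(⊤ ⊓ ker (stdForm (2 * l) (middleVec l))) / 2 = l - 1 by omega]
    exact stdFlag_isFlag (by omega)
  · change stdForm (2 * l) (middleVec l) x = 0
    rw [stdForm_apply]
    -- The vector `middleVec l` only involves the first l + 1 coordinates, whose span is orthogonal
    -- to that of the first l - 1 basis vectors.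
    refine beta_coordSub (k := l + 1) (m := l - 1) (by omega) ?_
      (coordSub_mono (min_le_right _ _) hx)
    intro i hi
    rw [middleVec, if_neg (by omega), if_neg (by omega)]

end StandardForm

/-! ### Orthogonal matrices, triangularity and determinants -/

section OrthogonalMatrices

variable {n : ℕ}

/-- The matrix `M` preserves the form `beta`. -/
def IsOrth (M : Matrix (Fin n) (Fin n) ℂ) : Prop :=
  ∀ x y, beta n (M *ᵥ x) (M *ᵥ y) = beta n x y

theorem IsOrth.mul {M N : Matrix (Fin n) (Fin n) ℂ} (hM : IsOrth M) (hN : IsOrth N) :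
    IsOrth (M * N) := by
  intro x y
  rw [← Matrix.mulVec_mulVec, ← Matrix.mulVec_mulVec, hM, hN]

theorem mat_isOrth (g : SO n) : IsOrth (mat g) := beta_mat g

theorem det_mat (g : SO n) : (mat g).det = 1 := g.1.2

theorem antidiag_mul_self : antidiag n * antidiag n = 1 := by
  apply Matrix.ext_of_mulVec_single
  intro i
  rw [← Matrix.mulVec_mulVec, Matrix.one_mulVec]
  funext j
  rw [antidiag_mulVec, antidiag_mulVec, Fin.rev_rev]

theorem IsOrth.transpose_mul {M : Matrix (Fin n) (Fin n) ℂ} (hM : IsOrth M) :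
    Mᵀ * antidiag n * M = antidiag n := by
  ext i j
  have h := hM (Pi.single i 1) (Pi.single j 1)
  have e : ∀ x y : Fin n → ℂ, beta n (M *ᵥ x) (M *ᵥ y) = x ⬝ᵥ ((Mᵀ * antidiag n * M) *ᵥ y) := by
    intro x y
    rw [beta, ← Matrix.vecMul_transpose, ← Matrix.dotProduct_mulVec, Matrix.mulVec_mulVec,
      Matrix.mulVec_mulVec, Matrix.mul_assoc]
  rw [e] at h
  simpa [beta] using h

theorem IsOrth.det_sq {M : Matrix (Fin n) (Fin n) ℂ} (hM : IsOrth M) : M.det = 1 ∨ M.det = -1 := by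
  have h1 := congrArg Matrix.det hM.transpose_mul
  have h2 := congrArg Matrix.det (antidiag_mul_self (n := n))
  rw [Matrix.det_mul, Matrix.det_one] at h2
  rw [Matrix.det_mul, Matrix.det_mul, Matrix.det_transpose] at h1
  have h3 : (antidiag n).det ≠ 0 := fun h => by simp [h] at h2
  rw [← mul_self_eq_one_iff]
  apply mul_left_cancel₀ h3
  linear_combination h1

theorem IsOrth.injective {M : Matrix (Fin n) (Fin n) ℂ} (hM : IsOrth M) :
    Function.Injective M.mulVecLin := by
  rw [← ker_eq_bot, ker_eq_bot']
  intro x hx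
  refine stdForm_nondeg x mem_top fun y _ => ?_
  rw [stdForm_apply, ← hM, ← Matrix.mulVecLin_apply M x, hx, ← stdForm_apply, map_zero,
    LinearMap.zero_apply]

/-- An orthogonal matrix of determinant one as an element of `SO n`. -/
def IsOrth.toSO {M : Matrix (Fin n) (Fin n) ℂ} (hM : IsOrth M) (hd : M.det = 1) : SO n :=
  ⟨⟨M, hd⟩, hM⟩

theorem IsOrth.mat_toSO {M : Matrix (Fin n) (Fin n) ℂ} (hM : IsOrth M) (hd : M.det = 1) :
    mat (hM.toSO hd) = M := rfl

theorem mat_mulVec_inv (g : SO n) (x : Fin n → ℂ) : mat g *ᵥ (mat g⁻¹ *ᵥ x) = x := by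
  rw [Matrix.mulVec_mulVec, mat_mul_inv, Matrix.one_mulVec]

theorem mat_inv_mulVec (g : SO n) (x : Fin n → ℂ) : mat g⁻¹ *ᵥ (mat g *ᵥ x) = x := by
  rw [Matrix.mulVec_mulVec, mat_inv_mul, Matrix.one_mulVec]

/-- A matrix is upper triangular. -/
def IsUpper (M : Matrix (Fin n) (Fin n) ℂ) : Prop := ∀ i j : Fin n, j < i → M i j = 0

theorem IsUpper.mulVec_mem {M : Matrix (Fin n) (Fin n) ℂ} (hM : IsUpper M) {k : ℕ} {x : Fin n → ℂ}
    (hx : x ∈ coordSub n k) : M *ᵥ x ∈ coordSub n k := by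
  intro i hi
  rw [Matrix.mulVec, dotProduct]
  refine Finset.sum_eq_zero fun j _ => ?_
  by_cases hj : j < i
  · rw [hM i j hj, zero_mul]
  · rw [hx j (by rw [not_lt, Fin.le_def] at hj; omega), mul_zero]

theorem mem_coordSub_of_mulVec_mem {M : Matrix (Fin n) (Fin n) ℂ}
    (hM : Function.Injective M.mulVecLin)
    {k : ℕ} (hk : ∀ x ∈ coordSub n k, M *ᵥ x ∈ coordSub n k) {x : Fin n → ℂ}
    (hx : M *ᵥ x ∈ coordSub n k) : x ∈ coordSub n k := by
  have h1 : (coordSub n k).map M.mulVecLin ≤ coordSub n k := by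
    rintro _ ⟨y, hy, rfl⟩
    exact hk y hy
  have h2 : (coordSub n k).map M.mulVecLin = coordSub n k :=
    eq_of_le_of_finrank_eq h1 (Submodule.equivMapOfInjective _ hM _).finrank_eq.symm
  rw [← h2] at hx
  obtain ⟨y, hy, e⟩ := hx
  rwa [← hM e]

/-- An orthogonal matrix preserving the standard maximal isotropic flag is upper triangular. -/
theorem IsOrth.isUpper {M : Matrix (Fin n) (Fin n) ℂ} (hM : IsOrth M)
    (hF : ∀ k ≤ n / 2, ∀ x ∈ coordSub n k, M *ᵥ x ∈ coordSub n k) (hn : Even n) : IsUpper M := by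
  intro i j hij
  have hij' : (j : ℕ) < i := hij
  by_cases hj : (j : ℕ) + 1 ≤ n / 2
  · have := hF (j + 1) hj (Pi.single j 1) (by rw [single_mem_coordSub]; omega) i (by omega)
    simpa using this
  -- Columns in the right half follow from the left half by orthogonality: the entry (i, j) is the
  -- pairing of M e_j with e_{rev i}, that is, of e_j with a preimage of e_{rev i} lying in a stable
  -- coordinate subspace.
  · obtain ⟨m, rfl⟩ := hn
    have hk : (i.rev : ℕ) + 1 ≤ (m + m) / 2 := by
      simp [Fin.rev]
      omega
    have hmap := hF _ hk
    have hsurj : ∃ y, M *ᵥ y = Pi.single i.rev 1 :=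
      (LinearMap.injective_iff_surjective.1 hM.injective) (Pi.single i.rev 1)
    obtain ⟨y, hy⟩ := hsurj
    have hyk : y ∈ coordSub (m + m) (i.rev + 1) := by
      apply mem_coordSub_of_mulVec_mem hM.injective hmap
      rw [hy, single_mem_coordSub]
      omega
    have h1 := hM y (Pi.single j 1)
    rw [hy, beta_single_left, beta_single_right, Fin.rev_rev,
      hyk j.rev (by simp [Fin.rev]; omega)] at h1
    simpa using h1

/-- Diagonal entries in positions i and `i.rev` are mutually inverse, and for even n no index is its
own reverse. -/
theorem IsOrth.det_of_isUpper {M : Matrix (Fin n) (Fin n) ℂ} (hM : IsOrth M) (hU : IsUpper M)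
    (hn : Even n) : M.det = 1 := by
  rw [Matrix.det_of_isUpperTriangular (fun i j hij => hU i j hij)]
  refine Finset.prod_involution (fun i _ => i.rev) ?_ ?_ ?_ ?_
  · intro i _
    have h := hM (Pi.single i 1) (Pi.single i.rev 1)
    rw [beta_single_left, beta_eq_sum, Finset.sum_eq_single i] at h
    · simpa using h
    · intro k _ hk
      rcases lt_or_gt_of_ne hk with hk | hk
      · have : i.rev < k.rev := Fin.rev_lt_rev.2 hk
        simp [hU _ _ this]
      · simp [hU _ _ hk]
    · simp
  · intro i _ _ h
    obtain ⟨m, rfl⟩ := hn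
    have := congrArg Fin.val h
    simp [Fin.rev] at this
    omega
  · simp
  · simp

/-- The permutation matrix interchanging the two middle basis vectors. -/
def midSwap (l : ℕ) (hl : 1 ≤ l) : Matrix (Fin (2 * l)) (Fin (2 * l)) ℂ :=
  (Equiv.swap (⟨l - 1, by omega⟩ : Fin (2 * l)) ⟨l, by omega⟩).permMatrix ℂ

variable {l : ℕ} (hl : 1 ≤ l)

theorem midSwap_mulVec (x : Fin (2 * l) → ℂ) (i : Fin (2 * l)) :
    (midSwap l hl *ᵥ x) i = x (Equiv.swap (⟨l - 1, by omega⟩ : Fin (2 * l)) ⟨l, by omega⟩ i) := by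
  rw [midSwap, Matrix.permMatrix_mulVec]
  rfl

theorem det_midSwap : (midSwap l hl).det = -1 := by
  rw [midSwap, Matrix.det_permutation, Equiv.Perm.sign_swap]
  · simp
  · simp
    omega

theorem midSwap_rev (i : Fin (2 * l)) :
    (Equiv.swap (⟨l - 1, by omega⟩ : Fin (2 * l)) ⟨l, by omega⟩ i).rev =
      Equiv.swap (⟨l - 1, by omega⟩ : Fin (2 * l)) ⟨l, by omega⟩ i.rev := by
  have h1 : (⟨l - 1, by omega⟩ : Fin (2 * l)).rev = ⟨l, by omega⟩ := by
    ext
    simp [Fin.rev]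
    omega
  have h2 : (⟨l, by omega⟩ : Fin (2 * l)).rev = ⟨l - 1, by omega⟩ := by
    rw [← h1, Fin.rev_rev]
  have e := Fin.revPerm.injective.map_swap (f := Fin.rev) (x := (⟨l - 1, by omega⟩ : Fin (2 * l)))
    (y := ⟨l, by omega⟩) (z := i)
  rw [e, h1, h2, Equiv.swap_comm]

theorem midSwap_isOrth : IsOrth (midSwap l hl) := by
  intro x y
  simp only [beta_eq_sum, midSwap_mulVec, ← midSwap_rev hl]
  exact Equiv.sum_comp (Equiv.swap (⟨l - 1, by omega⟩ : Fin (2 * l)) ⟨l, by omega⟩)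
    fun i => x i * y i.rev

theorem midSwap_mem {k : ℕ} (hk : k ≤ l - 1 ∨ l + 1 ≤ k) {x : Fin (2 * l) → ℂ}
    (hx : x ∈ coordSub (2 * l) k) : midSwap l hl *ᵥ x ∈ coordSub (2 * l) k := by
  intro i hi
  rw [midSwap_mulVec]
  apply hx
  rw [Equiv.swap_apply_def]
  split_ifs with h1 h2
  · have := congrArg Fin.val h1
    simp at this ⊢
    omega
  · have := congrArg Fin.val h2
    simp at this ⊢
    omega
  · exact hi

/-- An orthogonal matrix of determinant one preserving the standard isotropic flag up to dimension
`ℓ - 1` is upper triangular. -/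
theorem IsOrth.isUpper_of_det (hl : 1 ≤ l) {M : Matrix (Fin (2 * l)) (Fin (2 * l)) ℂ}
    (hM : IsOrth M) (hd : M.det = 1)
    (hF : ∀ k < l, ∀ x ∈ coordSub (2 * l) k, M *ᵥ x ∈ coordSub (2 * l) k) : IsUpper M := by
  set e : Fin (2 * l) → ℂ := Pi.single ⟨l - 1, by omega⟩ 1 with he
  have heven : Even (2 * l) := even_two_mul l
  have hhalf : 2 * l / 2 = l := by omega
  have hsplit : coordSub (2 * l) l = span ℂ {e} ⊔ coordSub (2 * l) (l - 1) := by
    have := coordSub_succ (n := 2 * l) (k := l - 1) (by omega)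
    rwa [Nat.sub_add_cancel hl] at this
  have hiso : e ∈ coordSub (2 * l) l := by
    rw [he, single_mem_coordSub]
    simp
    omega
  -- M e is orthogonal to M applied to the stable space of dimension l - 1, that is, to that space
  -- itself, whose complement has dimension l + 1.
  have hw : M *ᵥ e ∈ coordSub (2 * l) (l + 1) := by
    intro i hi
    obtain ⟨y, hy⟩ : ∃ y, M *ᵥ y = Pi.single i.rev 1 :=
      (LinearMap.injective_iff_surjective.1 hM.injective) (Pi.single i.rev 1)
    have hyk : y ∈ coordSub (2 * l) (l - 1) := by
      apply mem_coordSub_of_mulVec_mem hM.injective (hF (l - 1) (by omega))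
      rw [hy, single_mem_coordSub]
      simp [Fin.rev]
      omega
    have h1 := hM y e
    rw [hy, beta_single_left, Fin.rev_rev, beta_coordSub (by omega) hyk hiso] at h1
    exact h1
  set a := (M *ᵥ e) ⟨l - 1, by omega⟩ with ha
  set b := (M *ᵥ e) ⟨l, by omega⟩ with hb
  -- Isotropy of M e reads 2ab = 0: its class is one of the two isotropic lines of the middle plane.
  -- The line b = 0 gives triangularity.
  have hab : a * b = 0 := by
    have h1 := hM e e
    rw [beta_coordSub (by omega) hiso hiso, beta_eq_sum,
      Finset.sum_eq_add (⟨l - 1, by omega⟩ : Fin (2 * l)) ⟨l, by omega⟩ (by simp; omega)] at h1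
    · have h2 : (⟨l - 1, by omega⟩ : Fin (2 * l)).rev = ⟨l, by omega⟩ := by
        ext
        simp [Fin.rev]
        omega
      have h3 : (⟨l, by omega⟩ : Fin (2 * l)).rev = ⟨l - 1, by omega⟩ := by
        rw [← h2, Fin.rev_rev]
      rw [h2, h3, ← ha, ← hb] at h1
      linear_combination h1 / 2
    · intro i _ hi
      have h1 : (i : ℕ) ≠ l - 1 := fun h => hi.1 (Fin.ext h)
      have h2 : (i : ℕ) ≠ l := fun h => hi.2 (Fin.ext h)
      by_cases h : (i : ℕ) < l
      · rw [hw i.rev (by simp [Fin.rev]; omega), mul_zero]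
      · rw [hw i (by omega), zero_mul]
    · simp
    · simp
  rcases mul_eq_zero.1 hab with ha0 | hb0
  -- On the other line, swapping the two middle vectors makes the matrix upper triangular, hence of
  -- determinant 1; but the swap has determinant -1 and M has determinant 1.
  · exfalso
    have hPM := (midSwap_isOrth hl).mul hM
    have hup : IsUpper (midSwap l hl * M) := by
      refine hPM.isUpper ?_ heven
      rw [hhalf]
      intro k hk x hx
      rw [← Matrix.mulVec_mulVec]
      rcases hk.lt_or_eq with hk | rfl
      · exact midSwap_mem hl (by omega) (hF k hk x hx)
      · rw [hsplit] at hx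
        obtain ⟨c, v, hv, rfl⟩ := mem_span_sup_iff.1 hx
        rw [Matrix.mulVec_add, Matrix.mulVec_add, Matrix.mulVec_smul, Matrix.mulVec_smul]
        refine add_mem (smul_mem _ _ ?_) (coordSub_mono (Nat.sub_le _ 1)
          (midSwap_mem hl (by omega) (hF (k - 1) (by omega) v hv)))
        intro i hi
        rw [midSwap_mulVec, Equiv.swap_apply_def]
        split_ifs with h1 h2
        · have := congrArg Fin.val h1
          simp at this
          omega
        · exact ha0
        · exact hw i (by
            have : (i : ℕ) ≠ k := fun h => h2 (Fin.ext h)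
            omega)
    have := hPM.det_of_isUpper hup heven
    rw [Matrix.det_mul, det_midSwap, hd] at this
    norm_num at this
  · refine hM.isUpper ?_ heven
    rw [hhalf]
    intro k hk x hx
    rcases hk.lt_or_eq with hk | rfl
    · exact hF k hk x hx
    · rw [hsplit] at hx
      obtain ⟨c, v, hv, rfl⟩ := mem_span_sup_iff.1 hx
      rw [Matrix.mulVec_add, Matrix.mulVec_smul]
      refine add_mem (smul_mem _ _ ?_) (coordSub_mono (Nat.sub_le _ 1)
        (hF (k - 1) (by omega) v hv))
      intro i hi
      by_cases h : (i : ℕ) = k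
      · rw [show i = ⟨k, by omega⟩ from Fin.ext h]
        exact hb0
      · exact hw i (by omega)

end OrthogonalMatrices

/-! ### Lie's theorem for solvable algebras of skew operators -/

section LieTheorem

/-- Lie's theorem for a section of a module: if `A` and `C` are submodules of a module over a
solvable Lie algebra and `C` is not contained in `A`, some vector of `C` outside `A` is a common
eigenvector modulo `A`. -/
theorem exists_eigenvector_mod {L M : Type*} [LieRing L] [LieAlgebra ℂ L]
    [LieAlgebra.IsSolvable L] [AddCommGroup M] [Module ℂ M] [FiniteDimensional ℂ M]
    [LieRingModule L M] [LieModule ℂ L M] (A C : LieSubmodule ℂ L M) (h : ¬ C ≤ A) :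
    ∃ v ∈ C, v ∉ A ∧ ∀ X : L, ∃ c : ℂ, ⁅X, v⁆ - c • v ∈ A := by
  obtain ⟨w, hwC, hwA⟩ := SetLike.not_le_iff_exists.1 h
  let N : LieSubmodule ℂ L C := A.comap C.incl
  have : Nontrivial (C ⧸ N) := by
    refine nontrivial_of_ne (LieSubmodule.Quotient.mk (N := N) ⟨w, hwC⟩) 0 fun h0 => hwA ?_
    exact (LieSubmodule.Quotient.mk_eq_zero' (N := N)).1 h0
  obtain ⟨χ, hχ⟩ := LieModule.exists_nontrivial_weightSpace_of_isSolvable ℂ L (C ⧸ N)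
  obtain ⟨⟨y, hy⟩, hy0⟩ := exists_ne (0 : LieModule.weightSpace (C ⧸ N) χ)
  obtain ⟨v, rfl⟩ := LieSubmodule.Quotient.surjective_mk' N y
  refine ⟨v, v.2, fun hvA => hy0 ?_, fun X => ⟨χ X, ?_⟩⟩
  · apply Subtype.ext
    exact (LieSubmodule.Quotient.mk_eq_zero' (N := N)).2 hvA
  · rw [LieModule.mem_weightSpace] at hy
    have h1 := hy X
    have h2 : LieSubmodule.Quotient.mk' N (⁅X, v⁆ - χ X • v) = 0 := by
      rw [map_sub, LieModuleHom.map_lie, h1, map_smul, sub_self]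
    exact (LieSubmodule.Quotient.mk_eq_zero' (N := N)).1 h2

variable {L V : Type*} [LieRing L] [LieAlgebra ℂ L] [LieAlgebra.IsSolvable L] [AddCommGroup V]
  [Module ℂ V] [FiniteDimensional ℂ V] {B : LinearMap.BilinForm ℂ V}

theorem exists_eigenvector_mod_of_rep (ρ : L →ₗ⁅ℂ⁆ Module.End ℂ V) (A C : Submodule ℂ V)
    (hA : ∀ X, ∀ x ∈ A, ρ X x ∈ A) (hC : ∀ X, ∀ x ∈ C, ρ X x ∈ C) (h : ¬ C ≤ A) :
    ∃ v ∈ C, v ∉ A ∧ ∀ X : L, ∃ c : ℂ, ρ X v - c • v ∈ A := by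
  let _ : LieRingModule L V := LieRingModule.compLieHom V ρ
  let _ : LieModule ℂ L V := LieModule.compLieHom V ρ
  exact exists_eigenvector_mod (L := L) (M := V) ⟨A, fun {X x} hx => hA X x hx⟩
    ⟨C, fun {X x} hx => hC X x hx⟩ h

/-- Lie's theorem on W^⊥ modulo W gives an eigenvector v. If v is anisotropic, skewness forces its
weight to be zero, and v^⊥ inside W^⊥ is still larger than W, so it contains a second eigenvector w.
If w is anisotropic too, its weight is also zero, and some v + z w is isotropic of weight zero. -/
theorem exists_isotropic_eigenvector_mod (hB : ∀ x y, B x y = B y x) (ρ : L →ₗ⁅ℂ⁆ Module.End ℂ V)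
    (hρ : ∀ X x y, B (ρ X x) y = -B x (ρ X y)) {W : Submodule ℂ V}
    (hW : ∀ X, ∀ x ∈ W, ρ X x ∈ W)
    (hd : 2 * finrank ℂ W + 2 ≤ finrank ℂ V) :
    ∃ v ∉ W, B v v = 0 ∧ (∀ x ∈ W, B v x = 0) ∧ ∀ X : L, ∃ c : ℂ, ρ X v - c • v ∈ W := by
  let T : V →ₗ[ℂ] Dual ℂ W := B.compl₁₂ LinearMap.id W.subtype
  have hT : ∀ v, v ∈ ker T ↔ ∀ x ∈ W, B v x = 0 := by
    intro v
    rw [mem_ker]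
    exact ⟨fun h x hx => LinearMap.congr_fun h ⟨x, hx⟩, fun h => LinearMap.ext fun x => h x x.2⟩
  have hdim : finrank ℂ V ≤ finrank ℂ W + finrank ℂ (ker T) := by
    rw [← finrank_range_add_finrank_ker T, ← Subspace.dual_finrank_eq (K := ℂ) (V := W)]
    exact Nat.add_le_add_right (Submodule.finrank_le _) _
  have hTinv : ∀ X, ∀ v ∈ ker T, ρ X v ∈ ker T := by
    intro X v hv
    rw [hT] at hv ⊢
    intro x hx
    rw [hρ, hv _ (hW X x hx), neg_zero]
  have hnot : ∀ C : Submodule ℂ V, finrank ℂ W < finrank ℂ C → ¬ C ≤ W := by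
    intro C hC hle
    have := Submodule.finrank_mono hle
    omega
  obtain ⟨v, hv, hvW, hvX⟩ := exists_eigenvector_mod_of_rep ρ W (ker T) hW hTinv
    (hnot _ (by omega))
  by_cases hvv : B v v = 0
  · exact ⟨v, hvW, hvv, (hT v).1 hv, hvX⟩
  have kill : ∀ w ∈ ker T, B w w ≠ 0 → (∀ X : L, ∃ c : ℂ, ρ X w - c • w ∈ W) →
      ∀ X, ρ X w ∈ W := by
    intro w hw hww hwX X
    obtain ⟨c, hc⟩ := hwX X
    have h1 := (hT w).1 hw _ hc
    have h2 := hρ X w w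
    rw [hB (ρ X w) w] at h2
    have h3 : B w (ρ X w) = 0 := by linear_combination h2 / 2
    have hc0 : c = 0 := by simpa [h3, hww] using h1
    simpa [hc0] using hc
  have hvK := kill v hv hvv hvX
  have hd2 := finrank_inf_ker hv hvv
  obtain ⟨w, ⟨hw, hvw⟩, hwW, hwX⟩ := exists_eigenvector_mod_of_rep ρ W (ker T ⊓ ker (B v)) hW
    (fun X x hx => ⟨hTinv X x hx.1, by
      change B v (ρ X x) = 0
      rw [hB, hρ, hB, (hB _ _).trans ((hT x).1 hx.1 _ (hvK X)), neg_zero]⟩) (hnot _ (by omega))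
  have hvw' : B v w = 0 := hvw
  by_cases hww : B w w = 0
  · exact ⟨w, hwW, hww, (hT w).1 hw, hwX⟩
  have hwK := kill w hw hww hwX
  obtain ⟨z, hz⟩ := IsAlgClosed.exists_eq_mul_self (-B v v / B w w)
  refine ⟨v + z • w, fun h => hvv ?_, ?_, fun x hx => ?_, fun X => ⟨0, ?_⟩⟩
  · have := (hT v).1 hv _ h
    simpa [hvw'] using this
  · have h1 : z * z * B w w = -B v v := by
      rw [← hz]
      field_simp
    simp [hvw', hB w v]
    linear_combination h1
  · simp [(hT v).1 hv x hx, (hT w).1 hw x hx]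
  · simpa using add_mem (hvK X) (smul_mem _ z (hwK X))

/-- A solvable Lie algebra of skew operators stabilises a complete isotropic flag. -/
theorem exists_stable_flag (hB : ∀ x y, B x y = B y x) (ρ : L →ₗ⁅ℂ⁆ Module.End ℂ V)
    (hρ : ∀ X x y, B (ρ X x) y = -B x (ρ X y)) :
    ∃ F : ℕ → Submodule ℂ V, IsFullFlag B ⊤ F ∧ ∀ j X, ∀ x ∈ F j, ρ X x ∈ F j := by
  have key : ∀ r ≤ finrank ℂ V / 2, ∃ F : ℕ → Submodule ℂ V, IsFlag B r F ∧
      ∀ j X, ∀ x ∈ F j, ρ X x ∈ F j := by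
    intro r
    induction r with
    | zero =>
      exact fun _ => ⟨fun _ => ⊥, ⟨fun _ _ _ => le_rfl, by simp, by simp⟩, by simp⟩
    | succ r ih =>
      intro hr
      obtain ⟨F, hF, hFX⟩ := ih (by omega)
      have hd := hF.finrank_eq r
      obtain ⟨v, hvW, hvv, hvF, hvX⟩ := exists_isotropic_eigenvector_mod hB ρ hρ (hFX r) (by omega)
      refine ⟨ins r v F, hF.ins hB le_rfl (fun j hj => hvW (hF.le_step j hj)) hvv
        fun j x hx => hvF x (hF.le_step j hx), ?_⟩
      intro j X x hx
      rw [mem_ins_iff] at hx ⊢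
      rcases hx with ⟨h, hx⟩ | ⟨h, a, w, hw, rfl⟩
      · exact Or.inl ⟨h, hFX j X x hx⟩
      · obtain ⟨c, hc⟩ := hvX X
        rw [hF.eq_top_step (show r ≤ j - 1 by omega)] at hw ⊢
        refine Or.inr ⟨h, a * c, a • (ρ X v - c • v) + ρ X w,
          add_mem (smul_mem _ _ hc) (hFX r X w hw), ?_⟩
        simp only [map_add, map_smul, smul_sub, smul_smul]
        abel
  obtain ⟨F, hF, hFX⟩ := key _ le_rfl
  refine ⟨F, ⟨?_, fun _ => le_top⟩, hFX⟩
  rwa [finrank_top]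

end LieTheorem

/-! ### The upper triangular subalgebra is solvable -/

section StandardBorel

variable {n : ℕ}

theorem mem_so_iff_entries (X : Matrix (Fin n) (Fin n) ℂ) :
    X ∈ so n ↔ ∀ i j, X j.rev i.rev = -X i j := by
  rw [mem_so_iff]
  constructor
  · intro h i j
    have := h (Pi.single j 1) (Pi.single i.rev 1)
    rw [beta_single_left, beta_single_right] at this
    simp at this
    rw [this, neg_neg]
  · intro h x y
    rw [beta_eq_sum, beta_eq_sum, ← Finset.sum_neg_distrib]
    simp only [Matrix.mulVec, dotProduct, Finset.sum_mul, Finset.mul_sum, ← Finset.sum_neg_distrib]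
    rw [Finset.sum_comm]
    refine Finset.sum_congr rfl fun i _ => ?_
    rw [← Equiv.sum_comp Fin.revPerm]
    refine Finset.sum_congr rfl fun j _ => ?_
    have := h i.rev j
    simp only [Fin.revPerm_apply, Fin.rev_rev] at this ⊢
    rw [this]
    ring

theorem IsUpper.mul {M N : Matrix (Fin n) (Fin n) ℂ} (hM : IsUpper M) (hN : IsUpper N) :
    IsUpper (M * N) := by
  intro i j hij
  rw [Matrix.mul_apply]
  refine Finset.sum_eq_zero fun k _ => ?_
  by_cases hk : k < i
  · rw [hM i k hk, zero_mul]
  · rw [hN k j (lt_of_lt_of_le hij (not_lt.1 hk)), mul_zero]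

/-- The Lie algebra of upper triangular matrices in `𝔰𝔬(n)`. -/
def stdBorel (n : ℕ) : LieSubalgebra ℂ (so n) where
  carrier := {X | IsUpper X.1}
  zero_mem' := by
    intro i j _
    simp
  add_mem' := by
    intro X Y hX hY i j hij
    simp [hX i j hij, hY i j hij]
  smul_mem' := by
    intro c X hX i j hij
    simp [hX i j hij]
  lie_mem' := by
    intro X Y hX hY i j hij
    have h : ((⁅X, Y⁆ : so n) : Matrix (Fin n) (Fin n) ℂ) = X.1 * Y.1 - Y.1 * X.1 := rfl
    rw [h, Matrix.sub_apply, IsUpper.mul hX hY i j hij, IsUpper.mul hY hX i j hij, sub_zero]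

/-- Each derivation moves the support at least one diagonal up. The only products allowed by the
support bounds at the next diagonal are those of equal-index diagonal entries, which cancel in the
commutator. -/
theorem derivedSeries_stdBorel_entries (k : ℕ) :
    ∀ X ∈ LieAlgebra.derivedSeries ℂ (stdBorel n) k, ∀ i j : Fin n, (j : ℕ) < i + k →
      (X : so n).1 i j = 0 := by
  induction k with
  | zero => exact fun X _ i j hij => X.2 i j hij
  | succ k ih =>
    intro X hX
    rw [LieAlgebra.derivedSeries_def, LieAlgebra.derivedSeriesOfIdeal_succ,
      ← LieSubmodule.mem_toSubmodule, LieSubmodule.lieIdeal_oper_eq_linear_span'] at hX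
    induction hX using Submodule.span_induction with
    | mem Z hZ =>
      obtain ⟨X, hX, Y, hY, rfl⟩ := hZ
      intro i j hij
      have h : ((⁅X, Y⁆ : stdBorel n) : so n).1 =
        (X : so n).1 * (Y : so n).1 - (Y : so n).1 * (X : so n).1 := rfl
      have hX' := ih X hX
      have hY' := ih Y hY
      rw [h, Matrix.sub_apply, Matrix.mul_apply, Matrix.mul_apply, ← Finset.sum_sub_distrib]
      refine Finset.sum_eq_zero fun m _ => ?_
      by_cases h1 : (m : ℕ) < i + k
      · rw [hX' i m h1, hY' i m h1]
        ring
      · by_cases h2 : (j : ℕ) < m + k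
        · rw [hX' m j h2, hY' m j h2]
          ring
        · have e1 : m = i := Fin.ext (by omega)
          have e2 : j = m := Fin.ext (by omega)
          rw [e2, e1]
          ring
    | zero => simp
    | add X Y _ _ hX hY =>
      intro i j hij
      have h : ((X + Y : stdBorel n) : so n).1 = (X : so n).1 + (Y : so n).1 := rfl
      rw [h, Matrix.add_apply, hX i j hij, hY i j hij, add_zero]
    | smul c X _ hX =>
      intro i j hij
      have h : ((c • X : stdBorel n) : so n).1 = c • (X : so n).1 := rfl
      rw [h, Matrix.smul_apply, hX i j hij, smul_zero]

theorem isSolvable_stdBorel : LieAlgebra.IsSolvable (stdBorel n) := by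
  apply LieAlgebra.IsSolvable.mk (R := ℂ) (k := n)
  rw [eq_bot_iff]
  intro X hX
  have h := derivedSeries_stdBorel_entries n X hX
  rw [LieSubmodule.mem_bot]
  apply Subtype.ext
  apply Subtype.ext
  ext i j
  exact h i j (by omega)

end StandardBorel

/-! ### All Borel subalgebras are conjugate to the upper triangular one -/

section BorelSubalgebras

theorem isUpper_of_mem_so {l : ℕ} {Y : Matrix (Fin (2 * l)) (Fin (2 * l)) ℂ} (hY : Y ∈ so (2 * l))
    (hF : ∀ k ≤ l, ∀ x ∈ coordSub (2 * l) k, Y *ᵥ x ∈ coordSub (2 * l) k) : IsUpper Y := by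
  have key : ∀ i j : Fin (2 * l), j < i → (j : ℕ) < l → Y i j = 0 := by
    intro i j hij hj
    have hij' : (j : ℕ) < i := hij
    have := hF (j + 1) hj (Pi.single j 1) (by rw [single_mem_coordSub]; omega) i (by omega)
    simpa using this
  intro i j hij
  by_cases hj : (j : ℕ) < l
  · exact key i j hij hj
  · have hij' : (j : ℕ) < i := hij
    have h := (mem_so_iff_entries Y).1 hY i j
    rw [key j.rev i.rev (Fin.rev_lt_rev.2 hij) (by simp [Fin.rev]; omega)] at h
    exact neg_eq_zero.1 h.symm

section Swap

variable {l : ℕ} (hl : 1 ≤ l) (Y : Matrix (Fin (2 * l)) (Fin (2 * l)) ℂ)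

/-- Conjugation by `midSwap`. -/
def swapConj : Matrix (Fin (2 * l)) (Fin (2 * l)) ℂ :=
  Y.submatrix (Equiv.swap ⟨l - 1, by omega⟩ ⟨l, by omega⟩)
    (Equiv.swap ⟨l - 1, by omega⟩ ⟨l, by omega⟩)

theorem swapConj_swapConj : swapConj hl (swapConj hl Y) = Y := by
  ext i j
  simp [swapConj]

theorem swapConj_mulVec (x : Fin (2 * l) → ℂ) :
    swapConj hl Y *ᵥ x = midSwap l hl *ᵥ (Y *ᵥ (midSwap l hl *ᵥ x)) := by
  funext i
  rw [midSwap_mulVec]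
  simp only [Matrix.mulVec, dotProduct, swapConj, Matrix.submatrix_apply]
  rw [← Equiv.sum_comp (Equiv.swap (⟨l - 1, by omega⟩ : Fin (2 * l)) ⟨l, by omega⟩)]
  refine Finset.sum_congr rfl fun j _ => ?_
  have := midSwap_mulVec hl x j
  rw [Matrix.mulVec, dotProduct] at this
  rw [Equiv.swap_apply_self, this]

theorem midSwap_midSwap (x : Fin (2 * l) → ℂ) : midSwap l hl *ᵥ (midSwap l hl *ᵥ x) = x := by
  funext i
  rw [midSwap_mulVec, midSwap_mulVec, Equiv.swap_apply_self]

variable {Y}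

theorem swapConj_mem_so (hY : Y ∈ so (2 * l)) : swapConj hl Y ∈ so (2 * l) := by
  rw [mem_so_iff_entries] at hY ⊢
  intro i j
  simp only [swapConj, Matrix.submatrix_apply, ← midSwap_rev hl]
  exact hY _ _

/-- The one entry that the swap moves from above to below the diagonal lies on the antidiagonal,
where elements of so vanish. Thus the two maximal isotropic spaces completing the same shorter flag
give the same Borel subalgebra. -/
theorem swapConj_isUpper (hY : Y ∈ so (2 * l)) (hU : IsUpper Y) : IsUpper (swapConj hl Y) := by
  intro i j hij
  have hij' : (j : ℕ) < i := hij
  rw [swapConj, Matrix.submatrix_apply]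
  by_cases h : j = ⟨l - 1, by omega⟩ ∧ i = ⟨l, by omega⟩
  · rw [h.1, h.2, Equiv.swap_apply_left, Equiv.swap_apply_right]
    have h1 := (mem_so_iff_entries Y).1 hY ⟨l - 1, by omega⟩ ⟨l, by omega⟩
    have h2 : (⟨l - 1, by omega⟩ : Fin (2 * l)).rev = ⟨l, by omega⟩ := by
      ext
      simp [Fin.rev]
      omega
    have h3 : (⟨l, by omega⟩ : Fin (2 * l)).rev = ⟨l - 1, by omega⟩ := by
      rw [← h2, Fin.rev_rev]
    rw [h2, h3] at h1
    linear_combination h1 / 2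
  · apply hU
    rw [Equiv.swap_apply_def, Equiv.swap_apply_def]
    simp only [Fin.ext_iff] at h
    split_ifs with h1 h2 h3 h4 h5 h6 <;> simp only [Fin.ext_iff, Fin.lt_def] at * <;> omega

end Swap

variable {l : ℕ}

/-- A solvable subalgebra of `𝔰𝔬(2ℓ)` is conjugate to an algebra of upper triangular matrices. -/
theorem exists_conj_isUpper (hl : 1 ≤ l) (c : LieSubalgebra ℂ (so (2 * l)))
    (hc : LieAlgebra.IsSolvable c) :
    ∃ g : SO (2 * l), ∀ X ∈ c, IsUpper (mat g⁻¹ * X.1 * mat g) := by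
  let ρ : c →ₗ⁅ℂ⁆ Module.End ℂ (Fin (2 * l) → ℂ) :=
    (lieEquivMatrix' (R := ℂ) (n := Fin (2 * l))).symm.toLieHom.comp ((so (2 * l)).incl.comp c.incl)
  have hρ : ∀ (X : c) x, ρ X x = (X : so (2 * l)).1 *ᵥ x := fun X x => rfl
  obtain ⟨F, hF, hFX⟩ := exists_stable_flag (B := stdForm (2 * l)) stdForm_symm ρ (by
    intro X x y
    rw [hρ, hρ, stdForm_apply, stdForm_apply]
    exact (mem_so_iff _).1 (X : so (2 * l)).2 x y)
  obtain ⟨f, -, hfB, hfF⟩ := exists_isometry_flags (B := stdForm (2 * l)) stdForm_symm (2 * l) ⊤ ⊤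
    (stdFlag (2 * l) (2 * l / 2)) F (by simp) (by simp) stdForm_nondeg stdForm_nondeg
    stdFlag_isFullFlag hF
  set M := LinearMap.toMatrix' f with hMf
  have hMx : ∀ x, M *ᵥ x = f x := fun x => by rw [hMf, LinearMap.toMatrix'_mulVec]
  have hM : IsOrth M := by
    intro x y
    rw [hMx, hMx, ← stdForm_apply, hfB x mem_top y mem_top, stdForm_apply]
  have hstab : ∀ X ∈ c, ∀ k ≤ l, ∀ x ∈ coordSub (2 * l) k, ∃ y ∈ coordSub (2 * l) k,
      X.1 *ᵥ (M *ᵥ x) = M *ᵥ y := by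
    intro X hX k hk x hx
    have hstd : stdFlag (2 * l) (2 * l / 2) k = coordSub (2 * l) k := by
      rw [stdFlag, min_eq_left (by omega)]
    have h1 : (coordSub (2 * l) k).map M.mulVecLin ≤ F k := by
      rintro _ ⟨x, hx, rfl⟩
      rw [Matrix.mulVecLin_apply, hMx]
      exact hfF k x (by rwa [hstd])
    have h2 : (coordSub (2 * l) k).map M.mulVecLin = F k := by
      refine eq_of_le_of_finrank_eq h1 ?_
      rw [← (Submodule.equivMapOfInjective _ hM.injective _).finrank_eq, hF.isFlag.finrank_eq,
        finrank_coordSub (by omega), finrank_top, finrank_fin_fun]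
      omega
    have h3 : X.1 *ᵥ (M *ᵥ x) ∈ F k := hFX k ⟨X, hX⟩ _ (h2 ▸ ⟨x, hx, rfl⟩)
    rw [← h2] at h3
    obtain ⟨y, hy, e⟩ := h3
    exact ⟨y, hy, e.symm⟩
  have hpull : ∀ (g : SO (2 * l)) (X : Matrix (Fin (2 * l)) (Fin (2 * l)) ℂ)
      (x y : Fin (2 * l) → ℂ), X *ᵥ (mat g *ᵥ x) = mat g *ᵥ y → (mat g⁻¹ * X * mat g) *ᵥ x = y := by
    intro g X x y h
    rw [← Matrix.mulVec_mulVec, ← Matrix.mulVec_mulVec, h, mat_inv_mulVec]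
  have hso : ∀ (g : SO (2 * l)) (X : so (2 * l)), mat g⁻¹ * X.1 * mat g ∈ so (2 * l) := by
    intro g X
    simpa using conj_mem_so g⁻¹ X.2
  rcases hM.det_sq with hd | hd
  · refine ⟨hM.toSO hd, fun X hX => isUpper_of_mem_so (hso _ X) fun k hk x hx => ?_⟩
    obtain ⟨y, hy, e⟩ := hstab X hX k hk x hx
    rwa [hpull (hM.toSO hd) X.1 x y e]
  -- For determinant -1, M is multiplied by the middle swap; triangularity is then read off after
  -- conjugating by the swap.
  · have hMP := hM.mul (midSwap_isOrth hl)
    have hdet : (M * midSwap l hl).det = 1 := by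
      rw [Matrix.det_mul, hd, det_midSwap]
      norm_num
    refine ⟨hMP.toSO hdet, fun X hX => ?_⟩
    have hs := hso (hMP.toSO hdet) X
    rw [← swapConj_swapConj hl (mat (hMP.toSO hdet)⁻¹ * X.1 * mat (hMP.toSO hdet))]
    refine swapConj_isUpper hl (swapConj_mem_so hl hs)
      (isUpper_of_mem_so (swapConj_mem_so hl hs) fun k hk x hx => ?_)
    obtain ⟨y, hy, e⟩ := hstab X hX k hk x hx
    have h1 := hpull (hMP.toSO hdet) X.1 (midSwap l hl *ᵥ x) (midSwap l hl *ᵥ y) (by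
      rw [hMP.mat_toSO, ← Matrix.mulVec_mulVec, ← Matrix.mulVec_mulVec, midSwap_midSwap,
        midSwap_midSwap, e])
    rw [swapConj_mulVec, h1, midSwap_midSwap]
    exact hy

theorem mem_map_Ad_stdBorel {n : ℕ} (g : SO n) (X : so n) :
    X ∈ (stdBorel n).map (Ad g).toLieHom ↔ IsUpper (mat g⁻¹ * X.1 * mat g) := by
  have key : (((Ad g).symm X : so n) : Matrix (Fin n) (Fin n) ℂ) = mat g⁻¹ * X.1 * mat g := rfl
  rw [← key, LieSubalgebra.mem_map]
  constructor
  · rintro ⟨Y, hY, rfl⟩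
    have : (Ad g).symm ((Ad g).toLieHom Y) = Y := (Ad g).symm_apply_apply Y
    rw [this]
    exact hY
  · exact fun h => ⟨(Ad g).symm X, h, (Ad g).apply_symm_apply X⟩

/-- A solvable algebra containing it lies in a conjugate of it, which has the same dimension, so all
three coincide. -/
theorem isBorel_stdBorel (hl : 1 ≤ l) : IsBorel (stdBorel (2 * l)) := by
  refine ⟨isSolvable_stdBorel, fun c hc hle => ?_⟩
  obtain ⟨g, hg⟩ := exists_conj_isUpper hl c hc
  have h1 : c ≤ (stdBorel (2 * l)).map (Ad g).toLieHom :=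
    fun X hX => (mem_map_Ad_stdBorel g X).2 (hg X hX)
  have h2 : (stdBorel (2 * l)).toSubmodule =
      ((stdBorel (2 * l)).map (Ad g).toLieHom).toSubmodule := by
    refine eq_of_le_of_finrank_eq (fun X hX => h1 (hle hX)) ?_
    exact (LinearEquiv.finrank_map_eq (Ad g).toLinearEquiv (stdBorel (2 * l)).toSubmodule).symm
  intro X hX
  have h3 : X ∈ ((stdBorel (2 * l)).map (Ad g).toLieHom).toSubmodule := h1 hX
  rw [← h2] at h3
  exact h3

/-- The standard Borel subalgebra as a point of the flag variety. -/
def stdPoint (l : ℕ) (hl : 1 ≤ l) : FlagVariety (2 * l) := ⟨stdBorel (2 * l), isBorel_stdBorel hl⟩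

/-- All Borel subalgebras are conjugate. -/
theorem exists_smul_stdPoint (hl : 1 ≤ l) (b : FlagVariety (2 * l)) :
    ∃ g : SO (2 * l), b = g • stdPoint l hl := by
  obtain ⟨g, hg⟩ := exists_conj_isUpper hl b.1 b.2.1
  refine ⟨g, Subtype.ext ?_⟩
  have h1 : b.1 ≤ (stdBorel (2 * l)).map (Ad g).toLieHom :=
    fun X hX => (mem_map_Ad_stdBorel g X).2 (hg X hX)
  exact le_antisymm h1 (b.2.2 (isSolvable_map_Ad g _ isSolvable_stdBorel) h1)

theorem smul_stdPoint_of_isUpper (hl : 1 ≤ l) {g : SO (2 * l)} (hg : IsUpper (mat g)) :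
    g • stdPoint l hl = stdPoint l hl := by
  have hg' : IsUpper (mat g⁻¹) := (upperBorel (2 * l)).inv_mem (x := g) hg
  apply Subtype.ext
  have h : stdBorel (2 * l) ≤ (stdBorel (2 * l)).map (Ad g).toLieHom :=
    fun X hX => (mem_map_Ad_stdBorel g X).2 ((hg'.mul hX).mul hg)
  exact le_antisymm ((isBorel_stdBorel hl).2 (isSolvable_map_Ad g _ isSolvable_stdBorel) h) h

end BorelSubalgebras

/-! ### The standard Borel subalgebra is stabilised only by upper triangular matrices -/

section Normalizer

variable {n : ℕ}

/-- The root vector `E_{am} - E_{m* a*}` of `𝔰𝔬(n)`. -/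
def rootVec (a m : Fin n) : Matrix (Fin n) (Fin n) ℂ :=
  Matrix.single a m 1 - Matrix.single m.rev a.rev 1

theorem rootVec_mem_so (a m : Fin n) : rootVec a m ∈ so n := by
  rw [mem_so_iff_entries]
  intro i j
  have h1 : (a = j.rev ∧ m = i.rev) ↔ (m.rev = i ∧ a.rev = j) := by
    rw [Fin.rev_eq_iff, Fin.rev_eq_iff, and_comm]
  have h2 : (m.rev = j.rev ∧ a.rev = i.rev) ↔ (a = i ∧ m = j) := by
    rw [Fin.rev_inj, Fin.rev_inj, and_comm]
  simp only [rootVec, Matrix.sub_apply, Matrix.single_apply, h1, h2, neg_sub]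

theorem rootVec_isUpper {a m : Fin n} (h : a < m) : IsUpper (rootVec a m) := by
  intro i j hij
  have h' : m.rev < a.rev := Fin.rev_lt_rev.2 h
  have h1 : ¬ (a = i ∧ m = j) := by
    rintro ⟨rfl, rfl⟩
    exact lt_asymm h hij
  have h2 : ¬ (m.rev = i ∧ a.rev = j) := by
    rintro ⟨rfl, rfl⟩
    exact lt_asymm h' hij
  simp [rootVec, h1, h2]

theorem rootVec_mulVec {a m : Fin n} (h : a ≠ m.rev) (x : Fin n → ℂ) :
    (rootVec a m *ᵥ x) a = x m := by
  simp [rootVec, Matrix.sub_mulVec, Matrix.single_mulVec, h]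

/-- A regular diagonal element of `𝔰𝔬(n)`. -/
def regularDiag (n : ℕ) : Matrix (Fin n) (Fin n) ℂ :=
  Matrix.diagonal fun i => (n : ℂ) - 1 - 2 * (i : ℕ)

theorem regularDiag_mem_so : regularDiag n ∈ so n := by
  rw [mem_so_iff_entries]
  intro i j
  by_cases h : i = j
  · subst h
    simp only [regularDiag, Matrix.diagonal_apply_eq, Fin.rev]
    rw [Nat.cast_sub (by omega)]
    push_cast
    ring
  · simp [regularDiag, Matrix.diagonal_apply_ne _ h, Ne.symm h]

theorem regularDiag_isUpper : IsUpper (regularDiag n) := by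
  intro i j hij
  exact Matrix.diagonal_apply_ne _ hij.ne'

/-- An element of `SO(2ℓ)` normalising the standard Borel subalgebra is upper triangular. -/
theorem isUpper_of_smul_stdPoint {l : ℕ} (hl : 1 ≤ l) {g : SO (2 * l)}
    (hg : g • stdPoint l hl = stdPoint l hl) : IsUpper (mat g) := by
  have hconj : ∀ X ∈ so (2 * l), IsUpper X → IsUpper (mat g⁻¹ * X * mat g) := by
    intro X hX hU
    have h : (stdBorel (2 * l)).map (Ad g).toLieHom = stdBorel (2 * l) := congrArg Subtype.val hg
    apply (mem_map_Ad_stdBorel g ⟨X, hX⟩).1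
    rw [h]
    exact hU
  have hM := mat_isOrth g
  refine hM.isUpper_of_det hl (det_mat g) ?_
  intro k
  induction k with
  | zero =>
    intro _ x hx
    have : x = 0 := funext fun i => hx i (Nat.zero_le _)
    simp [this]
  | succ k ih =>
    intro hk
    have ih := ih (by omega)
    set e : Fin (2 * l) → ℂ := Pi.single ⟨k, by omega⟩ 1 with he
    set w := mat g *ᵥ e with hw
    have hwV : w ∉ coordSub (2 * l) k := by
      intro h
      have := mem_coordSub_of_mulVec_mem hM.injective ih h
      rw [he, single_mem_coordSub] at this
      exact lt_irrefl _ this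
    -- Since g normalises the Borel subalgebra, w = g e_k is, like e_k, a common eigenvector modulo
    -- the first k basis vectors.
    have heig : ∀ X ∈ so (2 * l), IsUpper X → ∃ c : ℂ, ∀ i : Fin (2 * l), k ≤ i →
        (X *ᵥ w) i = c * w i := by
      intro X hX hU
      have h1 : (mat g⁻¹ * X * mat g) *ᵥ e ∈ coordSub (2 * l) (k + 1) :=
        (hconj X hX hU).mulVec_mem (by rw [he, single_mem_coordSub]; simp)
      rw [coordSub_succ (by omega)] at h1
      obtain ⟨c, v, hv, h2⟩ := mem_span_sup_iff.1 h1
      refine ⟨c, fun i hi => ?_⟩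
      have h3 := congrArg (fun y => mat g *ᵥ y) h2
      simp only [← Matrix.mulVec_mulVec, mat_mulVec_inv, Matrix.mulVec_add,
        Matrix.mulVec_smul] at h3
      have h4 := congrFun h3 i
      rw [hw, h4, Pi.add_apply, ih v hv i hi, add_zero]
      rfl
    obtain ⟨m, hkm, hwm⟩ : ∃ m : Fin (2 * l), k ≤ m ∧ w m ≠ 0 := by
      by_contra! hc
      exact hwV hc
    obtain ⟨c, hc⟩ := heig _ regularDiag_mem_so regularDiag_isUpper
    have hc' : ∀ i : Fin (2 * l), k ≤ i → ((2 * l : ℕ) - 1 - 2 * (i : ℕ) - c : ℂ) * w i = 0 := by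
      intro i hi
      have := hc i hi
      rw [regularDiag, Matrix.mulVec_diagonal] at this
      linear_combination this
    have hcm : ((2 * l : ℕ) - 1 - 2 * (m : ℕ) - c : ℂ) = 0 :=
      (mul_eq_zero.1 (hc' m hkm)).resolve_right hwm
    -- The regular diagonal element has distinct eigenvalues, so w is a multiple of a single e_m
    -- modulo the first k basis vectors.
    have honly : ∀ i : Fin (2 * l), k ≤ i → i ≠ m → w i = 0 := by
      intro i hi him
      refine (mul_eq_zero.1 (hc' i hi)).resolve_left fun h => him (Fin.ext ?_)
      have h5 : ((i : ℕ) : ℂ) = (m : ℕ) := by linear_combination (hcm - h) / 2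
      exact_mod_cast h5
    have hroot : ∀ a : Fin (2 * l), k ≤ a → a < m → a = m.rev := by
      intro a hka ham
      by_contra hne
      obtain ⟨d, hd⟩ := heig _ (rootVec_mem_so a m) (rootVec_isUpper ham)
      have := hd a hka
      rw [rootVec_mulVec hne, honly a hka ham.ne, mul_zero] at this
      exact hwm this
    -- If k < m, the root vectors into rows k and k + 1 would force both k and k + 1 to equal
    -- `m.rev`; row k + 1 is still above m because k + 1 < l.
    have hmk : (m : ℕ) = k := by
      by_contra hne
      have hlt : (⟨k, by omega⟩ : Fin (2 * l)) < m := by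
        rw [Fin.lt_def]
        simp
        omega
      have h1 := hroot ⟨k, by omega⟩ le_rfl hlt
      have h1' := congrArg Fin.val h1
      simp [Fin.rev] at h1'
      have h2 := hroot ⟨k + 1, by omega⟩ (by simp) (by rw [Fin.lt_def]; simp; omega)
      rw [← h1] at h2
      have := congrArg Fin.val h2
      simp at this
    intro x hx
    rw [coordSub_succ (by omega)] at hx
    obtain ⟨a, v, hv, rfl⟩ := mem_span_sup_iff.1 hx
    rw [Matrix.mulVec_add, Matrix.mulVec_smul]
    refine add_mem (smul_mem _ _ fun i hi => ?_) (coordSub_mono (Nat.le_succ k) (ih v hv))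
    exact honly i (by omega) fun h => by
      rw [h] at hi
      omega

end Normalizer

/-! ### Images of flags under isometries -/

section Transport

variable {V : Type*} [AddCommGroup V] [Module ℂ V] [FiniteDimensional ℂ V]
  {B : LinearMap.BilinForm ℂ V}

theorem NondegOn.injective_of_isometry (hB : NondegOn B ⊤) {f : V →ₗ[ℂ] V}
    (hf : ∀ x y, B (f x) (f y) = B x y) : Function.Injective f := by
  rw [← ker_eq_bot, ker_eq_bot']
  intro x hx
  refine hB x mem_top fun y _ => ?_
  rw [← hf, hx, map_zero, LinearMap.zero_apply]

theorem IsFullFlag.map {F : ℕ → Submodule ℂ V} (hF : IsFullFlag B ⊤ F) (hB : NondegOn B ⊤)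
    {f : V →ₗ[ℂ] V} (hf : ∀ x y, B (f x) (f y) = B x y) :
    IsFullFlag B ⊤ fun j => (F j).map f := by
  have hinj := hB.injective_of_isometry hf
  refine ⟨⟨fun i j hij => Submodule.map_mono (hF.isFlag.mono hij), fun j => ?_, ?_⟩,
    fun _ => le_top⟩
  · rw [← (Submodule.equivMapOfInjective _ hinj _).finrank_eq, hF.isFlag.finrank_eq]
  · rintro j _ ⟨x, hx, rfl⟩ _ ⟨y, hy, rfl⟩
    rw [hf, hF.isFlag.isotropic j x hx y hy]

end Transport

/-! ### Orbits correspond to codes -/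

section Orbits

variable {l : ℕ}

theorem mulVecLin_isometry {n : ℕ} {M : Matrix (Fin n) (Fin n) ℂ} (hM : IsOrth M)
    (x y : Fin n → ℂ) : stdForm n (M.mulVecLin x) (M.mulVecLin y) = stdForm n x y := by
  rw [stdForm_apply, stdForm_apply]
  exact hM x y

theorem isOrth_toMatrix' {n : ℕ} {f : (Fin n → ℂ) →ₗ[ℂ] (Fin n → ℂ)}
    (hf : ∀ x y, stdForm n (f x) (f y) = stdForm n x y) : IsOrth (LinearMap.toMatrix' f) := by
  intro x y
  rw [LinearMap.toMatrix'_mulVec, LinearMap.toMatrix'_mulVec, ← stdForm_apply, hf, stdForm_apply]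

/-- The configuration consisting of the vector fixed by `K`, the flag fixed by its Borel subgroup
and the `g`-translate of the standard flag. -/
def baseConfig (l : ℕ) (g : SO (2 * l)) : Config (Fin (2 * l) → ℂ) :=
  ⟨⊤, middleVec l, stdFlag (2 * l) (l - 1), fun j => (stdFlag (2 * l) l j).map (mat g).mulVecLin⟩

theorem baseConfig_good (hl : 1 ≤ l) (g : SO (2 * l)) :
    (baseConfig l g).Good (stdForm (2 * l)) (2 * l - 1) := by
  refine ⟨?_, stdForm_nondeg, mem_top, ?_, stdFlag_isFullFlag_middle hl, ?_⟩
  · change finrank ℂ (⊤ : Submodule ℂ (Fin (2 * l) → ℂ)) = _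
    rw [finrank_top, finrank_fin_fun]
    omega
  · change stdForm (2 * l) (middleVec l) (middleVec l) ≠ 0
    rw [middleVec_norm l hl]
    norm_num
  · have h := stdFlag_isFullFlag (n := 2 * l)
    rw [show 2 * l / 2 = l by omega] at h
    exact h.map stdForm_nondeg (mulVecLin_isometry (mat_isOrth g))

theorem midSwap_middleVec (hl : 1 ≤ l) : midSwap l hl *ᵥ middleVec l = -middleVec l := by
  funext i
  rw [midSwap_mulVec, Equiv.swap_apply_def, Pi.neg_apply]
  have h1 : l - 1 + 1 = l := by omega
  have h2 : ¬ l - 1 = l := by omega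
  split_ifs with h3 h4
  · simp [h3, middleVec, h1]
  · simp [h4, middleVec, h1]
  · have h3' : (i : ℕ) + 1 ≠ l := fun h => h3 (Fin.ext (by simp; omega))
    have h4' : (i : ℕ) ≠ l := fun h => h4 (Fin.ext h)
    simp [middleVec, h3', h4']

/-- The vector fixed by `K` together with the standard flag of its orthogonal complement can be
moved to any other such pair. -/
theorem exists_isometry_middle (hl : 1 ≤ l) {u : Fin (2 * l) → ℂ}
    {E : ℕ → Submodule ℂ (Fin (2 * l) → ℂ)} (hu : stdForm (2 * l) u u = -2)
    (hE : IsFullFlag (stdForm (2 * l)) (⊤ ⊓ ker (stdForm (2 * l) u)) E) :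
    ∃ f : (Fin (2 * l) → ℂ) →ₗ[ℂ] (Fin (2 * l) → ℂ),
      (∀ x y, stdForm (2 * l) (f x) (f y) = stdForm (2 * l) x y) ∧ f u = middleVec l ∧
        ∀ j, (E j).map f = stdFlag (2 * l) (l - 1) j := by
  set B := stdForm (2 * l) with hBdef
  have hB : ∀ x y, B x y = B y x := stdForm_symm
  have hne : B u u ≠ 0 := by
    rw [hu]
    norm_num
  have hm : B (middleVec l) (middleVec l) = -2 := middleVec_norm l hl
  have hne' : B (middleVec l) (middleVec l) ≠ 0 := by
    rw [hm]
    norm_num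
  have hd := finrank_inf_ker (W := ⊤) mem_top hne
  have hd' := finrank_inf_ker (W := ⊤) mem_top hne'
  rw [finrank_top, finrank_fin_fun] at hd hd'
  have hnd : NondegOn B ⊤ := stdForm_nondeg
  have hE' : IsFullFlag B (⊤ ⊓ ker (B (middleVec l))) (stdFlag (2 * l) (l - 1)) :=
    stdFlag_isFullFlag_middle hl
  obtain ⟨f, hfU, hfB, hfE⟩ := exists_isometry_flags hB (2 * l - 1) (⊤ ⊓ ker (B u))
    (⊤ ⊓ ker (B (middleVec l))) E (stdFlag (2 * l) (l - 1)) (by omega) (by omega)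
    (hnd.inf_ker_of_ne hB mem_top hne) (hnd.inf_ker_of_ne hB mem_top hne') hE hE'
  have hperp : ∀ x ∈ ⊤ ⊓ ker (B u), B u x = 0 := fun x hx => hx.2
  obtain ⟨g, hgu, hg⟩ := exists_glue_vector hperp hne f (middleVec l)
  have hgB : ∀ x y, B (g x) (g y) = B x y := by
    intro x y
    have hx : x ∈ span ℂ {u} ⊔ ⊤ ⊓ ker (B u) := by rw [sup_inf_ker mem_top hne]; exact mem_top
    have hy : y ∈ span ℂ {u} ⊔ ⊤ ⊓ ker (B u) := by rw [sup_inf_ker mem_top hne]; exact mem_top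
    obtain ⟨a, v, hv, rfl⟩ := mem_span_sup_iff.1 hx
    obtain ⟨b, w, hw, rfl⟩ := mem_span_sup_iff.1 hy
    have h1 : B (middleVec l) (f v) = 0 := (hfU v hv).2
    have h2 : B (middleVec l) (f w) = 0 := (hfU w hw).2
    simp only [map_add, map_smul, hgu, hg v hv, hg w hw, LinearMap.add_apply,
      LinearMap.smul_apply, hfB v hv w hw, hB v u, hB (f v) (middleVec l), hperp v hv, hperp w hw,
      h1, h2, hu, hm]
  refine ⟨g, hgB, hgu, fun j => ?_⟩
  have hinj := hnd.injective_of_isometry hgB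
  refine eq_of_le_of_finrank_eq ?_ ?_
  · rintro _ ⟨x, hx, rfl⟩
    rw [hg x (hE.le j hx)]
    exact hfE j x hx
  · rw [← (Submodule.equivMapOfInjective _ hinj _).finrank_eq, hE.isFlag.finrank_eq,
      hE'.isFlag.finrank_eq]
    congr 1
    omega

/-- Every complete isotropic flag is the image of the standard one under an orthogonal matrix. -/
theorem exists_isOrth_map_stdFlag {F : ℕ → Submodule ℂ (Fin (2 * l) → ℂ)}
    (hF : IsFullFlag (stdForm (2 * l)) ⊤ F) :
    ∃ M : Matrix (Fin (2 * l)) (Fin (2 * l)) ℂ, IsOrth M ∧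
      (fun j => (stdFlag (2 * l) l j).map M.mulVecLin) = F := by
  have hstd := stdFlag_isFullFlag (n := 2 * l)
  rw [show 2 * l / 2 = l by omega] at hstd
  obtain ⟨f, -, hfB, hfF⟩ := exists_isometry_flags (B := stdForm (2 * l)) stdForm_symm (2 * l) ⊤ ⊤
    (stdFlag (2 * l) l) F (by simp) (by simp) stdForm_nondeg stdForm_nondeg hstd hF
  have hM := isOrth_toMatrix' fun x y => hfB x mem_top y mem_top
  refine ⟨_, hM, funext fun j => eq_of_le_of_finrank_eq ?_ ?_⟩
  · rintro _ ⟨x, hx, rfl⟩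
    rw [Matrix.mulVecLin_apply, LinearMap.toMatrix'_mulVec]
    exact hfF j x hx
  · rw [← (Submodule.equivMapOfInjective _ hM.injective _).finrank_eq, hstd.isFlag.finrank_eq,
      hF.isFlag.finrank_eq]

/-- A configuration of type c with vector of norm -2 can be moved so that its vector and first flag
are the standard ones; its second flag is then M applied to the standard flag for an orthogonal M,
and only det M = 1 has to be arranged. -/
theorem exists_baseConfig_hasType (hl : 1 ≤ l) (c : Code (2 * l - 1)) :
    ∃ g : SO (2 * l), HasType (stdForm (2 * l)) (2 * l - 1) c (baseConfig l g) := by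
  obtain ⟨T, hT, hTU, hTu⟩ := exists_hasType_of_code (B := stdForm (2 * l)) stdForm_symm
    (2 * l - 1) c ⊤ (-2) stdForm_nondeg (by rw [finrank_top, finrank_fin_fun]; omega) (by norm_num)
  have hgood := hT.good stdForm_symm
  have hE := hgood.E
  rw [hTU] at hE
  have hF := hgood.F
  rw [hTU] at hF
  obtain ⟨f, hf, hfu, hfE⟩ := exists_isometry_middle hl hTu hE
  have htop : ∀ {f : (Fin (2 * l) → ℂ) →ₗ[ℂ] (Fin (2 * l) → ℂ)},
      (∀ x y, stdForm (2 * l) (f x) (f y) = stdForm (2 * l) x y) →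
        (⊤ : Submodule ℂ (Fin (2 * l) → ℂ)).map f = ⊤ := by
    intro f hf
    rw [Submodule.map_top, LinearMap.range_eq_top]
    exact LinearMap.injective_iff_surjective.1 (stdForm_nondeg.injective_of_isometry hf)
  obtain ⟨M, hM, hMF⟩ := exists_isOrth_map_stdFlag (hF.map stdForm_nondeg hf)
  have h1 := hT.map hf
  have e1 : T.map f = ⟨⊤, middleVec l, stdFlag (2 * l) (l - 1),
      fun j => (stdFlag (2 * l) l j).map M.mulVecLin⟩ := by
    rw [Config.map, hTU, htop hf, hfu, hMF, funext hfE]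
  rw [e1] at h1
  rcases hM.det_sq with hd | hd
  · exact ⟨hM.toSO hd, h1⟩
  -- This matrix fixes `middleVec` and the members of dimension at most l - 1 of the standard flag,
  -- and has determinant -1 because the size is even.
  · have hneg : IsOrth (-midSwap l hl) := by
      intro x y
      rw [Matrix.neg_mulVec, Matrix.neg_mulVec, ← stdForm_apply, map_neg, map_neg,
        LinearMap.neg_apply, neg_neg, stdForm_apply, midSwap_isOrth hl]
    have hdet : (-midSwap l hl * M).det = 1 := by
      rw [Matrix.det_mul, Matrix.det_neg, det_midSwap, hd, Fintype.card_fin]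
      simp
    have h2 := h1.map (mulVecLin_isometry hneg)
    refine ⟨(hneg.mul hM).toSO hdet, ?_⟩
    convert h2 using 1
    rw [Config.map, baseConfig, htop (mulVecLin_isometry hneg)]
    congr 1
    · rw [Matrix.mulVecLin_apply, Matrix.neg_mulVec, midSwap_middleVec, neg_neg]
    · funext j
      refine (eq_of_le_of_finrank_eq ?_
        (Submodule.equivMapOfInjective _ hneg.injective _).finrank_eq.symm).symm
      rintro _ ⟨x, hx, rfl⟩
      rw [Matrix.mulVecLin_apply, Matrix.neg_mulVec]
      exact neg_mem (midSwap_mem hl (by omega) hx)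
    · funext j
      rw [← Submodule.map_comp, ← Matrix.mulVecLin_mul]
      rfl

/-- The isometry M between the two configurations fixes `middleVec` and the standard flag up to
dimension l - 1. As h⁻¹ M g preserves the full standard flag, it is triangular of determinant 1; so
det M = 1, and only then does the shorter flag force M to be triangular. -/
theorem exists_borelSub_of_hasType (hl : 1 ≤ l) {c : Code (2 * l - 1)} {g h : SO (2 * l)}
    (hg : HasType (stdForm (2 * l)) (2 * l - 1) c (baseConfig l g))
    (hh : HasType (stdForm (2 * l)) (2 * l - 1) c (baseConfig l h)) :
    ∃ k ∈ borelSub l, k • g • stdPoint l hl = h • stdPoint l hl := by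
  obtain ⟨f, -, hfB, hfu, hfE, hfF⟩ := HasType.dom stdForm_symm _ c _ _ hg hh rfl
  have hM := isOrth_toMatrix' fun x y => hfB x mem_top y mem_top
  set M := LinearMap.toMatrix' f with hMf
  have hMx : ∀ x, M *ᵥ x = f x := fun x => by rw [hMf, LinearMap.toMatrix'_mulVec]
  have hN := ((mat_isOrth h⁻¹).mul hM).mul (mat_isOrth g)
  have hNU : IsUpper (mat h⁻¹ * M * mat g) := by
    refine hN.isUpper ?_ (even_two_mul l)
    rw [show 2 * l / 2 = l by omega]
    intro k hk x hx
    have hst : stdFlag (2 * l) l k = coordSub (2 * l) k := by rw [stdFlag, min_eq_left hk]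
    obtain ⟨y, hy, e⟩ := hfF k (mat g *ᵥ x) ⟨x, by rw [hst]; exact hx, rfl⟩
    rw [hst] at hy
    rw [← Matrix.mulVec_mulVec, ← Matrix.mulVec_mulVec, hMx, ← e, Matrix.mulVecLin_apply,
      mat_inv_mulVec]
    exact hy
  have hdet : M.det = 1 := by
    have := hN.det_of_isUpper hNU (even_two_mul l)
    rwa [Matrix.det_mul, Matrix.det_mul, det_mat, det_mat, one_mul, mul_one] at this
  have hMU : IsUpper M := by
    refine hM.isUpper_of_det hl hdet fun k hk x hx => ?_
    have hst : stdFlag (2 * l) (l - 1) k = coordSub (2 * l) k := by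
      rw [stdFlag, min_eq_left (by omega)]
    have h1 : f x ∈ stdFlag (2 * l) (l - 1) k :=
      hfE k x (show x ∈ stdFlag (2 * l) (l - 1) k by rwa [hst])
    rwa [hst, ← hMx] at h1
  refine ⟨hM.toSO hdet, ⟨?_, hMU⟩, ?_⟩
  · exact (hMx _).trans hfu
  · have h1 : IsUpper (mat (h⁻¹ * hM.toSO hdet * g)) := by
      rw [mat_mul, mat_mul]
      exact hNU
    have h2 := smul_stdPoint_of_isUpper hl h1
    rw [mul_smul, mul_smul, inv_smul_eq_iff] at h2
    exact h2

theorem dom_baseConfig (hl : 1 ≤ l) {g h k : SO (2 * l)} (hk : k ∈ borelSub l)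
    (he : k • g • stdPoint l hl = h • stdPoint l hl) :
    Dom (stdForm (2 * l)) (baseConfig l g) (baseConfig l h) := by
  have hU : IsUpper (mat (h⁻¹ * k * g)) := by
    apply isUpper_of_smul_stdPoint hl
    rw [mul_smul, mul_smul, he, inv_smul_smul]
  have hkU : IsUpper (mat k) := hk.2
  refine ⟨(mat k).mulVecLin, fun _ _ => mem_top,
    fun x _ y _ => mulVecLin_isometry (mat_isOrth k) x y, hk.1, fun j x hx => hkU.mulVec_mem hx, ?_⟩
  rintro j _ ⟨x, hx, rfl⟩
  refine ⟨mat (h⁻¹ * k * g) *ᵥ x, hU.mulVec_mem hx, ?_⟩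
  rw [mat_mul, mat_mul, ← Matrix.mulVec_mulVec, ← Matrix.mulVec_mulVec, Matrix.mulVecLin_apply,
    mat_mulVec_inv, Matrix.mulVecLin_apply, Matrix.mulVecLin_apply]

/-- The orbits are classified by the types of configurations. -/
theorem nonempty_orbits_equiv_code (hl : 1 ≤ l) : Nonempty (Orbits l ≃ Code (2 * l - 1)) := by
  have hex : ∀ c : Code (2 * l - 1), ∃ g : SO (2 * l),
      HasType (stdForm (2 * l)) (2 * l - 1) c (baseConfig l g) := exists_baseConfig_hasType hl
  choose γ hγ using hex
  let Φ : Code (2 * l - 1) → Orbits l := fun c => Quotient.mk'' (γ c • stdPoint l hl)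
  refine ⟨(Equiv.ofBijective Φ ⟨?_, ?_⟩).symm⟩
  · intro c c' h
    have h1 : (MulAction.orbitRel (borelSub l) (FlagVariety (2 * l))) (γ c • stdPoint l hl)
        (γ c' • stdPoint l hl) := Quotient.exact h
    rw [MulAction.orbitRel_apply] at h1
    obtain ⟨⟨k, hk⟩, e⟩ := h1
    have e : k • γ c' • stdPoint l hl = γ c • stdPoint l hl := e
    have e' : k⁻¹ • γ c • stdPoint l hl = γ c' • stdPoint l hl := by
      rw [← e, inv_smul_smul]
    exact HasType.eq_of_dom stdForm_symm _ c c' _ _ (hγ c) (hγ c')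
      (dom_baseConfig hl (inv_mem hk) e') (dom_baseConfig hl hk e)
  · intro o
    induction o using Quotient.inductionOn' with
    | h b =>
      obtain ⟨g, rfl⟩ := exists_smul_stdPoint hl b
      obtain ⟨c, hc⟩ := (baseConfig_good hl g).exists_hasType stdForm_symm
      refine ⟨c, Quotient.sound ?_⟩
      change (MulAction.orbitRel (borelSub l) (FlagVariety (2 * l))) _ _
      rw [MulAction.orbitRel_apply]
      obtain ⟨k, hk, e⟩ := exists_borelSub_of_hasType hl hc (hγ c)
      exact ⟨⟨k, hk⟩, e⟩

theorem subsingleton_flagVariety_zero : Subsingleton (FlagVariety (2 * 0)) := by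
  refine ⟨fun b c => Subtype.ext ?_⟩
  ext X
  have hX : X = 0 := by
    apply Subtype.ext
    ext i
    exact i.elim0
  rw [hX]
  exact ⟨fun _ => c.1.zero_mem, fun _ => b.1.zero_mem⟩

theorem nonempty_flagVariety_zero : Nonempty (FlagVariety (2 * 0)) := by
  refine ⟨⟨stdBorel _, isSolvable_stdBorel, fun c _ _ X _ => ?_⟩⟩
  intro i
  exact i.elim0

theorem card_orbits (l : ℕ) : Finite (Orbits l) ∧ Nat.card (Orbits l) = codeCount l := by
  cases l with
  -- The Lie algebra so(0) is zero and has exactly one Borel subalgebra.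
  | zero =>
    have := subsingleton_flagVariety_zero
    obtain ⟨b⟩ := nonempty_flagVariety_zero
    have h1 : Subsingleton (Orbits 0) := Quotient.instSubsingletonQuotient _
    have h2 : Nonempty (Orbits 0) := ⟨Quotient.mk'' b⟩
    exact ⟨inferInstance, Nat.card_eq_one_iff_unique.2 ⟨h1, h2⟩⟩
  | succ l =>
    obtain ⟨e⟩ := nonempty_orbits_equiv_code (l := l + 1) (by omega)
    have := Code.finite (2 * (l + 1) - 1)
    exact ⟨Finite.of_equiv _ e.symm, Nat.card_congr e⟩

end Orbits

end OrthFlag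

theorem propositionp :
    (∀ l : ℕ, Finite (OrthFlag.Orbits l)) ∧
      OrthFlag.egf (fun l => (Nat.card (OrthFlag.Orbits l) : ℂ)) =
        (PowerSeries.exp ℂ).subst
          ((PowerSeries.X : PowerSeries ℂ) * (1 - 2 * (PowerSeries.X : PowerSeries ℂ))⁻¹) := by
  refine ⟨fun l => (OrthFlag.card_orbits l).1, ?_⟩
  simp only [fun l => (OrthFlag.card_orbits l).2]
  exact OrthFlag.egf_codeCount
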